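/- **Theorem (analogue of Selberg's formula for Motohashi's product).** Let $T_1,T_2\in\mathbb R$ and $z>1$. For integers $d\ge1$ put \[ \lambda_d(z)=\begin{cases}\mu(d)&\text{if } d<z,\\ \mu(d)\dfrac{\log(z^2/d)}{\log z}&\text{if } z\le d<z^2,\\ 0&\text{otherwise,}\end{cases} \] \[ P_d(s)=\prod_{p\mid d}\left(1-\left(1-p^{-s}\right)\left(1-p^{-(s-iT_1)}\right)\left(1-p^{-(s+iT_2)}\right)\left(1-p^{-(s-i(T_1-T_2))}\right)\left(1-p^{-(2s-i(T_1-T_2))}\right)^{-1}\right), \] \[ J(s)=\frac{\zeta(s)\zeta(s-iT_1)\zeta(s+iT_2)\zeta(s-i(T_1-T_2))}{\zeta(2s-i(T_1-T_2))},\qquad K(s)=\sum_{d\le z^2}\lambda_d(z)P_d(s), \] and let $Z(s)=J(s)K(s)$ (Motohashi's product), a meromorphic function on $\mathbb C$. Then: (a) For $\Re s$ sufficiently large, $\dfrac{Z'}{Z}(s)$ is given by an absolutely convergent Dirichlet series $\dfrac{Z'}{Z}(s)=\sum_{n\ge2}\Sigma(n)n^{-s}$; this defines the coefficients $\Sigma(n)$,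 and $\Sigma(1)=0$. (b) Every pole $\nu$ of $K$ is of the form $\nu=i\left(\frac{\pi k}{\log p}+\frac12(T_1-T_2)\right)$ with $k\in\mathbb Z$ and $p<z^2$ a prime. (c) Let $x>1$ and write \[ \Sigma_x(n)=\begin{cases}\Sigma(n)&\text{for }1\le n\le x,\\[2pt] \Sigma(n)\dfrac{\log^2\frac{x^3}n-2\log^2\frac{x^2}n}{2\log^2x}&\text{for }x\le n\le x^2,\\[6pt] \Sigma(n)\dfrac{\log^2\frac{x^3}n}{2\log^2x}&\text{for }x^2\le n\le x^3.\end{cases} \] Let $\rho$ run over the nontrivial zeros of $\zeta$ (those with $0<\Re\rho<1$), $q$ over $1,2,3,\dots$, $\nu$ over the poles of $K$ and $r$ over the zeros of $K$, and put \begin{align*} S_1&=\{1,\,1+iT_1,\,1-iT_2,\,1+i(T_1-T_2)\},&\overline S_1&=\{\tfrac12+\tfrac i2(T_1-T_2)\},\\ S_\rho&=\{\rho,\,\rho+iT_1,\,\rho-iT_2,\,\rho+i(T_1-T_2)\},&\overline S_\rho&=\{\tfrac\rho2+\tfrac i2(T_1-T_2)\},\\ S_{-2q}&=\{-2q,\,-2q+iT_1,\,-2q-iT_2,\,-2q+i(T_1-T_2)\},&\overline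 S_{-2q}&=\{-q+\tfrac i2(T_1-T_2)\},\\ S_\nu&=\{\nu\},&S_r&=\{r\}. \end{align*} Then for every $s\in\mathbb C$ lying in none of these sets, \[ \frac{Z'}{Z}(s)=\sum_{n<x^3}\frac{\Sigma_x(n)}{n^s} +\sum_{u\in S_1\cup\overline S_\rho\cup\overline S_{-2q}\cup S_\nu}\frac{x^{u-s}(1-x^{u-s})^2}{\log^2x\,(u-s)^3} -\sum_{u\in\overline S_1\cup S_\rho\cup S_{-2q}\cup S_r}\frac{x^{u-s}(1-x^{u-s})^2}{\log^2x\,(u-s)^3}, \] where all the sums converge absolutely and zeros and poles are counted according to their multiplicities: each $\rho$ with its multiplicity as a zero of $\zeta$, each $\nu$ and $r$ with its multiplicity as a pole or zero of $K$, and a point that occurs in several families, or for several of the four shifts, once for each occurrence. -/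

import Mathlib

open Complex Filter Topology

noncomputable section

namespace Motohashi

/-- The weights `ξ(d) = λ_d(z)`. -/
def lam (z : ℝ) (d : ℕ) : ℝ :=
  if (d : ℝ) < z then (ArithmeticFunction.moebius d : ℝ)
  else if (d : ℝ) < z ^ 2 then
    (ArithmeticFunction.moebius d : ℝ) * (Real.log (z ^ 2 / d) / Real.log z)
  else 0

/-- The product `P_d(s, T₁, T₂)` over the primes dividing `d`. -/
def P (T₁ T₂ : ℝ) (d : ℕ) (s : ℂ) : ℂ :=
  ∏ p ∈ d.primeFactors,
    (1 - (1 - 1 / (p : ℂ) ^ s) * (1 - 1 / (p : ℂ) ^ (s - I * T₁))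
        * (1 - 1 / (p : ℂ) ^ (s + I * T₂)) * (1 - 1 / (p : ℂ) ^ (s - I * (T₁ - T₂)))
        * (1 - 1 / (p : ℂ) ^ (2 * s - I * (T₁ - T₂)))⁻¹)

/-- The factor `J(s, T₁, T₂)`. -/
def J (T₁ T₂ : ℝ) (s : ℂ) : ℂ :=
  riemannZeta s * riemannZeta (s - I * T₁) * riemannZeta (s + I * T₂)
    * riemannZeta (s - I * (T₁ - T₂)) / riemannZeta (2 * s - I * (T₁ - T₂))

/-- The factor `K(s, T₁, T₂) = ∑_{d ≤ z²} λ_d(z) P_d(s, T₁, T₂)`. -/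
def K (T₁ T₂ z : ℝ) (s : ℂ) : ℂ :=
  ∑ d ∈ Finset.Icc 1 ⌊z ^ 2⌋₊, (lam z d : ℂ) * P T₁ T₂ d s

theorem meromorphicAt_riemannZeta (w : ℂ) : MeromorphicAt riemannZeta w := by
  by_cases hw : w = 1
  · subst hw
    have h1 : AnalyticAt ℂ (Function.update (fun s : ℂ => (s - 1) * riemannZeta s) 1 1) 1 := by
      apply Complex.analyticAt_of_differentiable_on_punctured_nhds_of_continuousAt
      · filter_upwards [self_mem_nhdsWithin] with s hs
        have : DifferentiableAt ℂ (fun s : ℂ => (s - 1) * riemannZeta s) s :=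
          (differentiableAt_id.sub_const 1).mul (differentiableAt_riemannZeta hs)
        refine this.congr_of_eventuallyEq ?_
        filter_upwards [isOpen_ne.mem_nhds hs] with t ht
        simp [Function.update_of_ne ht]
      · exact continuousAt_update_same.2 riemannZeta_residue_one
    have h2 : MeromorphicAt (fun s : ℂ => (s - 1)⁻¹ * Function.update (fun s : ℂ => (s - 1) * riemannZeta s) 1 1 s) 1 :=
      (MeromorphicAt.inv (by fun_prop)).mul h1.meromorphicAt
    refine h2.congr ?_
    filter_upwards [self_mem_nhdsWithin] with s hs
    have : s - 1 ≠ 0 := sub_ne_zero.2 hs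
    simp [Function.update_of_ne hs]
    field_simp
  · refine AnalyticAt.meromorphicAt ?_
    refine (DifferentiableOn.analyticAt (s := {1}ᶜ) ?_ (isOpen_ne.mem_nhds hw))
    intro s hs
    exact (differentiableAt_riemannZeta hs).differentiableWithinAt

theorem meromorphicOn_J_mul_K (T₁ T₂ z : ℝ) : MeromorphicOn (fun s => J T₁ T₂ s * K T₁ T₂ z s) Set.univ := by
  intro s _
  have e : ∀ a b : ℂ, MeromorphicAt (fun t => riemannZeta (a * t + b)) s := by
    intro a b
    exact (meromorphicAt_riemannZeta _).comp_analyticAt (f := riemannZeta) (g := fun t => a * t + b) (by fun_prop)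
  refine MeromorphicAt.mul ?_ ?_
  · unfold J
    refine MeromorphicAt.div (MeromorphicAt.mul (MeromorphicAt.mul (MeromorphicAt.mul ?_ ?_) ?_) ?_) ?_
    · exact meromorphicAt_riemannZeta s
    · simpa [sub_eq_add_neg] using e 1 (-(I * T₁))
    · simpa using e 1 (I * T₂)
    · simpa [sub_eq_add_neg] using e 1 (-(I * (T₁ - T₂)))
    · simpa [sub_eq_add_neg] using e 2 (-(I * (T₁ - T₂)))
  · unfold K P
    refine MeromorphicAt.fun_sum fun d _ => ?_
    refine MeromorphicAt.mul (MeromorphicAt.const _ _) (MeromorphicAt.fun_prod fun p hp => ?_)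
    have hp0 : (p : ℂ) ≠ 0 := by exact_mod_cast (Nat.prime_of_mem_primeFactors hp).ne_zero
    have hc : ∀ g : ℂ → ℂ, Differentiable ℂ g → MeromorphicAt (fun t => 1 - 1 / (p : ℂ) ^ g t) s := by
      intro g hg
      have : AnalyticAt ℂ (fun t => (p : ℂ) ^ g t) s :=
        Differentiable.analyticAt (hg.const_cpow (Or.inl hp0)) s
      exact (MeromorphicAt.const _ _).sub ((MeromorphicAt.const _ _).div this.meromorphicAt)
    refine (MeromorphicAt.const _ _).sub (((((hc _ ?_).mul (hc _ ?_)).mul (hc _ ?_)).mul (hc _ ?_)).mul (hc _ ?_).inv) <;> fun_prop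

/-- Motohashi's product `Z = J K` as a meromorphic function on `ℂ`. The normal form changes the
pointwise product only on a discrete set: it gives removable singularities their limit value
(the bare Lean expression takes a junk value wherever a zeta factor or a `P_d` divides by zero). -/
def Z (T₁ T₂ z : ℝ) : ℂ → ℂ :=
  toMeromorphicNFOn (fun s => J T₁ T₂ s * K T₁ T₂ z s) Set.univ

/-- `c` is the sequence of coefficients of the Dirichlet series of `Z'/Z`: the series
`∑ c(n) n^{-s}` converges absolutely to `Z'/Z (s)` for all `s` of sufficiently large real part. -/
def IsLogDerivCoeff (T₁ T₂ z : ℝ) (c : ℕ → ℂ) : Prop :=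
  ∃ σ₀ : ℝ, ∀ s : ℂ, σ₀ < s.re → LSeriesHasSum c s (logDeriv (Z T₁ T₂ z) s)

/-- The smoothed coefficients `Σ_x(n)` made from the coefficients `c(n) = Σ(n)`. -/
def smoothed (x : ℝ) (c : ℕ → ℂ) (n : ℕ) : ℂ :=
  if (n : ℝ) ≤ x then c n
  else if (n : ℝ) ≤ x ^ 2 then
    c n * (((Real.log (x ^ 3 / n) ^ 2 - 2 * Real.log (x ^ 2 / n) ^ 2)
      / (2 * Real.log x ^ 2) : ℝ) : ℂ)
  else if (n : ℝ) ≤ x ^ 3 then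
    c n * ((Real.log (x ^ 3 / n) ^ 2 / (2 * Real.log x ^ 2) : ℝ) : ℂ)
  else 0

/-- The kernel `x^{u-s} (1 - x^{u-s})² / (log² x · (u-s)³)`. -/
def kernel (x : ℝ) (s u : ℂ) : ℂ :=
  (x : ℂ) ^ (u - s) * (1 - (x : ℂ) ^ (u - s)) ^ 2 / ((Real.log x : ℂ) ^ 2 * (u - s) ^ 3)

/-- Multiplicity of `u` as a zero of `f` (`0` if `u` is not a zero). -/
def zeroMult (f : ℂ → ℂ) (u : ℂ) : ℕ := (meromorphicOrderAt f u).untop₀.toNat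

/-- Multiplicity of `u` as a pole of `f` (`0` if `u` is not a pole). -/
def poleMult (f : ℂ → ℂ) (u : ℂ) : ℕ := (-(meromorphicOrderAt f u).untop₀).toNat

/-- The complex (nontrivial) zeros `ρ` of the zeta function. -/
def zetaZeros : Set ℂ := {ρ | riemannZeta ρ = 0 ∧ 0 < ρ.re ∧ ρ.re < 1}

/-- The zeros `r` of `K`, as a meromorphic function. -/
def zerosK (T₁ T₂ z : ℝ) : Set ℂ := {r | 0 < meromorphicOrderAt (K T₁ T₂ z) r}

/-- The poles `ν` of `K`, as a meromorphic function. -/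
def polesK (T₁ T₂ z : ℝ) : Set ℂ := {ν | meromorphicOrderAt (K T₁ T₂ z) ν < 0}

/-- The four shifts `0, iT₁, -iT₂, i(T₁-T₂)` of the zeta factors in the numerator of `J`. -/
def shift (T₁ T₂ : ℝ) : Fin 4 → ℂ := ![0, I * T₁, -(I * T₂), I * (T₁ - T₂)]

/-- The point `w/2 + (i/2)(T₁-T₂)` at which the denominator of `J` is `ζ(w)`. -/
def half (T₁ T₂ : ℝ) (w : ℂ) : ℂ := w / 2 + I / 2 * (T₁ - T₂)

/-- The trivial zero `-2q` of the zeta function, where `q = 1, 2, 3, …`. -/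
def trivialZero (q : ℕ+) : ℂ := -2 * ((q : ℕ) : ℂ)

end Motohashi

end

/-! `Z'/Z` is a signed sum of logarithmic derivatives of entire functions: shifts of `(s - 1) ζ(s)`
(`riemannZeta₁`), linear factors, and a numerator and denominator of `K`, which are exponential
polynomials. Each of them is bounded by `exp (C (1 + |w|)²)`, a crude bound that is all the argument
needs.

Such an `f` has `O(R²)` zeros in a disc of radius `R` (`exists_count_bound`), so `∑ m(u) / |u|³`
converges. Once the zeros of the disc are divided out, Borel–Carathéodory makes the third Taylor
remainder of the remaining logarithmic derivative `O(R⁻²)` (`exists_taylorRem_logDeriv_bound`).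
Letting `R → ∞` and centring at `s` gives, for `L = f'/f`, `L(w) = L(s) + a (w - s) + b (w - s)² +
(w - s)³ ∑ m(u) / ((u - s)³ (w - u))` (`QuadGrowth.hasExpansion`). Expansions of this shape are
stable under linear combinations, hence hold for `Z'/Z` (`hasExpansion_logDeriv_Z`).

No contour is moved. Put `w = s + p` and divide by `p³`. On a vertical line far to the right both
sides are Laplace transforms: `n^{-p} / p³` comes from `(t - log n)₊² / 2`, the powers of `1/p` come
from a quadratic in `t`, and `1 / (p - (u - s))` comes from `e^{(u - s) t}`. Fourier inversion
identifies the originals (`HasExpansion.truncated_sum_eq`): `∑ c(n) n^{-s} (t - log n)₊² / 2 = b + a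
t + L(s) t² / 2 + ∑ m(u) e^{(u - s) t} / (u - s)³`. The second difference over `t = log x, 2 log x,
3 log x` kills `b + a t`, turns `t² / 2` into `log² x`, and turns `e^{(u - s) t}` into `x^{u-s} (1 -
x^{u-s})²`. On the left it produces the weights of `Σ_x`. This is `HasExpansion.explicit_formula`.

The remaining inputs are the growth of zeta (`quadGrowth_riemannZeta₁`), the simplicity of its
trivial zeros, and the fact that a Dirichlet series with first coefficient `1` is invertible far to
the right (`HasDirichlet.inv`), which yields part (a). Part (b) holds because the only denominators
in `K` are the Euler factors `1 - p^{-(2s - i(T₁ - T₂))}`. -/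

namespace Motohashi

/-! ### Entire functions of growth `exp (O(|w|²))` -/

/-- Entire functions whose modulus is at most `exp (C (1 + |w|)²)`. -/
structure QuadGrowth (f : ℂ → ℂ) : Prop where
  diff : Differentiable ℂ f
  bound : ∃ C : ℝ, 0 ≤ C ∧ ∀ w, ‖f w‖ ≤ Real.exp (C * (1 + ‖w‖) ^ 2)

/-- Compactness bounds `f` on the disc of radius `R`, and a larger constant absorbs that bound;
afterwards only large `‖w‖` has to be estimated. -/
theorem QuadGrowth.of_large {f : ℂ → ℂ} (hf : Differentiable ℂ f) {C R : ℝ}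
    (h : ∀ w, R ≤ ‖w‖ → ‖f w‖ ≤ Real.exp (C * (1 + ‖w‖) ^ 2)) : QuadGrowth f := by
  obtain ⟨B, hB⟩ := (isCompact_closedBall (0 : ℂ) R).exists_bound_of_continuousOn
    hf.continuous.continuousOn
  refine ⟨hf, |C| + |B|, by positivity, fun w => ?_⟩
  have h1 : 1 ≤ (1 + ‖w‖) ^ 2 := one_le_pow₀ (by linarith [norm_nonneg w])
  rcases le_total R ‖w‖ with hR | hR
  · refine (h w hR).trans (Real.exp_le_exp.2 ?_)
    gcongr
    linarith [le_abs_self C, abs_nonneg B]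
  · refine (hB w (by simpa using hR)).trans ?_
    calc B ≤ |B| * 1 := by simpa using le_abs_self B
      _ ≤ (|C| + |B|) * (1 + ‖w‖) ^ 2 := by gcongr; linarith [abs_nonneg C]
      _ ≤ _ := by linarith [Real.add_one_le_exp ((|C| + |B|) * (1 + ‖w‖) ^ 2)]

theorem QuadGrowth.const (a : ℂ) : QuadGrowth fun _ => a := by
  refine .of_large (C := ‖a‖) (R := 0) (differentiable_const a) fun w _ => ?_
  have h1 : 1 ≤ (1 + ‖w‖) ^ 2 := one_le_pow₀ (by linarith [norm_nonneg w])
  have : ‖a‖ * 1 ≤ ‖a‖ * (1 + ‖w‖) ^ 2 := by gcongr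
  linarith [Real.add_one_le_exp (‖a‖ * (1 + ‖w‖) ^ 2)]

theorem QuadGrowth.mul {f g : ℂ → ℂ} (hf : QuadGrowth f) (hg : QuadGrowth g) :
    QuadGrowth fun w => f w * g w := by
  obtain ⟨C, hC, h⟩ := hf.bound
  obtain ⟨D, hD, k⟩ := hg.bound
  refine ⟨hf.diff.mul hg.diff, C + D, by positivity, fun w => ?_⟩
  rw [norm_mul, add_mul, Real.exp_add]
  gcongr
  exacts [h w, k w]

theorem QuadGrowth.add {f g : ℂ → ℂ} (hf : QuadGrowth f) (hg : QuadGrowth g) :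
    QuadGrowth fun w => f w + g w := by
  obtain ⟨C, hC, h⟩ := hf.bound
  obtain ⟨D, hD, k⟩ := hg.bound
  refine ⟨hf.diff.add hg.diff, C + D + 1, by positivity, fun w => ?_⟩
  have h1 : 1 ≤ (1 + ‖w‖) ^ 2 := one_le_pow₀ (by linarith [norm_nonneg w])
  have e1 : Real.exp (C * (1 + ‖w‖) ^ 2) ≤ Real.exp ((C + D) * (1 + ‖w‖) ^ 2) :=
    Real.exp_le_exp.2 (by gcongr; linarith)
  have e2 : Real.exp (D * (1 + ‖w‖) ^ 2) ≤ Real.exp ((C + D) * (1 + ‖w‖) ^ 2) :=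
    Real.exp_le_exp.2 (by gcongr; linarith)
  -- The extra `1` in `C + D + 1` pays for the factor `2` from adding two terms.
  have e3 : 2 ≤ Real.exp ((1 + ‖w‖) ^ 2) := by
    linarith [Real.add_one_le_exp ((1 + ‖w‖) ^ 2)]
  rw [show (C + D + 1) * (1 + ‖w‖) ^ 2 = (C + D) * (1 + ‖w‖) ^ 2 + (1 + ‖w‖) ^ 2 by ring,
    Real.exp_add]
  calc ‖f w + g w‖ ≤ ‖f w‖ + ‖g w‖ := norm_add_le _ _
    _ ≤ Real.exp ((C + D) * (1 + ‖w‖) ^ 2) * 2 := by linarith [h w, k w]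
    _ ≤ _ := by gcongr

theorem QuadGrowth.neg {f : ℂ → ℂ} (hf : QuadGrowth f) : QuadGrowth fun w => -f w :=
  ⟨hf.diff.neg, by simpa using hf.bound⟩

theorem QuadGrowth.sub {f g : ℂ → ℂ} (hf : QuadGrowth f) (hg : QuadGrowth g) :
    QuadGrowth fun w => f w - g w := by
  simpa [sub_eq_add_neg] using hf.add hg.neg

theorem QuadGrowth.sum {ι : Type*} (S : Finset ι) {f : ι → ℂ → ℂ}
    (hf : ∀ i ∈ S, QuadGrowth (f i)) : QuadGrowth fun w => ∑ i ∈ S, f i w := by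
  classical
  induction S using Finset.induction_on with
  | empty => simpa using QuadGrowth.const 0
  | insert a S ha ih =>
    simp only [Finset.sum_insert ha]
    exact (hf a (by simp)).add (ih fun i hi => hf i (by simp [hi]))

theorem QuadGrowth.prod {ι : Type*} (S : Finset ι) {f : ι → ℂ → ℂ}
    (hf : ∀ i ∈ S, QuadGrowth (f i)) : QuadGrowth fun w => ∏ i ∈ S, f i w := by
  classical
  induction S using Finset.induction_on with
  | empty => simpa using QuadGrowth.const 1
  | insert a S ha ih =>
    simp only [Finset.prod_insert ha]
    exact (hf a (by simp)).mul (ih fun i hi => hf i (by simp [hi]))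

theorem QuadGrowth.comp_affine {f : ℂ → ℂ} (hf : QuadGrowth f) (a b : ℂ) :
    QuadGrowth fun w => f (a * w + b) := by
  obtain ⟨C, hC, h⟩ := hf.bound
  refine ⟨hf.diff.comp (by fun_prop), C * (1 + ‖a‖ + ‖b‖) ^ 2, by positivity, fun w => ?_⟩
  refine (h _).trans (Real.exp_le_exp.2 ?_)
  rw [mul_assoc, ← mul_pow]
  gcongr
  calc 1 + ‖a * w + b‖ ≤ 1 + (‖a‖ * ‖w‖ + ‖b‖) := by
        gcongr; exact (norm_add_le _ _).trans (by rw [norm_mul])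
    _ ≤ _ := by nlinarith [norm_nonneg w, norm_nonneg a, norm_nonneg b,
        mul_nonneg (norm_nonneg b) (norm_nonneg w)]

theorem QuadGrowth.exp_affine (a b : ℂ) : QuadGrowth fun w => Complex.exp (a * w + b) := by
  suffices h : QuadGrowth Complex.exp from h.comp_affine a b
  refine .of_large (C := 1) (R := 0) Complex.differentiable_exp fun w _ => ?_
  rw [Complex.norm_exp]
  refine Real.exp_le_exp.2 ((Complex.re_le_norm w).trans ?_)
  nlinarith [norm_nonneg w]

/-! ### Dividing out zeros -/

theorem analyticOrderNatAt_sub_pow_of_ne {a v : ℂ} (h : v ≠ a) (n : ℕ) :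
    analyticOrderNatAt (fun w : ℂ => (w - a) ^ n) v = 0 := by
  have : analyticOrderAt (fun w : ℂ => (w - a) ^ n) v = 0 := by
    refine (AnalyticAt.analyticOrderAt_eq_zero (by fun_prop)).2 (pow_ne_zero _ (sub_ne_zero.2 h))
  simp [analyticOrderNatAt, this]

theorem analyticOrderAt_ne_top_of_entire {f : ℂ → ℂ} (hf : Differentiable ℂ f) {z : ℂ}
    (hz : f z ≠ 0) (a : ℂ) : analyticOrderAt f a ≠ ⊤ := by
  intro h
  have h2 := AnalyticOnNhd.eqOn_zero_of_preconnected_of_eventuallyEq_zero (U := Set.univ)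
    (fun x _ => hf.analyticAt x) isPreconnected_univ (Set.mem_univ a) (analyticOrderAt_eq_top.1 h)
  exact hz (h2 (Set.mem_univ z))

theorem analyticOrderNatAt_eq_zero_of_ne {f : ℂ → ℂ} {u : ℂ} (h : f u ≠ 0) :
    analyticOrderNatAt f u = 0 := by
  by_contra h2
  exact h (apply_eq_zero_of_analyticOrderNatAt_ne_zero h2)

theorem exists_eq_sub_pow_mul {f : ℂ → ℂ} (hf : Differentiable ℂ f) {z : ℂ} (hz : f z ≠ 0)
    (a : ℂ) : ∃ g : ℂ → ℂ, Differentiable ℂ g ∧ g a ≠ 0 ∧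
      (∀ w, f w = (w - a) ^ analyticOrderNatAt f a * g w) ∧
      ∀ v, v ≠ a → analyticOrderNatAt g v = analyticOrderNatAt f v := by
  have hta := analyticOrderAt_ne_top_of_entire hf hz
  set n := analyticOrderNatAt f a with hn
  obtain ⟨g₀, hg₀, hg₀a, hev⟩ :=
    ((hf.analyticAt a).analyticOrderAt_eq_natCast (n := n)).1
      (by rw [hn, Nat.cast_analyticOrderNatAt (hta a)])
  set g : ℂ → ℂ := Function.update (fun w => f w / (w - a) ^ n) a (g₀ a) with hg
  have hga : g a = g₀ a := by simp [hg]
  have hgne : ∀ w, w ≠ a → g w = f w / (w - a) ^ n := fun w hw => by simp [hg, hw]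
  have hnear : g =ᶠ[𝓝 a] g₀ := by
    filter_upwards [hev] with w hw
    by_cases h : w = a
    · rw [h, hga]
    · rw [hgne w h, hw, smul_eq_mul, mul_div_cancel_left₀]
      exact pow_ne_zero _ (sub_ne_zero.2 h)
  have hd : Differentiable ℂ g := by
    intro w
    by_cases h : w = a
    · rw [h]; exact (hg₀.differentiableAt).congr_of_eventuallyEq hnear
    · have : DifferentiableAt ℂ (fun w => f w / (w - a) ^ n) w :=
        (hf w).div (by fun_prop) (pow_ne_zero _ (sub_ne_zero.2 h))
      refine this.congr_of_eventuallyEq ?_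
      filter_upwards [isOpen_ne.mem_nhds h] with v hv using hgne v hv
  have hfac : ∀ w, f w = (w - a) ^ n * g w := by
    intro w
    by_cases h : w = a
    · rw [h, hga]; simpa using hev.self_of_nhds
    · rw [hgne w h, mul_div_cancel₀]
      exact pow_ne_zero _ (sub_ne_zero.2 h)
  refine ⟨g, hd, by rwa [hga], hfac, fun v hv => ?_⟩
  have hz' : g z ≠ 0 := fun h => hz (by rw [hfac, h, mul_zero])
  have e : f = (fun w : ℂ => (w - a) ^ n) * g := funext hfac
  conv_rhs => rw [e]
  rw [analyticOrderNatAt_mul (by fun_prop) (hd.analyticAt v) ?_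
    (analyticOrderAt_ne_top_of_entire hd hz' v), analyticOrderNatAt_sub_pow_of_ne hv, zero_add]
  exact analyticOrderAt_ne_top_of_entire (z := a + 1) (by fun_prop) (by simp) v

/-- For `‖w‖ ≥ ‖a‖ + 1` the removed factor has modulus at least `1`, so dividing by it cannot
enlarge the function. This later cancels a common zero of the numerator and denominator of `K` at
the centre `s`. -/
theorem QuadGrowth.exists_eq_sub_pow_mul {f : ℂ → ℂ} (hf : QuadGrowth f) {z : ℂ} (hz : f z ≠ 0)
    (a : ℂ) : ∃ g : ℂ → ℂ, QuadGrowth g ∧ g a ≠ 0 ∧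
      (∀ w, f w = (w - a) ^ analyticOrderNatAt f a * g w) ∧
      ∀ v, v ≠ a → analyticOrderNatAt g v = analyticOrderNatAt f v := by
  obtain ⟨g, hg, hga, hfac, hord⟩ := Motohashi.exists_eq_sub_pow_mul hf.diff hz a
  obtain ⟨C, hC, h⟩ := hf.bound
  refine ⟨g, .of_large hg (C := C) (R := ‖a‖ + 1) fun w hw => ?_, hga, hfac, hord⟩
  refine le_trans ?_ (h w)
  rw [hfac w, norm_mul, norm_pow]
  have : 1 ≤ ‖w - a‖ := by linarith [norm_sub_norm_le w a]
  exact le_mul_of_one_le_left (norm_nonneg _) (one_le_pow₀ this)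

/-- The factors `1 - w / u` equal `1` at the origin, so the quotient keeps the value `f 0`, against
which all later bounds are measured. -/
theorem exists_eq_prod_mul {f : ℂ → ℂ} (hf : Differentiable ℂ f) (h0 : f 0 ≠ 0)
    (S : Finset ℂ) (hS : ∀ u ∈ S, u ≠ 0) : ∃ g : ℂ → ℂ, Differentiable ℂ g ∧
      (∀ u ∈ S, g u ≠ 0) ∧
      (∀ w, f w = (∏ u ∈ S, (1 - w / u) ^ analyticOrderNatAt f u) * g w) ∧
      ∀ v ∉ S, analyticOrderNatAt g v = analyticOrderNatAt f v := by
  induction S using Finset.induction_on with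
  | empty => exact ⟨f, hf, by simp, by simp, by simp⟩
  | insert a S ha ih =>
    obtain ⟨g, hg, hgS, hfac, hord⟩ := ih fun u hu => hS u (by simp [hu])
    have ha0 : a ≠ 0 := hS a (by simp)
    have hg0 : g 0 ≠ 0 := fun h => h0 (by rw [hfac, h, mul_zero])
    obtain ⟨k, hk, hka, hkfac, hkord⟩ := exists_eq_sub_pow_mul hg hg0 a
    rw [hord a ha] at hkfac
    set n := analyticOrderNatAt f a
    have hc : (-a) ^ n ≠ 0 := pow_ne_zero _ (neg_ne_zero.2 ha0)
    refine ⟨fun w => (-a) ^ n * k w, hk.const_mul _, ?_, ?_, ?_⟩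
    · intro u hu
      rcases Finset.mem_insert.1 hu with rfl | hu
      · exact mul_ne_zero hc hka
      · refine mul_ne_zero hc fun h => hgS u hu ?_
        rw [hkfac, h, mul_zero]
    · intro w
      rw [Finset.prod_insert ha, hfac, hkfac]
      have : (w - a) = (1 - w / a) * (-a) := by field_simp; ring
      rw [this, mul_pow]
      ring
    · intro v hv
      have hva : v ≠ a := fun h => hv (by simp [h])
      have hvS : v ∉ S := fun h => hv (by simp [h])
      rw [← hord v hvS, ← hkord v hva]
      have hk0 : k 0 ≠ 0 := fun h => hg0 (by rw [hkfac, h, mul_zero])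
      have := analyticOrderNatAt_mul (f := fun _ : ℂ => (-a) ^ n) (g := k) (z₀ := v)
        (by fun_prop) (hk.analyticAt v)
        (analyticOrderAt_ne_top_of_entire (z := 0) (by fun_prop) hc v)
        (analyticOrderAt_ne_top_of_entire hk hk0 v)
      rw [analyticOrderNatAt_eq_zero_of_ne (f := fun _ : ℂ => (-a) ^ n) hc, zero_add] at this
      exact this

end Motohashi

namespace Motohashi

/-! ### Counting zeros -/

theorem finite_zeros {f : ℂ → ℂ} (hf : Differentiable ℂ f) {z : ℂ} (hz : f z ≠ 0) (R : ℝ) :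
    {u | f u = 0 ∧ ‖u‖ ≤ R}.Finite := by
  have h := AnalyticOnNhd.preimage_zero_mem_codiscrete (f := f) (x := z)
    (fun x _ => hf.analyticAt x) hz
  have h' := mem_codiscrete'.1 h
  have hcl : IsClosed (f ⁻¹' {0}) := by
    simpa using h'.1
  have hd : IsDiscrete (f ⁻¹' {0}) := by
    simpa using h'.2
  refine (((isCompact_closedBall (0 : ℂ) R).inter_right hcl).finite
    (hd.mono Set.inter_subset_right)).subset ?_
  rintro u ⟨h1, h2⟩
  exact ⟨by simpa using h2, h1⟩

/-- The zeros of an entire function of quadratic growth in a disc of radius `R` can be divided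
out, leaving a function that is bounded by the modulus of `f` on the circle of radius `3R`. -/
theorem exists_quotient_bound {f : ℂ → ℂ} (hf : QuadGrowth f) (h0 : f 0 ≠ 0) :
    ∃ C : ℝ, 0 ≤ C ∧ ∀ R : ℝ, 0 < R → ∀ S : Finset ℂ, (∀ u ∈ S, f u = 0 ∧ ‖u‖ ≤ R) →
      ∃ g : ℂ → ℂ, Differentiable ℂ g ∧ (∀ u ∈ S, g u ≠ 0) ∧ g 0 = f 0 ∧
        (∀ w, f w = (∏ u ∈ S, (1 - w / u) ^ analyticOrderNatAt f u) * g w) ∧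
        ∀ w, ‖w‖ ≤ 3 * R → 2 ^ (∑ u ∈ S, analyticOrderNatAt f u) * ‖g w‖ ≤
          Real.exp (C * (1 + 3 * R) ^ 2) := by
  obtain ⟨C, hC, hb⟩ := hf.bound
  refine ⟨C, hC, fun R hR S hS => ?_⟩
  have hS0 : ∀ u ∈ S, u ≠ 0 := fun u hu h => h0 (h ▸ (hS u hu).1)
  obtain ⟨g, hg, hgS, hfac, -⟩ := exists_eq_prod_mul hf.diff h0 S hS0
  refine ⟨g, hg, hgS, by simp [hfac 0], hfac, fun w hw => ?_⟩
  set n := ∑ u ∈ S, analyticOrderNatAt f u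
  -- On `‖v‖ = 3R` one has `‖v / u‖ ≥ 3`, hence `‖1 - v / u‖ ≥ 2`: every zero gains a factor `2`.
  -- The maximum principle carries the bound inside.
  have key : ∀ v ∈ frontier (Metric.ball (0 : ℂ) (3 * R)),
      ‖g v‖ ≤ Real.exp (C * (1 + 3 * R) ^ 2) / 2 ^ n := by
    intro v hv
    rw [frontier_ball _ (by positivity)] at hv
    have hv : ‖v‖ = 3 * R := by simpa using hv
    rw [le_div_iff₀ (by positivity), mul_comm]
    refine le_trans ?_ (hv ▸ hb v)
    rw [hfac v, norm_mul]
    gcongr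
    rw [norm_prod, ← Finset.prod_pow_eq_pow_sum]
    gcongr with u hu
    rw [norm_pow]
    gcongr
    have hu0 : 0 < ‖u‖ := norm_pos_iff.2 (hS0 u hu)
    have h3 : 3 ≤ ‖v / u‖ := by
      rw [norm_div, le_div_iff₀ hu0, hv]
      linarith [(hS u hu).2]
    have := norm_sub_norm_le (v / u) 1
    rw [norm_one, norm_sub_rev] at this
    linarith
  have := Complex.norm_le_of_forall_mem_frontier_norm_le Metric.isBounded_ball
    hg.diffContOnCl key (z := w) (by rw [closure_ball _ (by positivity)]; simpa using hw)
  rwa [le_div_iff₀ (by positivity), mul_comm] at this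

/-- A weak form of Jensen's inequality: at the origin the quotient bound reads `2^n ‖f 0‖ ≤ exp (C
(1 + 3R)²)`, where `n` counts the zeros. -/
theorem exists_count_bound {f : ℂ → ℂ} (hf : QuadGrowth f) (h0 : f 0 ≠ 0) :
    ∃ D : ℝ, 0 ≤ D ∧ ∀ R : ℝ, 1 ≤ R → ∀ S : Finset ℂ, (∀ u ∈ S, f u = 0 ∧ ‖u‖ ≤ R) →
      (∑ u ∈ S, (analyticOrderNatAt f u : ℝ)) ≤ D * R ^ 2 := by
  obtain ⟨C, hC, h⟩ := exists_quotient_bound hf h0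
  refine ⟨(C * 16 + |Real.log ‖f 0‖|) / Real.log 2, by positivity, fun R hR S hS => ?_⟩
  obtain ⟨g, -, -, hg0, -, hb⟩ := h R (by linarith) S hS
  have h1 := hb 0 (by simp; linarith)
  rw [hg0] at h1
  have hpos : 0 < ‖f 0‖ := norm_pos_iff.2 h0
  have h2 := Real.log_le_log (by positivity) h1
  rw [Real.log_exp, Real.log_mul (by positivity) hpos.ne', Real.log_pow] at h2
  have hl2 : 0 < Real.log 2 := Real.log_pos one_lt_two
  rw [← Nat.cast_sum, div_mul_eq_mul_div, le_div_iff₀ hl2]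
  have h3 : (1 + 3 * R) ^ 2 ≤ 16 * R ^ 2 := by nlinarith
  have h4 := neg_abs_le (Real.log ‖f 0‖)
  have h5 : C * (1 + 3 * R) ^ 2 ≤ C * (16 * R ^ 2) := by gcongr
  have h6 : |Real.log ‖f 0‖| * 1 ≤ |Real.log ‖f 0‖| * R ^ 2 := by
    gcongr; exact one_le_pow₀ hR
  linarith

/-- Dyadic shells: the shell `‖u‖ ≤ 2^j` holds `O(4^j)` zeros, each of weight `O(8^{-j})`. -/
theorem summable_order_div_norm_pow_three {f : ℂ → ℂ} (hf : QuadGrowth f) (h0 : f 0 ≠ 0) :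
    Summable fun u : ℂ => (analyticOrderNatAt f u : ℝ) / ‖u‖ ^ 3 := by
  classical
  obtain ⟨D, hD, hcount⟩ := exists_count_bound hf h0
  obtain ⟨δ, hδ, hball⟩ := Metric.isOpen_iff.1 (isOpen_ne.preimage hf.diff.continuous) 0 h0
  -- The `8` serves the shells with `k u ≥ 1`, where `‖u‖ ≥ 2^(k u - 1)`. The innermost shell has no
  -- such lower bound, and there the zero-free disc of radius `δ` is used.
  set B : ℝ := max 8 (1 / δ ^ 3) with hB
  have hB0 : 0 < B := lt_of_lt_of_le (by norm_num) (le_max_left _ _)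
  set k : ℂ → ℕ := fun u => Nat.clog 2 ⌈‖u‖⌉₊ with hk
  have hk1 : ∀ u, ‖u‖ ≤ 2 ^ k u := fun u => by
    have h1 : ⌈‖u‖⌉₊ ≤ 2 ^ k u := Nat.le_pow_clog one_lt_two _
    exact_mod_cast (Nat.ceil_le.1 h1)
  have hk2 : ∀ u, f u = 0 → 1 / ‖u‖ ^ 3 ≤ B * (1 / 8) ^ k u := by
    intro u hu
    have hδu : δ ≤ ‖u‖ := by
      by_contra! hlt
      exact hball (by simpa using hlt) hu
    rcases Nat.eq_zero_or_pos (k u) with hz | hp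
    · rw [hz, pow_zero, mul_one]
      exact (one_div_le_one_div_of_le (by positivity) (by gcongr)).trans (le_max_right _ _)
    · have h2 : (2 : ℝ) ^ (k u - 1) ≤ ‖u‖ := by
        have h3 : 2 ^ (k u - 1) < ⌈‖u‖⌉₊ := Nat.lt_of_lt_of_eq
          ((Nat.lt_clog_iff_pow_lt one_lt_two).1 (Nat.sub_lt hp one_pos)) rfl
        have := Nat.lt_ceil.1 h3
        push_cast at this
        exact this.le
      have h4 : (8 : ℝ) ^ k u ≤ 8 * ‖u‖ ^ 3 := by
        obtain ⟨j, hj⟩ := Nat.exists_eq_succ_of_ne_zero hp.ne'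
        rw [hj] at h2 ⊢
        simp only [Nat.succ_eq_add_one, Nat.add_sub_cancel] at h2
        rw [pow_succ, show (8 : ℝ) ^ j = (2 ^ j) ^ 3 by rw [← pow_mul, mul_comm, pow_mul]; norm_num,
          mul_comm]
        gcongr
      have hu0 : 0 < ‖u‖ := hδ.trans_le hδu
      calc 1 / ‖u‖ ^ 3 ≤ 8 * (1 / 8) ^ k u := by
            rw [one_div_pow, mul_one_div, div_le_div_iff₀ (by positivity) (by positivity)]
            linarith
        _ ≤ _ := by gcongr; exact le_max_left _ _
  refine summable_of_sum_le (c := B * D * 2) (fun u => by positivity) fun S => ?_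
  set T := S.filter fun u => f u = 0 with hT
  have hST : ∑ u ∈ S, (analyticOrderNatAt f u : ℝ) / ‖u‖ ^ 3 =
      ∑ u ∈ T, (analyticOrderNatAt f u : ℝ) / ‖u‖ ^ 3 := by
    rw [hT, Finset.sum_filter]
    refine Finset.sum_congr rfl fun u _ => ?_
    split_ifs with h
    · rfl
    · rw [analyticOrderNatAt_eq_zero_of_ne h]; simp
  rw [hST, ← Finset.sum_fiberwise_of_maps_to (t := T.image k) (g := k)
    (fun u hu => Finset.mem_image_of_mem k hu)]
  calc ∑ j ∈ T.image k, ∑ u ∈ T with k u = j, (analyticOrderNatAt f u : ℝ) / ‖u‖ ^ 3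
      ≤ ∑ j ∈ T.image k, B * D * (1 / 2) ^ j := by
        gcongr with j hj
        calc ∑ u ∈ T with k u = j, (analyticOrderNatAt f u : ℝ) / ‖u‖ ^ 3
            ≤ ∑ u ∈ T with k u = j, (analyticOrderNatAt f u : ℝ) * (B * (1 / 8) ^ j) := by
              gcongr with u hu
              rw [Finset.mem_filter] at hu
              rw [div_eq_mul_one_div]
              gcongr
              rw [← hu.2]
              exact hk2 u (Finset.mem_filter.1 hu.1).2
          _ = (∑ u ∈ T with k u = j, (analyticOrderNatAt f u : ℝ)) * (B * (1 / 8) ^ j) := by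
              rw [Finset.sum_mul]
          _ ≤ D * (2 ^ j) ^ 2 * (B * (1 / 8) ^ j) := by
              gcongr
              refine hcount _ (one_le_pow₀ one_le_two) _ fun u hu => ?_
              rw [Finset.mem_filter] at hu
              exact ⟨(Finset.mem_filter.1 hu.1).2, hu.2 ▸ hk1 u⟩
          _ = B * D * (1 / 2) ^ j := by
              rw [show (1 / 2 : ℝ) ^ j = (2 ^ j) ^ 2 * (1 / 8) ^ j by
                rw [← pow_mul, mul_comm j 2, pow_mul, ← mul_pow]; norm_num]
              ring
    _ = B * D * ∑ j ∈ T.image k, (1 / 2 : ℝ) ^ j := by rw [Finset.mul_sum]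
    _ ≤ B * D * 2 := by
        gcongr
        exact (Summable.sum_le_tsum _ (fun _ _ => by positivity) summable_geometric_two).trans
          tsum_geometric_two.le

/-! ### Third order Taylor remainders at the origin -/

/-- The remainder `(φ w - φ 0 - φ'(0) w - φ''(0) w² / 2) / w³`. -/
noncomputable def taylorRem (φ : ℂ → ℂ) : ℂ → ℂ := dslope (dslope (dslope φ 0) 0) 0

theorem eq_add_taylorRem (φ : ℂ → ℂ) : ∃ a b : ℂ, ∀ w,
    φ w = φ 0 + a * w + b * w ^ 2 + w ^ 3 * taylorRem φ w := by
  refine ⟨dslope φ 0 0, dslope (dslope φ 0) 0 0, fun w => ?_⟩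
  have h1 := sub_smul_dslope φ 0 w
  have h2 := sub_smul_dslope (dslope φ 0) 0 w
  have h3 := sub_smul_dslope (dslope (dslope φ 0) 0) 0 w
  simp only [sub_zero, smul_eq_mul] at h1 h2 h3
  rw [taylorRem]
  linear_combination (-1) * h1 - w * h2 - w ^ 2 * h3

theorem dslope_congr {φ ψ : ℂ → ℂ} {U : Set ℂ} (hU : IsOpen U) (h0 : (0 : ℂ) ∈ U)
    (h : Set.EqOn φ ψ U) : Set.EqOn (dslope φ 0) (dslope ψ 0) U := by
  intro w hw
  by_cases hw0 : w = 0
  · rw [hw0, dslope_same, dslope_same]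
    exact Filter.EventuallyEq.deriv_eq (h.eventuallyEq_of_mem (hU.mem_nhds h0))
  · rw [dslope_of_ne _ hw0, dslope_of_ne _ hw0, slope_def_field, slope_def_field, h hw, h h0]

theorem taylorRem_congr {φ ψ : ℂ → ℂ} {U : Set ℂ} (hU : IsOpen U) (h0 : (0 : ℂ) ∈ U)
    (h : Set.EqOn φ ψ U) : Set.EqOn (taylorRem φ) (taylorRem ψ) U :=
  dslope_congr hU h0 (dslope_congr hU h0 (dslope_congr hU h0 h))

theorem dslope_add {φ ψ : ℂ → ℂ} (hφ : DifferentiableAt ℂ φ 0) (hψ : DifferentiableAt ℂ ψ 0) :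
    dslope (fun w => φ w + ψ w) 0 = fun w => dslope φ 0 w + dslope ψ 0 w := by
  funext w
  by_cases hw0 : w = 0
  · rw [hw0, dslope_same, dslope_same, dslope_same, deriv_fun_add hφ hψ]
  · simp only [dslope_of_ne _ hw0, slope_def_field]
    ring

theorem taylorRem_add {φ ψ : ℂ → ℂ} {U : Set ℂ} (hU : U ∈ 𝓝 (0 : ℂ))
    (hφ : DifferentiableOn ℂ φ U) (hψ : DifferentiableOn ℂ ψ U) :
    taylorRem (fun w => φ w + ψ w) = fun w => taylorRem φ w + taylorRem ψ w := by
  have h1 := (Complex.differentiableOn_dslope hU).2 hφ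
  have h2 := (Complex.differentiableOn_dslope hU).2 hψ
  have h3 := (Complex.differentiableOn_dslope hU).2 h1
  have h4 := (Complex.differentiableOn_dslope hU).2 h2
  unfold taylorRem
  rw [dslope_add (hφ.differentiableAt hU) (hψ.differentiableAt hU),
    dslope_add (h1.differentiableAt hU) (h2.differentiableAt hU),
    dslope_add (h3.differentiableAt hU) (h4.differentiableAt hU)]

/-- A divided difference at `0` keeps the shape `c / (w - u)` and only replaces `c` by `c / u`;
three of them give `c / u³`. -/
theorem dslope_div_sub (c : ℂ) {u : ℂ} (hu : u ≠ 0) :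
    Set.EqOn (dslope (fun w => c / (w - u)) 0) (fun w => c / u / (w - u)) {u}ᶜ := by
  intro w hw
  have hwu : w - u ≠ 0 := sub_ne_zero.2 hw
  by_cases hw0 : w = 0
  · have h1 : HasDerivAt (fun w : ℂ => c / (w - u)) (c / u / (0 - u)) 0 := by
      have := ((hasDerivAt_id (0 : ℂ)).sub_const u).inv (by simpa using hu)
      refine (this.const_mul c).congr_deriv ?_
      simp only [id, zero_sub]
      field_simp
    rw [hw0, dslope_same, h1.deriv]
  · rw [dslope_of_ne _ hw0, slope_def_field]
    field_simp
    ring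

theorem taylorRem_div_sub (c : ℂ) {u w : ℂ} (hu : u ≠ 0) (hw : w ≠ u) :
    taylorRem (fun w => c / (w - u)) w = c / (u ^ 3 * (w - u)) := by
  have hU : IsOpen ({u}ᶜ : Set ℂ) := isOpen_compl_singleton
  have h0 : (0 : ℂ) ∈ ({u}ᶜ : Set ℂ) := by simpa using hu.symm
  have e1 := dslope_div_sub c hu
  have e2 := (dslope_congr hU h0 e1).trans (dslope_div_sub (c / u) hu)
  have e3 := (dslope_congr hU h0 e2).trans (dslope_div_sub (c / u / u) hu)
  rw [taylorRem, e3 hw]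
  have hwu : w - u ≠ 0 := sub_ne_zero.2 hw
  field_simp

/-- On the circle `‖v‖ = r` the divided difference is visibly at most `2A / r`; the maximum
principle extends this to the disc, including the origin. -/
theorem norm_dslope_le {φ : ℂ → ℂ} {R r A : ℝ} (hr : 0 < r) (hrR : r < R)
    (hφ : DifferentiableOn ℂ φ (Metric.ball 0 R)) (hA : ∀ w, ‖w‖ ≤ r → ‖φ w‖ ≤ A) :
    ∀ w, ‖w‖ ≤ r → ‖dslope φ 0 w‖ ≤ 2 * A / r := by
  intro w hw
  have hd : DifferentiableOn ℂ (dslope φ 0) (Metric.ball 0 R) :=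
    (Complex.differentiableOn_dslope (Metric.ball_mem_nhds _ (hr.trans hrR))).2 hφ
  have hd' : DiffContOnCl ℂ (dslope φ 0) (Metric.ball 0 r) := by
    refine DifferentiableOn.diffContOnCl (hd.mono ?_)
    rw [closure_ball _ hr.ne']
    exact Metric.closedBall_subset_ball hrR
  refine Complex.norm_le_of_forall_mem_frontier_norm_le Metric.isBounded_ball hd' ?_
    (by rw [closure_ball _ hr.ne']; simpa using hw)
  intro v hv
  rw [frontier_ball _ hr.ne'] at hv
  have hv : ‖v‖ = r := by simpa using hv
  have hv0 : v ≠ 0 := norm_pos_iff.1 (by rw [hv]; exact hr)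
  rw [dslope_of_ne _ hv0, slope_def_field, sub_zero, norm_div, hv]
  gcongr
  calc ‖φ v - φ 0‖ ≤ ‖φ v‖ + ‖φ 0‖ := norm_sub_le _ _
    _ ≤ 2 * A := by linarith [hA v hv.le, hA 0 (by simpa using hr.le)]

theorem norm_taylorRem_le {φ : ℂ → ℂ} {R r A : ℝ} (hr : 0 < r) (hrR : r < R)
    (hφ : DifferentiableOn ℂ φ (Metric.ball 0 R)) (hA : ∀ w, ‖w‖ ≤ r → ‖φ w‖ ≤ A) :
    ∀ w, ‖w‖ ≤ r → ‖taylorRem φ w‖ ≤ 8 * A / r ^ 3 := by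
  have hU : Metric.ball (0 : ℂ) R ∈ 𝓝 0 := Metric.ball_mem_nhds _ (hr.trans hrR)
  have h1 := (Complex.differentiableOn_dslope hU).2 hφ
  have h2 := (Complex.differentiableOn_dslope hU).2 h1
  have := norm_dslope_le hr hrR h2 (norm_dslope_le hr hrR h1 (norm_dslope_le hr hrR hφ hA))
  intro w hw
  refine (this w hw).trans (le_of_eq ?_)
  field_simp
  ring

/-- If `g` has no zero in the disc of radius `R` and `|g| ≤ e^M |g 0|` there, then the Taylor
remainder of its logarithmic derivative is small. -/
theorem norm_taylorRem_logDeriv_le {g : ℂ → ℂ} {R M : ℝ} (hR : 0 < R) (hM : 0 < M)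
    (hg : Differentiable ℂ g) (hg0 : ∀ w, ‖w‖ < R → g w ≠ 0)
    (hb : ∀ w, ‖w‖ < R → ‖g w‖ ≤ Real.exp M * ‖g 0‖) {w : ℂ} (hw : ‖w‖ ≤ R / 4) :
    ‖taylorRem (logDeriv g) w‖ ≤ 4096 * M / R ^ 4 := by
  have hφ : DifferentiableOn ℂ (logDeriv g) (Metric.ball 0 R) := by
    intro v hv
    have hv : ‖v‖ < R := by simpa using hv
    exact ((hg.deriv v).div (hg v) (hg0 v hv)).differentiableWithinAt
  -- `h` is a primitive of `g'/g` vanishing at `0`, that is, a logarithm of `g / g 0`; its real part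
  -- is therefore at most `M`.
  obtain ⟨h, hh0, hh⟩ := hφ.isExactOn_ball.with_val_at 0 0
  have hh' : DifferentiableOn ℂ h (Metric.ball 0 R) := fun v hv =>
    (hh v hv).differentiableAt.differentiableWithinAt
  have hexp : ∀ v ∈ Metric.ball (0 : ℂ) R, g v * Complex.exp (-h v) = g 0 := by
    intro v hv
    have hd : ∀ x ∈ Metric.ball (0 : ℂ) R,
        HasDerivWithinAt (fun v => g v * Complex.exp (-h v)) 0 (Metric.ball 0 R) x := by
      intro x hx
      have hx' : ‖x‖ < R := by simpa using hx
      have := (hg x).hasDerivAt.mul (hh x hx).neg.cexp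
      refine (this.congr_deriv ?_).hasDerivWithinAt
      rw [logDeriv_apply]
      field_simp [hg0 x hx']
      simp
    have := (convex_ball (0 : ℂ) R).is_const_of_fderivWithin_eq_zero (𝕜 := ℂ)
      (f := fun v => g v * Complex.exp (-h v))
      (fun x hx => (hd x hx).differentiableWithinAt)
      (fun x hx => by
        have := (hd x hx).hasFDerivWithinAt.fderivWithin
          (Metric.isOpen_ball.uniqueDiffWithinAt hx)
        rw [this]; ext; simp) hv (Metric.mem_ball_self hR)
    simpa [hh0] using this
  have hg00 : 0 < ‖g 0‖ := norm_pos_iff.2 (hg0 0 (by simpa using hR))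
  have hre : Set.MapsTo h (Metric.ball 0 R) {z | z.re ≤ M} := by
    intro v hv
    have hv' : ‖v‖ < R := by simpa using hv
    have h1 : ‖g v‖ = Real.exp (h v).re * ‖g 0‖ := by
      rw [← hexp v hv, norm_mul, Complex.norm_exp, neg_re, Real.exp_neg]
      field_simp
    have h2 := hb v hv'
    rw [h1] at h2
    exact Real.exp_le_exp.1 (le_of_mul_le_mul_right h2 hg00)
  -- Borel–Carathéodory bounds `‖h‖` by `2M r / (R - r)`, which is `2M` at `r = R / 2`. Cauchy's
  -- estimate on circles of radius `R / 4` then gives `8M / R` for `h' = g'/g`.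
  have hhb : ∀ v, ‖v‖ ≤ R / 2 → ‖h v‖ ≤ 2 * M := by
    intro v hv
    have := Complex.borelCaratheodory_zero hM hh' hre hR (z := v) (by simp; linarith) hh0
    refine this.trans ?_
    rw [div_le_iff₀ (by linarith)]
    nlinarith
  have hφb : ∀ v, ‖v‖ ≤ R / 4 → ‖logDeriv g v‖ ≤ 8 * M / R := by
    intro v hv
    have hsub : Metric.closedBall v (R / 4) ⊆ Metric.ball 0 R := by
      intro x hx
      have h1 : ‖x - v‖ ≤ R / 4 := by simpa [dist_eq_norm] using hx
      have h2 : ‖x‖ ≤ ‖x - v‖ + ‖v‖ := norm_le_norm_sub_add _ _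
      simp; linarith
    have := Complex.norm_deriv_le_of_forall_mem_sphere_norm_le (c := v) (R := R / 4)
      (C := 2 * M) (f := h) (by positivity) ?_ ?_
    · rw [(hh v (by simp; linarith)).deriv] at this
      refine this.trans (le_of_eq ?_)
      field_simp
      ring
    · refine DifferentiableOn.diffContOnCl (hh'.mono ?_)
      rwa [closure_ball _ (by positivity)]
    · intro x hx
      refine hhb x ?_
      have h1 : ‖x - v‖ = R / 4 := by simpa [dist_eq_norm] using hx
      have h2 : ‖x‖ ≤ ‖x - v‖ + ‖v‖ := norm_le_norm_sub_add _ _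
      linarith
  -- The constant is `8 · (8M / R) / (R / 4)³ = 4096 M / R⁴`.
  refine (norm_taylorRem_le (by positivity) (by linarith) hφ hφb w hw).trans (le_of_eq ?_)
  field_simp
  ring

end Motohashi

namespace Motohashi

/-! ### The Mittag-Leffler expansion of a logarithmic derivative -/

theorem _root_.HasSum.of_eq {ι : Type*} {f g : ι → ℂ} {a b : ℂ} (h : HasSum f a)
    (hf : ∀ i, g i = f i) (hb : b = a) : HasSum g b := by
  rw [hb, funext hf]
  exact h

theorem logDeriv_prod_one_sub_div (S : Finset ℂ) (m : ℂ → ℕ) (hS : ∀ u ∈ S, u ≠ 0) {w : ℂ}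
    (hw : w ∉ S) :
    logDeriv (fun w => ∏ u ∈ S, (1 - w / u) ^ m u) w = ∑ u ∈ S, (m u : ℂ) / (w - u) := by
  have hne : ∀ u ∈ S, 1 - w / u ≠ 0 := fun u hu h => by
    refine hw ?_
    have : w = u := by
      have := hS u hu
      field_simp at h
      linear_combination -h
    rwa [this]
  rw [logDeriv_prod (f := fun u (w : ℂ) => (1 - w / u) ^ m u) (fun u hu => pow_ne_zero _ (hne u hu)) (fun u _ => by fun_prop)]
  refine Finset.sum_congr rfl fun u hu => ?_
  rw [logDeriv_fun_pow (by fun_prop)]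
  have hd : HasDerivAt (fun w : ℂ => 1 - w / u) (-(1 / u)) w :=
    ((hasDerivAt_id w).div_const u).const_sub 1
  rw [logDeriv_apply, hd.deriv]
  have h1 := hne u hu
  have h2 := hS u hu
  have h3 : w - u ≠ 0 := fun h => hw (sub_eq_zero.1 h ▸ hu)
  have h4 : 1 - w / u = -(w - u) / u := by field_simp; ring
  rw [h4]
  field_simp

theorem taylorRem_sum_div_sub (S : Finset ℂ) (m : ℂ → ℂ) (hS : ∀ u ∈ S, u ≠ 0) {w : ℂ}
    (hw : w ∉ S) :
    taylorRem (fun w => ∑ u ∈ S, m u / (w - u)) w = ∑ u ∈ S, m u / (u ^ 3 * (w - u)) := by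
  induction S using Finset.induction_on with
  | empty =>
    have h1 : dslope (fun _ : ℂ => (0 : ℂ)) 0 = fun _ => 0 := by
      funext w
      by_cases hw0 : w = 0
      · simp [hw0]
      · simp [dslope_of_ne _ hw0, slope_def_field]
    simp [taylorRem, h1]
  | insert a S ha ih =>
    have hdiff : ∀ T : Finset ℂ, T ⊆ insert a S →
        DifferentiableOn ℂ (fun w => ∑ u ∈ T, m u / (w - u)) ((insert a S : Finset ℂ) : Set ℂ)ᶜ := by
      intro T hT
      refine DifferentiableOn.fun_sum fun u hu => ?_
      refine DifferentiableOn.div (by fun_prop) (by fun_prop) fun x hx => ?_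
      refine sub_ne_zero.2 fun h => hx ?_
      rw [h]; exact hT hu
    have hU : ((insert a S : Finset ℂ) : Set ℂ)ᶜ ∈ 𝓝 (0 : ℂ) :=
      (insert a S).finite_toSet.isClosed.isOpen_compl.mem_nhds
        fun h => hS 0 h rfl
    simp only [Finset.sum_insert ha]
    have := hdiff {a} (by simp)
    simp only [Finset.sum_singleton] at this
    rw [taylorRem_add hU this (hdiff S (by simp))]
    have haw : w ≠ a := fun h => hw (by simp [h])
    beta_reduce
    rw [taylorRem_div_sub _ (hS a (by simp)) haw,
      ih (fun u hu => hS u (by simp [hu])) fun h => hw (by simp [h])]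

/-- The zeros in the disc contribute the finite sum exactly. The zero-free quotient contributes at
most `4096 M / R⁴` with `M = O(R²)`, so for quadratic growth the third remainder leaves an error
that tends to zero. -/
theorem exists_taylorRem_logDeriv_bound {f : ℂ → ℂ} (hf : QuadGrowth f) (h0 : f 0 ≠ 0) :
    ∃ A : ℝ, 0 ≤ A ∧ ∀ R : ℝ, 1 ≤ R → ∀ S : Finset ℂ, (∀ u, u ∈ S ↔ f u = 0 ∧ ‖u‖ ≤ R) →
      ∀ w, f w ≠ 0 → ‖w‖ ≤ R / 4 →
        ‖taylorRem (logDeriv f) w -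
          ∑ u ∈ S, (analyticOrderNatAt f u : ℂ) / (u ^ 3 * (w - u))‖ ≤ A / R ^ 2 := by
  obtain ⟨C, hC, h⟩ := exists_quotient_bound hf h0
  refine ⟨4096 * (C * 16 + |Real.log ‖f 0‖| + 1), by positivity, fun R hR S hS w hw hwR => ?_⟩
  have hR0 : 0 < R := by linarith
  obtain ⟨g, hg, hgS, hg0, hfac, hb⟩ := h R hR0 S fun u hu => (hS u).1 hu
  have hS0 : ∀ u ∈ S, u ≠ 0 := fun u hu h => h0 (h ▸ ((hS u).1 hu).1)
  have hgne : ∀ v, ‖v‖ < R → g v ≠ 0 := by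
    intro v hv hgv
    have : f v = 0 := by rw [hfac, hgv, mul_zero]
    exact hgS v ((hS v).2 ⟨this, hv.le⟩) hgv
  set U : Set ℂ := {v | f v ≠ 0} with hUdef
  have hU : IsOpen U := isOpen_ne.preimage hf.diff.continuous
  have hUS : ∀ v ∈ U, v ∉ S := fun v hv h => hv ((hS v).1 h).1
  have hUg : ∀ v ∈ U, g v ≠ 0 := fun v hv h => hv (by rw [hfac, h, mul_zero])
  set ψ : ℂ → ℂ := fun v => ∑ u ∈ S, (analyticOrderNatAt f u : ℂ) / (v - u) with hψ
  have hL : Set.EqOn (logDeriv f) (fun v => ψ v + logDeriv g v) U := by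
    intro v hv
    have e : f = fun w => (∏ u ∈ S, (1 - w / u) ^ analyticOrderNatAt f u) * g w := funext hfac
    have h1 : (∏ u ∈ S, (1 - v / u) ^ analyticOrderNatAt f u) ≠ 0 := fun h =>
      hv (by rw [hfac, h, zero_mul])
    have h2 := logDeriv_mul (f := fun w => ∏ u ∈ S, (1 - w / u) ^ analyticOrderNatAt f u) (g := g)
      v h1 (hUg v hv) (by fun_prop) (hg v)
    rw [← e] at h2
    rw [h2, logDeriv_prod_one_sub_div S _ hS0 (hUS v hv)]
  have hψd : DifferentiableOn ℂ ψ U := by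
    refine DifferentiableOn.fun_sum fun u hu => ?_
    refine DifferentiableOn.div (by fun_prop) (by fun_prop) fun x hx => ?_
    exact sub_ne_zero.2 fun h => hUS x hx (h ▸ hu)
  have hgd : DifferentiableOn ℂ (logDeriv g) U := fun v hv =>
    ((hg.deriv v).div (hg v) (hUg v hv)).differentiableWithinAt
  have h0U : (0 : ℂ) ∈ U := h0
  rw [taylorRem_congr hU h0U hL hw, taylorRem_add (hU.mem_nhds h0U) hψd hgd]
  beta_reduce
  rw [hψ, taylorRem_sum_div_sub S _ hS0 (hUS w hw), add_sub_cancel_left]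
  -- The bound must be relative to `‖g 0‖ = ‖f 0‖`, hence the term `|log ‖f 0‖|`; the `1` makes `M`
  -- positive.
  set M : ℝ := C * (1 + 3 * R) ^ 2 + |Real.log ‖f 0‖| + 1 with hM
  have hM0 : 0 < M := by positivity
  have hf0 : 0 < ‖f 0‖ := norm_pos_iff.2 h0
  have hgb : ∀ v, ‖v‖ < R → ‖g v‖ ≤ Real.exp M * ‖g 0‖ := by
    intro v hv
    have h1 : ‖g v‖ ≤ Real.exp (C * (1 + 3 * R) ^ 2) :=
      (le_mul_of_one_le_left (norm_nonneg _) (one_le_pow₀ one_le_two)).trans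
        (hb v (by linarith))
    refine h1.trans ?_
    rw [hg0]
    conv_rhs => rw [← Real.exp_log hf0]
    rw [← Real.exp_add, Real.exp_le_exp]
    linarith [neg_abs_le (Real.log ‖f 0‖)]
  refine (norm_taylorRem_logDeriv_le hR0 hM0 hg hgne hgb hwR).trans ?_
  have hMR : M ≤ (C * 16 + |Real.log ‖f 0‖| + 1) * R ^ 2 := by
    have h3 : (1 + 3 * R) ^ 2 ≤ 16 * R ^ 2 := by nlinarith
    have h5 : C * (1 + 3 * R) ^ 2 ≤ C * (16 * R ^ 2) := by gcongr
    have h6 : (|Real.log ‖f 0‖| + 1) * 1 ≤ (|Real.log ‖f 0‖| + 1) * R ^ 2 := by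
      gcongr; exact one_le_pow₀ hR
    linarith
  rw [div_le_div_iff₀ (by positivity) (by positivity)]
  calc 4096 * M * R ^ 2
      ≤ 4096 * ((C * 16 + |Real.log ‖f 0‖| + 1) * R ^ 2) * R ^ 2 := by gcongr
    _ = _ := by ring

theorem summable_order_div {f : ℂ → ℂ} (hf : QuadGrowth f) (h0 : f 0 ≠ 0) {w : ℂ}
    (hw : f w ≠ 0) :
    Summable fun u : ℂ => (analyticOrderNatAt f u : ℂ) / (u ^ 3 * (w - u)) := by
  obtain ⟨δ, hδ, hball⟩ := Metric.isOpen_iff.1 (isOpen_ne.preimage hf.diff.continuous) w hw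
  refine Summable.of_norm_bounded
    (g := fun u => (1 / δ) * ((analyticOrderNatAt f u : ℝ) / ‖u‖ ^ 3))
    ((summable_order_div_norm_pow_three hf h0).mul_left _) fun u => ?_
  by_cases hu : f u = 0
  · have h1 : δ ≤ ‖w - u‖ := by
      by_contra! h
      exact hball (by rwa [Metric.mem_ball, dist_comm, dist_eq_norm]) hu
    rw [norm_div, norm_mul, norm_pow, Complex.norm_natCast]
    rw [div_mul_div_comm, one_mul, mul_comm δ]
    have hu0 : 0 < ‖u‖ := norm_pos_iff.2 fun h => h0 (h ▸ hu)
    gcongr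
  · rw [analyticOrderNatAt_eq_zero_of_ne hu]
    simp

/-- Absolute convergence is already known, so the value can be read off along any exhaustion; the
discs of integer radius have error `A / n²`. -/
theorem hasSum_taylorRem_logDeriv {f : ℂ → ℂ} (hf : QuadGrowth f) (h0 : f 0 ≠ 0) {w : ℂ}
    (hw : f w ≠ 0) :
    HasSum (fun u : ℂ => (analyticOrderNatAt f u : ℂ) / (u ^ 3 * (w - u)))
      (taylorRem (logDeriv f) w) := by
  have hs := summable_order_div hf h0 hw
  set F : ℂ → ℂ := fun u => (analyticOrderNatAt f u : ℂ) / (u ^ 3 * (w - u)) with hF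
  obtain ⟨A, hA, hb⟩ := exists_taylorRem_logDeriv_bound hf h0
  set T : ℕ → Finset ℂ := fun n => (finite_zeros hf.diff h0 n).toFinset with hT
  have hmem : ∀ n u, u ∈ T n ↔ f u = 0 ∧ ‖u‖ ≤ n := fun n u => by simp [hT]
  have hlim1 : Tendsto (fun n => ∑ u ∈ T n, F u) atTop (𝓝 (taylorRem (logDeriv f) w)) := by
    rw [← tendsto_sub_nhds_zero_iff]
    have hz : Tendsto (fun n : ℕ => A / (n : ℝ) ^ 2) atTop (𝓝 0) :=
      Tendsto.div_atTop tendsto_const_nhds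
        ((tendsto_pow_atTop two_ne_zero).comp tendsto_natCast_atTop_atTop)
    refine squeeze_zero_norm' ?_ hz
    filter_upwards [eventually_ge_atTop 1, eventually_ge_atTop ⌈4 * ‖w‖⌉₊] with n hn hnw
    rw [norm_sub_rev]
    refine hb n (by exact_mod_cast hn) (T n) (hmem n) w hw ?_
    have := Nat.ceil_le.1 hnw
    linarith
  have hsupp : Function.support F ⊆ {u | f u = 0} := by
    intro u hu
    by_contra h
    exact hu (by simp [hF, analyticOrderNatAt_eq_zero_of_ne h])
  have hsub : Summable fun u : {u | f u = 0} => F u := hs.subtype _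
  rw [← hasSum_subtype_iff_of_support_subset hsupp]
  -- The discs exhaust only the zero set, not all of `ℂ`, which is why the sum was first restricted
  -- to the zeros.
  have hT' : Tendsto (fun n => (T n).subtype fun u => f u = 0) atTop atTop := by
    refine tendsto_atTop_finset_of_monotone ?_ ?_
    · intro a b hab u hu
      rw [Finset.mem_subtype, hmem] at hu ⊢
      exact ⟨hu.1, hu.2.trans (by exact_mod_cast hab)⟩
    · intro u
      obtain ⟨n, hn⟩ := exists_nat_ge ‖(u : ℂ)‖
      exact ⟨n, by rw [Finset.mem_subtype, hmem]; exact ⟨u.2, hn⟩⟩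
  have hlim2 := hsub.hasSum.comp hT'
  have e : (fun n => ∑ u ∈ T n, F u) =
      (fun s : Finset {u | f u = 0} => ∑ b ∈ s, F b) ∘
        fun n => (T n).subtype fun u => f u = 0 := by
    funext n
    refine (Finset.sum_subtype_of_mem F fun u hu => ((hmem n u).1 hu).1).symm
  rw [e] at hlim1
  have := tendsto_nhds_unique hlim1 hlim2
  rw [this]
  exact hsub.hasSum

/-- `HasExpansion s B L m` says that `L` is, in the half-plane `Re w > B`, equal to a
Mittag-Leffler series of simple poles `u` with residues `m u`, normalised at the point `s` up to
the second order, with constant term `L s`. -/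
structure HasExpansion (s : ℂ) (B : ℝ) (L : ℂ → ℂ) (m : ℂ → ℂ) : Prop where
  summable : Summable fun u : ℂ => ‖m u‖ / ‖u - s‖ ^ 3
  center : m s = 0
  re_le : ∀ u, m u ≠ 0 → u.re ≤ B
  expansion : ∃ a b : ℂ, ∀ w : ℂ, B < w.re →
    HasSum (fun u => m u / ((u - s) ^ 3 * (w - u)) * (w - s) ^ 3)
      (L w - (L s + a * (w - s) + b * (w - s) ^ 2))

theorem analyticOrderNatAt_comp_affine {f : ℂ → ℂ} {a : ℂ} (ha : a ≠ 0) (b u : ℂ) :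
    analyticOrderNatAt (fun w => f (a * w + b)) u =
      analyticOrderNatAt f (a * u + b) := by
  have hd : HasDerivAt (fun w : ℂ => a * w + b) a u := by
    simpa using ((hasDerivAt_id u).const_mul a).add_const b
  have := analyticOrderAt_comp_of_deriv_ne_zero (f := f) (g := fun w : ℂ => a * w + b) (z₀ := u)
    (by fun_prop) (by rw [hd.deriv]; exact ha)
  unfold analyticOrderNatAt
  rw [← this]
  rfl

/-- The case of centre `0` applied to `w ↦ f (w + s)`; the two unspecified constants are the first
Taylor coefficients of `f'/f` at `s`. -/
theorem QuadGrowth.hasExpansion {f : ℂ → ℂ} (hf : QuadGrowth f) {s : ℂ} (hs : f s ≠ 0) {B : ℝ}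
    (hB : ∀ w : ℂ, B < w.re → f w ≠ 0) :
    HasExpansion s B (logDeriv f) fun u => (analyticOrderNatAt f u : ℂ) := by
  have hF : QuadGrowth fun w => f (w + s) := by simpa using hf.comp_affine 1 s
  have hF0 : f (0 + s) ≠ 0 := by simpa using hs
  have hord : ∀ u, analyticOrderNatAt (fun w => f (w + s)) u = analyticOrderNatAt f (u + s) := by
    intro u
    simpa using analyticOrderNatAt_comp_affine (f := f) one_ne_zero s u
  have hlog : ∀ w, logDeriv (fun w => f (w + s)) w = logDeriv f (w + s) := by
    intro w
    rw [logDeriv_apply, logDeriv_apply, deriv_comp_add_const]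
  refine ⟨?_, ?_, ?_, ?_⟩
  · have h1 := summable_order_div_norm_pow_three hF hF0
    rw [← (Equiv.addRight s).summable_iff]
    refine h1.congr fun u => ?_
    simp [hord, Equiv.addRight]
  · simp [analyticOrderNatAt_eq_zero_of_ne hs]
  · intro u hu
    by_contra! h
    exact hu (by simp [analyticOrderNatAt_eq_zero_of_ne (hB u h)])
  · obtain ⟨a, b, hab⟩ := eq_add_taylorRem (logDeriv fun w => f (w + s))
    refine ⟨a, b, fun w hw => ?_⟩
    have hw0 : f (w - s + s) ≠ 0 := by simpa using hB w hw
    have h1 := (hasSum_taylorRem_logDeriv hF hF0 hw0).mul_right ((w - s) ^ 3)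
    have h2 := hab (w - s)
    simp only [hlog, zero_add, sub_add_cancel] at h2
    rw [← (Equiv.addRight s).hasSum_iff]
    refine h1.of_eq (fun u => ?_) ?_
    · simp [hord, Equiv.addRight, sub_sub, add_comm s u]
    · rw [h2]
      ring

theorem HasExpansion.mono {s : ℂ} {B B' : ℝ} {L m : ℂ → ℂ} (h : HasExpansion s B L m)
    (hB : B ≤ B') : HasExpansion s B' L m := by
  obtain ⟨a, b, hab⟩ := h.expansion
  exact ⟨h.summable, h.center, fun u hu => (h.re_le u hu).trans hB,
    a, b, fun w hw => hab w (hB.trans_lt hw)⟩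

theorem HasExpansion.congr {s : ℂ} {B : ℝ} {L L' m m' : ℂ → ℂ} (h : HasExpansion s B L m)
    (hs : L' s = L s) (hL : ∀ w : ℂ, B < w.re → L' w = L w) (hm : ∀ u, m' u = m u) :
    HasExpansion s B L' m' := by
  obtain rfl : m' = m := funext hm
  obtain ⟨a, b, hab⟩ := h.expansion
  exact ⟨h.summable, h.center, h.re_le, a, b, fun w hw => by rw [hL w hw, hs]; exact hab w hw⟩

theorem HasExpansion.const_mul {s : ℂ} {B : ℝ} {L m : ℂ → ℂ} (h : HasExpansion s B L m) (c : ℂ) :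
    HasExpansion s B (fun w => c * L w) fun u => c * m u := by
  obtain ⟨a, b, hab⟩ := h.expansion
  refine ⟨?_, by simp [h.center], fun u hu => h.re_le u (right_ne_zero_of_mul hu),
    c * a, c * b, fun w hw => ?_⟩
  · simpa [mul_div_assoc] using h.summable.mul_left ‖c‖
  · refine ((hab w hw).mul_left c).of_eq (fun u => ?_) ?_
    · ring
    · ring

theorem HasExpansion.add {s : ℂ} {B : ℝ} {L L' m m' : ℂ → ℂ} (h : HasExpansion s B L m)
    (h' : HasExpansion s B L' m') :
    HasExpansion s B (fun w => L w + L' w) fun u => m u + m' u := by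
  obtain ⟨a, b, hab⟩ := h.expansion
  obtain ⟨a', b', hab'⟩ := h'.expansion
  refine ⟨?_, by simp [h.center, h'.center], fun u hu => ?_, a + a', b + b', fun w hw => ?_⟩
  · refine Summable.of_nonneg_of_le (fun u => by positivity) (fun u => ?_)
      (h.summable.add h'.summable)
    rw [← add_div]
    gcongr
    exact norm_add_le _ _
  · by_cases hm : m u = 0
    · exact h'.re_le u (by simpa [hm] using hu)
    · exact h.re_le u hm
  · refine ((hab w hw).add (hab' w hw)).of_eq (fun u => ?_) ?_
    · ring
    · ring

theorem HasExpansion.sub {s : ℂ} {B : ℝ} {L L' m m' : ℂ → ℂ} (h : HasExpansion s B L m)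
    (h' : HasExpansion s B L' m') :
    HasExpansion s B (fun w => L w - L' w) fun u => m u - m' u :=
  (h.add (h'.const_mul (-1))).congr (by ring) (fun _ _ => by ring) fun _ => by ring

theorem HasExpansion.sum {s : ℂ} {B : ℝ} {ι : Type*} (S : Finset ι) {L m : ι → ℂ → ℂ}
    (h : ∀ i, HasExpansion s B (L i) (m i)) :
    HasExpansion s B (fun w => ∑ i ∈ S, L i w) fun u => ∑ i ∈ S, m i u := by
  classical
  induction S using Finset.induction_on with
  | empty =>
    refine ⟨by simp, by simp, by simp, 0, 0, fun w _ => ?_⟩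
    simp
  | insert a S ha ih => simpa only [Finset.sum_insert ha] using (h a).add ih

/-- For a single pole the expansion is the finite geometric identity, with constants the Taylor
coefficients of `1 / (w - a)` at `s`. -/
theorem hasExpansion_inv_sub {s a : ℂ} (hs : s ≠ a) {B : ℝ} (ha : a.re ≤ B) :
    HasExpansion s B (fun w => 1 / (w - a)) fun u => if u = a then 1 else 0 := by
  have hsa : s - a ≠ 0 := sub_ne_zero.2 hs
  refine ⟨?_, by simp [hs], ?_, -1 / (s - a) ^ 2, 1 / (s - a) ^ 3, fun w hw => ?_⟩
  · refine summable_of_ne_finset_zero (s := {a}) fun u hu => ?_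
    simp [Finset.mem_singleton.not.1 hu]
  · intro u hu
    by_cases h : u = a
    · rwa [h]
    · simp [h] at hu
  · have hwa : w - a ≠ 0 := fun h => by
      rw [sub_eq_zero.1 h] at hw; linarith
    refine (hasSum_ite_eq a (1 / ((a - s) ^ 3 * (w - a)) * (w - s) ^ 3)).of_eq (fun u => ?_) ?_
    · by_cases h : u = a <;> simp [h]
    · have has : a - s ≠ 0 := sub_ne_zero.2 hs.symm
      have e : s - a = -(a - s) := by ring
      rw [e]
      field_simp
      ring

end Motohashi

namespace Motohashi

open MeasureTheory Set

/-! ### Laplace transforms on a vertical line -/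

/-- `h` is continuous on `(0, ∞)`, `O (exp ((κ - 1) t))`, and has Laplace transform `H` on the line
`Re p = κ`. -/
structure HasLaplace (κ : ℝ) (h : ℝ → ℂ) (H : ℂ → ℂ) : Prop where
  cont : ContinuousOn h (Ioi 0)
  bound : ∃ C : ℝ, ∀ t, 0 < t → ‖h t‖ ≤ C * Real.exp ((κ - 1) * t)
  integral : ∀ p : ℂ, p.re = κ → ∫ t in Ioi (0 : ℝ), cexp (-p * t) * h t = H p

/-- The gap of `1` between the growth exponent `κ - 1` and the line `Re p = κ` leaves the integrable
majorant `C e^{-t}`, uniformly on the line. -/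
theorem norm_exp_mul_le {κ C : ℝ} {h : ℝ → ℂ} (hC : ∀ t, 0 < t → ‖h t‖ ≤ C * Real.exp ((κ - 1) * t))
    {p : ℂ} (hp : p.re = κ) {t : ℝ} (ht : 0 < t) :
    ‖cexp (-p * t) * h t‖ ≤ C * Real.exp (-1 * t) := by
  rw [norm_mul, Complex.norm_exp]
  calc Real.exp (-p * t).re * ‖h t‖ ≤ Real.exp (-p * t).re * (C * Real.exp ((κ - 1) * t)) := by
        gcongr; exact hC t ht
    _ = C * (Real.exp (-p * t).re * Real.exp ((κ - 1) * t)) := by ring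
    _ = _ := by
        rw [← Real.exp_add]
        congr 2
        simp [hp]
        ring

theorem integrable_exp_neg (C : ℝ) :
    Integrable (fun t => C * Real.exp (-1 * t)) (volume.restrict (Ioi (0 : ℝ))) :=
  (integrableOn_exp_mul_Ioi (a := -1) (by norm_num) 0).const_mul C

theorem HasLaplace.integrable {κ : ℝ} {h : ℝ → ℂ} {H : ℂ → ℂ} (hh : HasLaplace κ h H) {p : ℂ}
    (hp : p.re = κ) : IntegrableOn (fun t : ℝ => cexp (-p * t) * h t) (Ioi 0) := by
  obtain ⟨C, hC⟩ := hh.bound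
  refine Integrable.mono' (integrable_exp_neg C) ?_ ?_
  · exact ContinuousOn.aestronglyMeasurable
      (ContinuousOn.mul (by fun_prop) hh.cont) measurableSet_Ioi
  · refine (ae_restrict_mem measurableSet_Ioi).mono fun t ht => norm_exp_mul_le hC hp ht

theorem HasLaplace.sub {κ : ℝ} {h k : ℝ → ℂ} {H K : ℂ → ℂ} (hh : HasLaplace κ h H)
    (hk : HasLaplace κ k K) : HasLaplace κ (fun t => h t - k t) fun p => H p - K p := by
  obtain ⟨C, hC⟩ := hh.bound
  obtain ⟨D, hD⟩ := hk.bound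
  refine ⟨hh.cont.sub hk.cont, ⟨C + D, fun t ht => ?_⟩, fun p hp => ?_⟩
  · exact (norm_sub_le _ _).trans (by linarith [hC t ht, hD t ht])
  · rw [← hh.integral p hp, ← hk.integral p hp, ← integral_sub (hh.integrable hp) (hk.integrable hp)]
    simp only [mul_sub]

theorem HasLaplace.add {κ : ℝ} {h k : ℝ → ℂ} {H K : ℂ → ℂ} (hh : HasLaplace κ h H)
    (hk : HasLaplace κ k K) : HasLaplace κ (fun t => h t + k t) fun p => H p + K p := by
  obtain ⟨C, hC⟩ := hh.bound
  obtain ⟨D, hD⟩ := hk.bound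
  refine ⟨hh.cont.add hk.cont, ⟨C + D, fun t ht => ?_⟩, fun p hp => ?_⟩
  · exact (norm_add_le _ _).trans (by linarith [hC t ht, hD t ht])
  · rw [← hh.integral p hp, ← hk.integral p hp, ← integral_add (hh.integrable hp) (hk.integrable hp)]
    simp only [mul_add]

/-- A common summable weight `b i` gives both uniform convergence on bounded intervals, hence
continuity, and the dominated exchange of sum and integral. -/
theorem hasLaplace_tsum {ι : Type*} [Countable ι] {κ : ℝ} {h : ι → ℝ → ℂ} {H : ι → ℂ → ℂ}
    {G : ℂ → ℂ} {b : ι → ℝ} (hb : Summable b) (hc : ∀ i, ContinuousOn (h i) (Ioi 0))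
    (hbd : ∀ i t, 0 < t → ‖h i t‖ ≤ b i * Real.exp ((κ - 1) * t))
    (hint : ∀ i p, p.re = κ → ∫ t in Ioi (0 : ℝ), cexp (-p * t) * h i t = H i p)
    (hG : ∀ p : ℂ, p.re = κ → HasSum (fun i => H i p) (G p)) :
    HasLaplace κ (fun t => ∑' i, h i t) G := by
  have hsum : ∀ t, 0 < t → Summable fun i => h i t := fun t ht =>
    Summable.of_norm_bounded (hb.mul_right _) fun i => hbd i t ht
  refine ⟨?_, ⟨∑' i, b i, fun t ht => ?_⟩, fun p hp => ?_⟩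
  · rw [isOpen_Ioi.continuousOn_iff]
    intro t ht
    have ht' : (0 : ℝ) < t := ht
    have hb0 : ∀ i, 0 ≤ b i := fun i => by
      by_contra! hneg
      have := (norm_nonneg _).trans (hbd i t ht')
      nlinarith [Real.exp_pos ((κ - 1) * t)]
    have h1 : ContinuousOn (fun t => ∑' i, h i t) (Ioo 0 (t + 1)) := by
      refine continuousOn_tsum (u := fun i => b i * Real.exp (|κ - 1| * (t + 1)))
        (fun i => (hc i).mono Ioo_subset_Ioi_self) (hb.mul_right _) fun i r hr => ?_
      refine (hbd i r hr.1).trans ?_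
      gcongr
      · exact hb0 i
      · exact hr.1.le
      · exact le_abs_self _
      · exact hr.2.le
    exact h1.continuousAt (Ioo_mem_nhds ht' (by linarith))
  · rw [← tsum_mul_right]
    exact tsum_of_norm_bounded (hb.mul_right _).hasSum fun i => hbd i t ht
  · have := hasSum_integral_of_dominated_convergence (μ := volume.restrict (Ioi (0 : ℝ)))
      (F := fun i t => cexp (-p * t) * h i t) (f := fun t => cexp (-p * t) * ∑' i, h i t)
      (fun i t => b i * Real.exp (-1 * t))
      (fun i => ContinuousOn.aestronglyMeasurable (ContinuousOn.mul (by fun_prop) (hc i))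
        measurableSet_Ioi)
      (fun i => (ae_restrict_mem measurableSet_Ioi).mono fun t ht => norm_exp_mul_le (hbd i) hp ht)
      (ae_of_all _ fun t => hb.mul_right _) ?_
      ((ae_restrict_mem measurableSet_Ioi).mono fun t ht => (hsum t ht).hasSum.mul_left _)
    · refine this.unique ?_
      simpa only [hint _ p hp] using hG p hp
    · simp only [tsum_mul_right]
      exact integrable_exp_neg _

/-- A function with vanishing Laplace transform vanishes. -/
theorem HasLaplace.eq_zero {κ : ℝ} {h : ℝ → ℂ} {H : ℂ → ℂ} (hh : HasLaplace κ h H)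
    (hH : ∀ p : ℂ, p.re = κ → H p = 0) {t : ℝ} (ht : 0 < t) : h t = 0 := by
  -- Damped by `e^{-κt}` and extended by zero, the function has as Fourier transform at `y` the
  -- Laplace transform at `p = κ + 2πiy`. It vanishes, so it is trivially integrable, and Fourier
  -- inversion applies at the continuity point `t`.
  set f : ℝ → ℂ := (Ioi (0 : ℝ)).indicator fun t => cexp (-(κ : ℂ) * t) * h t with hf
  have hfi : Integrable f :=
    (integrable_indicator_iff measurableSet_Ioi).2 (hh.integrable (by simp))
  have hF : FourierTransform.fourier f = 0 := by
    funext y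
    rw [Real.fourier_real_eq_integral_exp_smul]
    have h1 := hh.integral (κ + 2 * Real.pi * y * I) (by simp)
    rw [hH _ (by simp), ← integral_indicator measurableSet_Ioi] at h1
    rw [Pi.zero_apply, ← h1]
    congr 1
    funext v
    simp only [hf, indicator]
    split_ifs
    · rw [smul_eq_mul, ← mul_assoc, ← Complex.exp_add]
      congr 2
      push_cast
      ring
    · simp
  have hcont : ContinuousAt f t := by
    have h1 : ContinuousAt (fun t : ℝ => cexp (-(κ : ℂ) * t) * h t) t :=
      ContinuousAt.mul (by fun_prop) (hh.cont.continuousAt (Ioi_mem_nhds ht))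
    refine h1.congr ?_
    filter_upwards [Ioi_mem_nhds ht] with r hr
    rw [hf, indicator_of_mem hr]
  have := hfi.fourierInv_fourier_eq (by rw [hF]; exact integrable_zero _ _ _) hcont
  rw [hF, hf, indicator_of_mem (mem_Ioi.2 ht)] at this
  have h0 : FourierTransformInv.fourierInv (0 : ℝ → ℂ) t = 0 := by
    rw [Real.fourierInv_eq']
    simp
  rw [h0] at this
  exact (mul_eq_zero.1 this.symm).resolve_left (Complex.exp_ne_zero _)

theorem hasLaplace_quadratic {κ : ℝ} (hκ : 2 ≤ κ) (a b c : ℂ) :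
    HasLaplace κ (fun t => b + a * t + c * t ^ 2 / 2)
      fun p => b / p + a / p ^ 2 + c / p ^ 3 := by
  have hbd : ∀ t : ℝ, 0 < t → ‖b + a * t + c * t ^ 2 / 2‖ ≤
      (‖b‖ + ‖a‖ + ‖c‖) * Real.exp ((κ - 1) * t) := by
    intro t ht
    have h1 : 1 + t + t ^ 2 / 2 ≤ Real.exp t := Real.quadratic_le_exp_of_nonneg ht.le
    have h2 : Real.exp t ≤ Real.exp ((κ - 1) * t) := Real.exp_le_exp.2 (by nlinarith)
    have hn : ‖(t : ℂ)‖ = t := by simp [abs_of_pos ht]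
    calc ‖b + a * t + c * t ^ 2 / 2‖ ≤ ‖b‖ + ‖a * t‖ + ‖c * t ^ 2 / 2‖ := norm_add₃_le
      _ = ‖b‖ * 1 + ‖a‖ * t + ‖c‖ * (t ^ 2 / 2) := by
          rw [norm_div, norm_mul, norm_mul, norm_pow, hn]
          simp
          ring
      _ ≤ ‖b‖ * Real.exp t + ‖a‖ * Real.exp t + ‖c‖ * Real.exp t := by
          gcongr <;> nlinarith [sq_nonneg t]
      _ = (‖b‖ + ‖a‖ + ‖c‖) * Real.exp t := by ring
      _ ≤ _ := by gcongr
  refine ⟨by fun_prop, ⟨_, hbd⟩, fun p hp => ?_⟩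
  have hp0 : p ≠ 0 := fun h => by rw [h, zero_re] at hp; linarith
  -- The antiderivative `-e^{-pt} (h/p + h'/p² + h''/p³)` given by repeated integration by parts,
  -- for the quadratic `h`.
  set q : ℝ → ℂ := fun t => -(cexp (-p * t) *
    ((b / p + a / p ^ 2 + c / p ^ 3) + (a / p + c / p ^ 2) * t + (c / p) * t ^ 2 / 2)) with hq
  have hderiv : ∀ t : ℝ, HasDerivAt q (cexp (-p * t) * (b + a * t + c * t ^ 2 / 2)) t := by
    intro t
    have h1 : HasDerivAt (fun z : ℂ => -(cexp (-p * z) *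
        ((b / p + a / p ^ 2 + c / p ^ 3) + (a / p + c / p ^ 2) * z + (c / p) * z ^ 2 / 2)))
        (cexp (-p * t) * (b + a * t + c * t ^ 2 / 2)) (t : ℂ) := by
      have he : HasDerivAt (fun z : ℂ => cexp (-p * z)) (cexp (-p * t) * (-p)) (t : ℂ) := by
        simpa using ((hasDerivAt_id (t : ℂ)).const_mul (-p)).cexp
      have hl : HasDerivAt (fun z : ℂ => (b / p + a / p ^ 2 + c / p ^ 3) + (a / p + c / p ^ 2) * z
          + (c / p) * z ^ 2 / 2) ((a / p + c / p ^ 2) + (c / p) * t) (t : ℂ) := by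
        have h3 := (((hasDerivAt_pow 2 (t : ℂ)).const_mul (c / p)).div_const 2)
        have h2 := ((hasDerivAt_id (t : ℂ)).const_mul (a / p + c / p ^ 2)).const_add
          (b / p + a / p ^ 2 + c / p ^ 3)
        refine (h2.add h3).congr_deriv ?_
        simp
        ring
      refine (he.mul hl).neg.congr_deriv ?_
      field_simp
      ring
    exact h1.comp_ofReal
  have hlim : Tendsto q atTop (𝓝 0) := by
    have h2 : ∀ t : ℝ, 0 < t → ‖q t‖ ≤ (‖b / p + a / p ^ 2 + c / p ^ 3‖ + ‖a / p + c / p ^ 2‖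
        + ‖c / p‖) * Real.exp (-1 * t) := by
      intro t ht
      have h1 : 1 + t + t ^ 2 / 2 ≤ Real.exp t := Real.quadratic_le_exp_of_nonneg ht.le
      have hn : ‖(t : ℂ)‖ = t := by simp [abs_of_pos ht]
      have h3 : Real.exp (-p * t).re ≤ Real.exp (-2 * t) := by
        refine Real.exp_le_exp.2 ?_
        simp [hp]
        nlinarith
      rw [hq, norm_neg, norm_mul, Complex.norm_exp]
      generalize b / p + a / p ^ 2 + c / p ^ 3 = u
      generalize a / p + c / p ^ 2 = v
      generalize c / p = w
      have h4 : ‖u + v * t + w * t ^ 2 / 2‖ ≤ (‖u‖ + ‖v‖ + ‖w‖) * Real.exp t := by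
        calc ‖u + v * t + w * t ^ 2 / 2‖ ≤ ‖u‖ + ‖v * t‖ + ‖w * t ^ 2 / 2‖ := norm_add₃_le
          _ = ‖u‖ * 1 + ‖v‖ * t + ‖w‖ * (t ^ 2 / 2) := by
              rw [norm_div, norm_mul, norm_mul, norm_pow, hn]
              simp
              ring
          _ ≤ ‖u‖ * Real.exp t + ‖v‖ * Real.exp t + ‖w‖ * Real.exp t := by
              gcongr <;> nlinarith [sq_nonneg t]
          _ = _ := by ring
      calc Real.exp (-p * t).re * ‖u + v * t + w * t ^ 2 / 2‖
          ≤ Real.exp (-2 * t) * ((‖u‖ + ‖v‖ + ‖w‖) * Real.exp t) := by gcongr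
        _ = (‖u‖ + ‖v‖ + ‖w‖) * (Real.exp (-2 * t) * Real.exp t) := by ring
        _ = _ := by rw [← Real.exp_add]; congr 2; ring
    refine squeeze_zero_norm' (eventually_gt_atTop 0 |>.mono h2) ?_
    rw [← mul_zero (_ + _ + _ : ℝ)]
    refine Tendsto.const_mul _ (Real.tendsto_exp_atBot.comp ?_)
    exact tendsto_id.const_mul_atTop_of_neg (by norm_num)
  have hint : IntegrableOn (fun t : ℝ => cexp (-p * t) * (b + a * t + c * t ^ 2 / 2)) (Ioi 0) := by
    refine Integrable.mono' (integrable_exp_neg (‖b‖ + ‖a‖ + ‖c‖)) ?_ ?_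
    · exact Continuous.aestronglyMeasurable (by fun_prop)
    · exact (ae_restrict_mem measurableSet_Ioi).mono fun t ht => norm_exp_mul_le hbd hp ht
  rw [integral_Ioi_of_hasDerivAt_of_tendsto' (fun t _ => hderiv t) hint hlim]
  simp [hq]

/-- Translating `t² / 2` by `l` multiplies its transform `1 / p³` by `e^{-pl}`; `0 ≤ l` keeps the
translated support inside `(0, ∞)`. With `l = log n` this is the real form of Perron's kernel. -/
theorem integral_exp_mul_truncated_sq {p : ℂ} (hp : 2 ≤ p.re) {l : ℝ} (hl : 0 ≤ l) :
    ∫ t in Ioi (0 : ℝ), cexp (-p * t) * ((max (t - l) 0 ^ 2 / 2 : ℝ) : ℂ) =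
      cexp (-p * l) / p ^ 3 := by
  have h1 := (hasLaplace_quadratic hp 0 0 1).integral p rfl
  simp only [zero_mul, add_zero, zero_add, zero_div, one_mul] at h1
  rw [← integral_indicator measurableSet_Ioi] at h1 ⊢
  rw [div_eq_mul_one_div, ← h1, ← integral_sub_right_eq_self
    (fun t : ℝ => (Ioi (0 : ℝ)).indicator (fun t : ℝ => cexp (-p * t) * ((t : ℂ) ^ 2 / 2)) t) l,
    ← integral_const_mul]
  congr 1
  funext t
  simp only [indicator, mem_Ioi]
  by_cases h : 0 < t - l
  · rw [if_pos h, if_pos (by linarith), max_eq_left h.le, ← mul_assoc, ← Complex.exp_add]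
    push_cast
    congr 2
    ring
  · rw [if_neg h, mul_zero, max_eq_right (not_lt.1 h)]
    simp

/-! ### From the Mittag-Leffler expansion to the explicit formula -/

theorem term_mul_exp {c : ℕ → ℂ} {s p : ℂ} (n : ℕ) :
    LSeries.term c s n * cexp (-p * Real.log n) = LSeries.term c (s + p) n := by
  rcases Nat.eq_zero_or_pos n with rfl | hn
  · simp
  · have hn0 : (n : ℂ) ≠ 0 := by exact_mod_cast hn.ne'
    rw [LSeries.term_of_ne_zero hn.ne', LSeries.term_of_ne_zero hn.ne', cpow_add _ _ hn0,
      neg_mul, Complex.exp_neg, ← div_div, div_eq_mul_inv (c n / _)]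
    congr 2
    rw [cpow_def_of_ne_zero hn0, natCast_log, mul_comm p]

/-- With `b = κ - 1` and `l = log n`, the majorant splits into `e^{(κ-1)t}` and a factor
`n^{-(κ-1)}` that moves the Dirichlet series into its region of absolute convergence. -/
theorem truncated_sq_le {b t l : ℝ} (hb : 1 ≤ b) : max (t - l) 0 ^ 2 / 2 ≤ Real.exp (b * (t - l)) := by
  rcases le_total (t - l) 0 with h | h
  · rw [max_eq_right h]
    simpa using (Real.exp_pos _).le
  · rw [max_eq_left h]
    have h1 := Real.quadratic_le_exp_of_nonneg h
    have h2 : Real.exp (t - l) ≤ Real.exp (b * (t - l)) := Real.exp_le_exp.2 (by nlinarith)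
    linarith

/-- The smoothed explicit formula before specialising the smoothing parameter. -/
theorem HasExpansion.truncated_sum_eq {s : ℂ} {B : ℝ} {L m : ℂ → ℂ} (h : HasExpansion s B L m)
    {c : ℕ → ℂ} {σ : ℝ} (hc : ∀ w : ℂ, σ < w.re → LSeriesHasSum c w (L w)) :
    ∃ a b : ℂ, ∀ t : ℝ, 0 < t →
      ∑' n, LSeries.term c s n * ((max (t - Real.log n) 0 ^ 2 / 2 : ℝ) : ℂ) =
        (b + a * t + L s * t ^ 2 / 2) + ∑' u : {u // m u ≠ 0},
          m u / ((u : ℂ) - s) ^ 3 * cexp (((u : ℂ) - s) * t) := by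
  obtain ⟨a, b, hab⟩ := h.expansion
  refine ⟨a, b, ?_⟩
  set B' : ℝ := max (max B σ) s.re with hB'
  have hB1 : B ≤ B' := (le_max_left _ _).trans (le_max_left _ _)
  have hB2 : σ ≤ B' := (le_max_right _ _).trans (le_max_left _ _)
  have hB3 : s.re ≤ B' := le_max_right _ _
  -- On `Re p = κ` the point `s + p` has real part `B' + 2`, beyond all poles and inside the region
  -- of convergence. The point `s + κ - 1`, of real part `B' + 1`, still has both properties, which
  -- gives the summable weights; `Re s ≤ B'` yields `κ ≥ 2`.
  set κ : ℝ := B' - s.re + 2 with hκ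
  have hκ2 : 2 ≤ κ := by linarith
  have hus : ∀ u, m u ≠ 0 → u - s ≠ 0 := fun u hu h0 => hu (by rw [sub_eq_zero.1 h0, h.center])
  have hcount : Countable {u // m u ≠ 0} := by
    refine (h.summable.countable_support.mono fun u hu => ?_).to_subtype
    have := hus u hu
    exact div_ne_zero (norm_ne_zero_iff.2 hu) (pow_ne_zero _ (norm_ne_zero_iff.2 this))
  have hA : HasLaplace κ
      (fun t => ∑' n, LSeries.term c s n * ((max (t - Real.log n) 0 ^ 2 / 2 : ℝ) : ℂ))
      fun p => L (s + p) / p ^ 3 := by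
    refine hasLaplace_tsum (b := fun n => ‖LSeries.term c (s + (κ - 1 : ℝ)) n‖)
      (H := fun n p => LSeries.term c s n * (cexp (-p * Real.log n) / p ^ 3)) ?_ ?_ ?_ ?_ ?_
    · refine (hc _ ?_).summable.norm
      simp only [add_re, ofReal_re]
      linarith
    · intro n
      refine Continuous.continuousOn ?_
      have : Continuous fun t : ℝ => max (t - Real.log n) 0 ^ 2 / 2 := by fun_prop
      exact continuous_const.mul (continuous_ofReal.comp this)
    · intro n t ht
      rw [← term_mul_exp, norm_mul, norm_mul, mul_assoc]
      gcongr
      rw [Complex.norm_exp, ← Real.exp_add, norm_real, Real.norm_of_nonneg (by positivity)]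
      refine (truncated_sq_le (b := κ - 1) (by linarith)).trans (le_of_eq ?_)
      congr 1
      rw [← ofReal_neg, ← ofReal_mul, ofReal_re]
      ring
    · intro n p hp
      rw [← integral_exp_mul_truncated_sq (hp ▸ hκ2) (Real.log_natCast_nonneg n),
        ← integral_const_mul]
      congr 1
      funext t
      ring
    · intro p hp
      have h1 : LSeriesHasSum c (s + p) (L (s + p)) := hc _ (by rw [add_re, hp]; linarith)
      refine (HasSum.div_const h1 (p ^ 3)).of_eq (fun n => ?_) rfl
      rw [← term_mul_exp, mul_div_assoc]
  have hQ := hasLaplace_quadratic hκ2 a b (L s)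
  have hR : HasLaplace κ (fun t => ∑' u : {u // m u ≠ 0},
      m u / ((u : ℂ) - s) ^ 3 * cexp (((u : ℂ) - s) * t))
      fun p => (L (s + p) - (L s + a * p + b * p ^ 2)) / p ^ 3 := by
    refine hasLaplace_tsum (ι := {u // m u ≠ 0}) (b := fun u => ‖m u‖ / ‖(u : ℂ) - s‖ ^ 3)
      (H := fun u p => m u / (((u : ℂ) - s) ^ 3 * (s + p - u))) ?_ ?_ ?_ ?_ ?_
    · exact h.summable.subtype _
    · intro u; fun_prop
    · intro u t ht
      rw [norm_mul, norm_div, norm_pow, Complex.norm_exp]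
      gcongr
      have h1 := h.re_le u u.2
      simp only [mul_re, sub_re, ofReal_re, ofReal_im, mul_zero, sub_zero]
      exact mul_le_mul_of_nonneg_right (by linarith) ht.le
    · intro u p hp
      have h1 := h.re_le u u.2
      have h2 : ((u : ℂ) - s - p).re < 0 := by
        simp only [sub_re, hp]; linarith
      have h3 : (u : ℂ) - s - p ≠ 0 := fun h0 => by rw [h0] at h2; simp at h2
      have h4 : s + p - u ≠ 0 := fun h0 => h3 (by linear_combination -h0)
      have h5 := hus u u.2
      have h6 := integral_exp_mul_complex_Ioi h2 0
      calc ∫ t in Ioi (0 : ℝ), cexp (-p * t) * (m u / ((u : ℂ) - s) ^ 3 * cexp (((u : ℂ) - s) * t))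
          = ∫ t in Ioi (0 : ℝ), m u / ((u : ℂ) - s) ^ 3 * cexp (((u : ℂ) - s - p) * t) := by
            congr 1
            funext t
            rw [mul_left_comm, ← Complex.exp_add]
            congr 2
            ring
        _ = _ := by
            rw [integral_const_mul, h6]
            simp only [ofReal_zero, mul_zero, Complex.exp_zero]
            rw [show (u : ℂ) - s - p = -(s + p - u) by ring]
            field_simp
    · intro p hp
      have hp0 : p ≠ 0 := fun h => by rw [h, zero_re] at hp; linarith
      have h1 := (hab (s + p) (by rw [add_re, hp]; linarith)).div_const (p ^ 3)
      rw [← hasSum_subtype_iff_of_support_subset (s := {u | m u ≠ 0})] at h1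
      · refine h1.of_eq (fun u => ?_) (by ring)
        have : s + p - s = p := by ring
        simp only [Function.comp, this]
        rw [mul_div_cancel_right₀ _ (pow_ne_zero 3 hp0)]
      · intro u hu hm
        exact hu (by simp only [hm, zero_div, zero_mul])
  -- The expansion at `w = s + p`, divided by `p³`, says exactly that this difference has zero
  -- transform.
  have hz := hA.sub (hQ.add hR)
  intro t ht
  refine sub_eq_zero.1 (hz.eq_zero (fun p hp => ?_) ht)
  have hp0 : p ≠ 0 := fun h => by rw [h, zero_re] at hp; linarith
  field_simp
  ring

/-! ### Second differences at `log x`, `2 log x`, `3 log x` -/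

theorem kernel_eq_exp {x : ℝ} (hx : 1 < x) (s u : ℂ) :
    kernel x s u = (cexp ((u - s) * Real.log x) - 2 * cexp ((u - s) * (2 * Real.log x : ℝ)) +
      cexp ((u - s) * (3 * Real.log x : ℝ))) / (Real.log x ^ 2 * (u - s) ^ 3) := by
  have hx0 : (x : ℂ) ≠ 0 := by exact_mod_cast (by linarith : x ≠ 0)
  have e : (x : ℂ) ^ (u - s) = cexp ((u - s) * Real.log x) := by
    rw [cpow_def_of_ne_zero hx0, ← ofReal_log (by linarith), mul_comm]
  have e2 : cexp ((u - s) * (2 * Real.log x : ℝ)) = cexp ((u - s) * Real.log x) ^ 2 := by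
    rw [← Complex.exp_nat_mul]; congr 1; push_cast; ring
  have e3 : cexp ((u - s) * (3 * Real.log x : ℝ)) = cexp ((u - s) * Real.log x) ^ 3 := by
    rw [← Complex.exp_nat_mul]; congr 1; push_cast; ring
  rw [kernel, e, e2, e3]
  -- With `y = x^{u-s}`, this is `y (1 - y)² = y - 2y² + y³`.
  congr 1
  ring

/-- The weights of `Σ_x` are the same second difference applied to `t ↦ (t - log n)₊² / 2`. For `n ≤
x` nothing is truncated and it equals `log² x`; beyond `x` the first term vanishes, beyond `x²` the
second also. -/
theorem log_sq_mul_smoothed {x : ℝ} (hx : 1 < x) (c : ℕ → ℂ) {n : ℕ} (hn : 0 < n)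
    (hn3 : (n : ℝ) < x ^ 3) :
    (Real.log x : ℂ) ^ 2 * smoothed x c n =
      c n * (((max (Real.log x - Real.log n) 0 ^ 2 / 2
        - 2 * (max (2 * Real.log x - Real.log n) 0 ^ 2 / 2)
        + max (3 * Real.log x - Real.log n) 0 ^ 2 / 2 : ℝ)) : ℂ) := by
  have hn0 : (0 : ℝ) < n := by exact_mod_cast hn
  have hx0 : 0 < x := by linarith
  have hT : 0 < Real.log x := Real.log_pos hx
  have hTc : (Real.log x : ℂ) ≠ 0 := by exact_mod_cast hT.ne'
  have e2 : Real.log (x ^ 2 / n) = 2 * Real.log x - Real.log n := by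
    rw [Real.log_div (by positivity) hn0.ne', Real.log_pow]; norm_num
  have e3 : Real.log (x ^ 3 / n) = 3 * Real.log x - Real.log n := by
    rw [Real.log_div (by positivity) hn0.ne', Real.log_pow]; norm_num
  have l3 : Real.log n ≤ 3 * Real.log x := by
    have := Real.log_le_log hn0 hn3.le
    rwa [Real.log_pow] at this
  have m3 : max (3 * Real.log x - Real.log n) 0 = 3 * Real.log x - Real.log n :=
    max_eq_left (by linarith)
  rw [smoothed, e2, e3, m3]
  have key1 : ∀ r v : ℝ, Real.log x ^ 2 * r = v →
      (Real.log x : ℂ) ^ 2 * (c n * (r : ℂ)) = c n * (v : ℂ) := by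
    intro r v hrv
    rw [← hrv]; push_cast; ring
  split_ifs with h1 h2
  · have l1 := Real.log_le_log hn0 h1
    rw [max_eq_left (by linarith), max_eq_left (by linarith)]
    have := key1 1 (((Real.log x - Real.log n) ^ 2 / 2
        - 2 * ((2 * Real.log x - Real.log n) ^ 2 / 2)
        + (3 * Real.log x - Real.log n) ^ 2 / 2)) (by ring)
    simpa using this
  · have l2 := Real.log_le_log hn0 h2
    rw [Real.log_pow] at l2
    have l1 := Real.log_lt_log hx0 (not_le.1 h1)
    rw [max_eq_right (by linarith), max_eq_left (by push_cast at l2; linarith)]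
    refine key1 _ _ ?_
    field_simp
    ring
  · have l2 := Real.log_lt_log (by positivity) (not_le.1 h2)
    rw [Real.log_pow] at l2
    push_cast at l2
    rw [max_eq_right (by linarith), max_eq_right (by linarith)]
    refine key1 _ _ ?_
    field_simp
    ring
  · exact absurd hn3.le ‹_›

/-- The poles satisfy `Re u ≤ B`, so the powers of `x` are uniformly bounded and only `‖m u‖ / ‖u -
s‖³` remains. -/
theorem HasExpansion.summable_kernel {s : ℂ} {B : ℝ} {L m : ℂ → ℂ} (h : HasExpansion s B L m)
    {x : ℝ} (hx : 1 < x) : Summable fun u => m u * kernel x s u := by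
  have hx0 : 0 < x := by linarith
  set C : ℝ := x ^ (B - s.re) * (1 + x ^ (B - s.re)) ^ 2 / Real.log x ^ 2 with hC
  refine Summable.of_norm_bounded (h.summable.mul_left C) fun u => ?_
  by_cases hm : m u = 0
  · simp [hm]
  have hy : ‖(x : ℂ) ^ (u - s)‖ ≤ x ^ (B - s.re) := by
    rw [norm_cpow_eq_rpow_re_of_pos hx0]
    refine Real.rpow_le_rpow_of_exponent_le hx.le ?_
    have := h.re_le u hm
    simpa using this
  rw [kernel, norm_mul, norm_div, norm_mul, norm_mul, norm_pow, norm_pow, norm_pow, norm_real,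
    Real.norm_eq_abs, sq_abs, hC]
  calc ‖m u‖ * (‖(x : ℂ) ^ (u - s)‖ * ‖1 - (x : ℂ) ^ (u - s)‖ ^ 2 /
        (Real.log x ^ 2 * ‖u - s‖ ^ 3))
      ≤ ‖m u‖ * (x ^ (B - s.re) * (1 + x ^ (B - s.re)) ^ 2 / (Real.log x ^ 2 * ‖u - s‖ ^ 3)) := by
        gcongr
        refine (norm_sub_le _ _).trans ?_
        rw [norm_one]
        gcongr
    _ = _ := by
        rw [div_mul_div_comm, mul_comm ‖m u‖, div_mul_eq_mul_div]

/-- **Selberg's explicit formula**, for any function with a Mittag-Leffler expansion and a Dirichlet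
series. -/
theorem HasExpansion.explicit_formula {s : ℂ} {B : ℝ} {L m : ℂ → ℂ} (h : HasExpansion s B L m)
    {c : ℕ → ℂ} {σ : ℝ} (hc : ∀ w : ℂ, σ < w.re → LSeriesHasSum c w (L w)) {x : ℝ} (hx : 1 < x) :
    L s = (∑ n ∈ Finset.Ico 1 ⌈x ^ 3⌉₊, smoothed x c n / (n : ℂ) ^ s) -
      ∑' u, m u * kernel x s u := by
  obtain ⟨a, b, hab⟩ := h.truncated_sum_eq hc
  have hT : 0 < Real.log x := Real.log_pos hx
  have hTc : (Real.log x : ℂ) ≠ 0 := by exact_mod_cast hT.ne'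
  set T := Real.log x with hTdef
  set F : ℝ → {u // m u ≠ 0} → ℂ := fun t u =>
    m u / ((u : ℂ) - s) ^ 3 * cexp (((u : ℂ) - s) * t) with hF
  have hFs : ∀ t, 0 < t → Summable (F t) := by
    intro t ht
    refine Summable.of_norm_bounded (g := fun u : {u // m u ≠ 0} =>
      ‖m u‖ / ‖(u : ℂ) - s‖ ^ 3 * Real.exp ((B - s.re) * t))
      ((h.summable.subtype _).mul_right _) fun u => ?_
    rw [hF, norm_mul, norm_div, norm_pow, Complex.norm_exp]
    gcongr
    have h1 := h.re_le u u.2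
    simp only [mul_re, sub_re, ofReal_re, ofReal_im, mul_zero, sub_zero]
    gcongr
  -- For `t ≤ 3 log x` the truncation kills every `n ≥ x³`, so the series is a finite sum.
  have hfin : ∀ t, t ≤ 3 * T →
      ∑' n, LSeries.term c s n * ((max (t - Real.log n) 0 ^ 2 / 2 : ℝ) : ℂ) =
      ∑ n ∈ Finset.Ico 1 ⌈x ^ 3⌉₊, c n / (n : ℂ) ^ s *
        ((max (t - Real.log n) 0 ^ 2 / 2 : ℝ) : ℂ) := by
    intro t ht
    rw [tsum_eq_sum (s := Finset.Ico 1 ⌈x ^ 3⌉₊)]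
    · refine Finset.sum_congr rfl fun n hn => ?_
      rw [LSeries.term_of_ne_zero (by have := (Finset.mem_Ico.1 hn).1; omega)]
    · intro n hn
      rcases Nat.eq_zero_or_pos n with rfl | hn0
      · simp
      · have h1 : ⌈x ^ 3⌉₊ ≤ n := by
          by_contra! h2
          exact hn (Finset.mem_Ico.2 ⟨hn0, h2⟩)
        have h2 := Real.log_le_log (by positivity) (Nat.ceil_le.1 h1)
        rw [Real.log_pow] at h2
        push_cast at h2
        rw [max_eq_right (by linarith)]
        simp
  have h1 := hab T hT
  have h2 := hab (2 * T) (by linarith)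
  have h3 := hab (3 * T) (by linarith)
  rw [hfin _ (by linarith)] at h1 h2 h3
  have hk : ∑' u, m u * kernel x s u =
      (∑' u, F T u - 2 * ∑' u, F (2 * T) u + ∑' u, F (3 * T) u) / (T : ℂ) ^ 2 := by
    have e1 : ∑' u, m u * kernel x s u = ∑' u : {u | m u ≠ 0}, m u * kernel x s u := by
      refine (tsum_subtype_eq_of_support_subset (f := fun u => m u * kernel x s u) ?_).symm
      intro u hu
      exact left_ne_zero_of_mul hu
    rw [e1, ← tsum_mul_left, ← (hFs T hT).tsum_sub ((hFs (2 * T) (by linarith)).mul_left 2),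
      ← ((hFs T hT).sub ((hFs (2 * T) (by linarith)).mul_left 2)).tsum_add
        (hFs (3 * T) (by linarith)), ← tsum_div_const]
    refine tsum_congr fun u => ?_
    rw [kernel_eq_exp hx, hF, ← hTdef]
    field_simp
  have hs : (T : ℂ) ^ 2 * ∑ n ∈ Finset.Ico 1 ⌈x ^ 3⌉₊, smoothed x c n / (n : ℂ) ^ s =
      ∑ n ∈ Finset.Ico 1 ⌈x ^ 3⌉₊, c n / (n : ℂ) ^ s * ((max (T - Real.log n) 0 ^ 2 / 2 : ℝ) : ℂ)
      - 2 * ∑ n ∈ Finset.Ico 1 ⌈x ^ 3⌉₊,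
        c n / (n : ℂ) ^ s * ((max (2 * T - Real.log n) 0 ^ 2 / 2 : ℝ) : ℂ)
      + ∑ n ∈ Finset.Ico 1 ⌈x ^ 3⌉₊,
        c n / (n : ℂ) ^ s * ((max (3 * T - Real.log n) 0 ^ 2 / 2 : ℝ) : ℂ) := by
    rw [Finset.mul_sum, Finset.mul_sum, ← Finset.sum_sub_distrib, ← Finset.sum_add_distrib]
    refine Finset.sum_congr rfl fun n hn => ?_
    rw [Finset.mem_Ico] at hn
    rw [← mul_div_assoc, log_sq_mul_smoothed hx c (by omega) (Nat.lt_ceil.1 hn.2)]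
    push_cast
    ring
  change _ = _ + ∑' u, F T u at h1
  change _ = _ + ∑' u, F (2 * T) u at h2
  change _ = _ + ∑' u, F (3 * T) u at h3
  generalize ∑' u, F T u = S₁ at h1 hk
  generalize ∑' u, F (2 * T) u = S₂ at h2 hk
  generalize ∑' u, F (3 * T) u = S₃ at h3 hk
  rw [hk]
  -- The coefficients `1, -2, 1` at `T, 2T, 3T` annihilate `b + a t`, and `(1 - 8 + 9) / 2 = 1` is
  -- the coefficient of `L s * T²`.
  have hmain : (T : ℂ) ^ 2 * ∑ n ∈ Finset.Ico 1 ⌈x ^ 3⌉₊, smoothed x c n / (n : ℂ) ^ s =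
      L s * T ^ 2 + (S₁ - 2 * S₂ + S₃) := by
    rw [hs, h1, h2, h3]
    push_cast
    ring
  field_simp
  linear_combination -hmain

end Motohashi

namespace Motohashi

open MeasureTheory Set

/-! ### Growth of the zeta function -/

/-- The function equal to the fractional part on `(1, ∞)` and `0` elsewhere. -/
noncomputable def fractTail : ℝ → ℂ := (Ioi (1 : ℝ)).indicator fun t => ((Int.fract t : ℝ) : ℂ)

theorem norm_fractTail_le (t : ℝ) : ‖fractTail t‖ ≤ 1 := by
  unfold fractTail
  by_cases h : t ∈ Ioi (1 : ℝ)
  · rw [indicator_of_mem h, norm_real, Real.norm_of_nonneg (Int.fract_nonneg t)]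
    exact (Int.fract_lt_one t).le
  · rw [indicator_of_notMem h]; simp

theorem measurable_fractTail : Measurable fractTail :=
  (measurable_ofReal.comp measurable_fract).indicator measurableSet_Ioi

theorem differentiableAt_mellin_fractTail {s : ℂ} (hs : 0 < s.re) :
    DifferentiableAt ℂ (fun s => mellin fractTail (-s)) s := by
  have h1 : DifferentiableAt ℂ (mellin fractTail) (-s) := by
    -- `a = 0` because the function is bounded. Any `b` below `Re (-s)` would do, because it
    -- vanishes on `(0, 1)`.
    refine mellin_differentiableAt_of_isBigO_rpow (a := 0) (b := -s.re - 1) ?_ ?_ ?_ ?_ ?_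
    · have h2 : LocallyIntegrable (fun _ : ℝ => (1 : ℝ)) := locallyIntegrable_const 1
      have h3 : LocallyIntegrable fractTail :=
        h2.mono measurable_fractTail.aestronglyMeasurable
          (ae_of_all _ fun t => by simpa using norm_fractTail_le t)
      exact h3.locallyIntegrableOn _
    · refine Asymptotics.IsBigO.of_bound 1 (Eventually.of_forall fun t => ?_)
      simpa using norm_fractTail_le t
    · simpa using hs
    · refine Asymptotics.IsBigO.of_bound 1 ?_
      filter_upwards [mem_nhdsWithin_of_mem_nhds (Iio_mem_nhds (zero_lt_one (α := ℝ)))] with t ht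
      rw [fractTail, indicator_of_notMem (by simpa using (mem_Iio.1 ht).le)]
      simp
    · simp
  exact DifferentiableAt.comp s (f := fun s : ℂ => -s) h1 (by fun_prop)

theorem mellin_fractTail (s : ℂ) :
    mellin fractTail (-s) = ∫ t in Ioi (1 : ℝ), ((Int.fract t : ℝ) : ℂ) * (t : ℂ) ^ (-(s + 1)) := by
  have h1 : ∀ t : ℝ, (t : ℂ) ^ (-s - 1) • fractTail t = (Ioi (1 : ℝ)).indicator
      (fun t : ℝ => ((Int.fract t : ℝ) : ℂ) * (t : ℂ) ^ (-(s + 1))) t := by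
    intro t
    rw [fractTail]
    by_cases h : t ∈ Ioi (1 : ℝ)
    · rw [indicator_of_mem h, indicator_of_mem h, smul_eq_mul, mul_comm]
      congr 2
      ring
    · rw [indicator_of_notMem h, indicator_of_notMem h, smul_zero]
  rw [mellin, setIntegral_congr_fun measurableSet_Ioi fun t _ => h1 t,
    setIntegral_indicator measurableSet_Ioi]
  congr 2
  ext t
  simp only [mem_inter_iff, mem_Ioi]
  constructor <;> intro h <;> [exact h.2; exact ⟨by linarith, h⟩]

theorem integrableOn_fract_mul_cpow {s : ℂ} (hs : 0 < s.re) :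
    IntegrableOn (fun t : ℝ => ((Int.fract t : ℝ) : ℂ) * (t : ℂ) ^ (-(s + 1))) (Ioi 1) := by
  have h1 : IntegrableOn (fun t : ℝ => (t : ℂ) ^ (-(s + 1))) (Ioi 1) :=
    integrableOn_Ioi_cpow_of_lt (by simp; linarith) one_pos
  refine h1.bdd_mul (c := 1) ?_ (ae_of_all _ fun t => ?_)
  · exact (measurable_ofReal.comp measurable_fract).aestronglyMeasurable
  · rw [norm_real, Real.norm_of_nonneg (Int.fract_nonneg t)]
    exact (Int.fract_lt_one t).le

/-- Partial summation gives `ζ(s) = s ∫ ⌊t⌋ t^{-s-1}` over `t > 1`; writing `⌊t⌋ = t - {t}` isolates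
the pole. -/
theorem riemannZeta₁_eq_of_one_lt_re {s : ℂ} (hs : 1 < s.re) :
    riemannZeta₁ s = s - s * (s - 1) * mellin fractTail (-s) := by
  have hs1 : s - 1 ≠ 0 := fun h => by
    rw [sub_eq_zero.1 h] at hs; simp at hs
  have h1 : riemannZeta s = s * ∫ t in Ioi (1 : ℝ), (⌊t⌋₊ : ℂ) * (t : ℂ) ^ (-(s + 1)) := by
    rw [← LSeries_one_eq_riemannZeta hs, LSeries_eq_mul_integral 1 zero_le_one hs
      (LSeriesSummable_one_iff.2 hs)]
    · simp
    · refine Asymptotics.IsBigO.of_bound 1 (Eventually.of_forall fun n => ?_)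
      simp
  have h2 : ∫ t in Ioi (1 : ℝ), (⌊t⌋₊ : ℂ) * (t : ℂ) ^ (-(s + 1)) =
      (∫ t in Ioi (1 : ℝ), (t : ℂ) ^ (-s)) - mellin fractTail (-s) := by
    rw [mellin_fractTail, ← integral_sub (integrableOn_Ioi_cpow_of_lt (by simpa) one_pos)
      (integrableOn_fract_mul_cpow (by linarith))]
    refine setIntegral_congr_fun measurableSet_Ioi fun t ht => ?_
    have ht0 : (0 : ℝ) < t := one_pos.trans ht
    have htc : (t : ℂ) ≠ 0 := by exact_mod_cast ht0.ne'
    have e : (t : ℂ) ^ (-s) = t * (t : ℂ) ^ (-(s + 1)) := by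
      rw [show -s = 1 + -(s + 1) by ring, cpow_add _ _ htc, cpow_one]
    have e2 : ((Int.fract t : ℝ) : ℂ) = t - (⌊t⌋₊ : ℂ) := by
      rw [Int.fract, ofReal_sub, ← natCast_floor_eq_intCast_floor ht0.le]
      simp
    simp only [e, e2]
    ring
  rw [integral_Ioi_cpow_of_lt (by simpa) one_pos] at h2
  have h3 : riemannZeta₁ s = (s - 1) * riemannZeta s := by
    rw [riemannZeta_eq_inv_sub_mul (sub_ne_zero.1 hs1), mul_inv_cancel_left₀ hs1]
  rw [h3, h1, h2]
  have hs1' : -s + 1 ≠ 0 := fun h => hs1 (by linear_combination -h)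
  simp only [ofReal_one, one_cpow]
  field_simp
  ring

theorem riemannZeta₁_eq_of_re_pos {s : ℂ} (hs : 0 < s.re) :
    riemannZeta₁ s = s - s * (s - 1) * mellin fractTail (-s) := by
  have hopen : IsOpen {s : ℂ | 0 < s.re} := isOpen_lt continuous_const continuous_re
  have hopen1 : IsOpen {s : ℂ | 1 < s.re} := isOpen_lt continuous_const continuous_re
  have hd : DifferentiableOn ℂ (fun s : ℂ => s - s * (s - 1) * mellin fractTail (-s))
      {s : ℂ | 0 < s.re} := fun w hw => by
    have := differentiableAt_mellin_fractTail hw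
    exact DifferentiableAt.differentiableWithinAt (by fun_prop)
  refine (differentiable_riemannZeta₁.differentiableOn.analyticOnNhd
    hopen).eqOn_of_preconnected_of_eventuallyEq (hd.analyticOnNhd hopen)
    (convex_halfSpace_re_gt 0).isPreconnected (z₀ := 2) (by simp) ?_ hs
  filter_upwards [hopen1.mem_nhds (by simp : (2 : ℂ) ∈ {s : ℂ | 1 < s.re})] with w hw
  exact riemannZeta₁_eq_of_one_lt_re hw

theorem norm_riemannZeta₁_le {s : ℂ} (hs : 1 / 2 ≤ s.re) :
    ‖riemannZeta₁ s‖ ≤ 4 * (1 + ‖s‖) ^ 2 := by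
  have h1 : ‖mellin fractTail (-s)‖ ≤ 2 := by
    rw [mellin_fractTail]
    have h2 : ∫ t in Ioi (1 : ℝ), t ^ (-(3 / 2) : ℝ) = 2 := by
      rw [integral_Ioi_rpow_of_lt (by norm_num) one_pos]; norm_num
    rw [← h2]
    refine norm_integral_le_of_norm_le (integrableOn_Ioi_rpow_of_lt (by norm_num) one_pos) ?_
    refine (ae_restrict_mem measurableSet_Ioi).mono fun t ht => ?_
    have ht1 : (1 : ℝ) < t := ht
    rw [norm_mul, norm_real, Real.norm_of_nonneg (Int.fract_nonneg t),
      norm_cpow_eq_rpow_re_of_pos (by linarith)]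
    calc Int.fract t * t ^ (-(s + 1)).re ≤ 1 * t ^ (-(3 / 2) : ℝ) := by
          gcongr
          · exact (Int.fract_lt_one t).le
          · exact ht1.le
          · simp; linarith
      _ = _ := one_mul _
  rw [riemannZeta₁_eq_of_re_pos (by linarith)]
  calc ‖s - s * (s - 1) * mellin fractTail (-s)‖
      ≤ ‖s‖ + ‖s‖ * (‖s‖ + 1) * 2 := by
        refine (norm_sub_le _ _).trans ?_
        rw [norm_mul, norm_mul]
        gcongr
        exact (norm_sub_le _ _).trans (by simp)
    _ ≤ _ := by nlinarith [norm_nonneg s]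

theorem norm_Gamma_le {s : ℂ} (hs : 0 < s.re) : ‖Complex.Gamma s‖ ≤ Real.Gamma s.re := by
  rw [Complex.Gamma_eq_integral hs, Real.Gamma_eq_integral hs, Complex.GammaIntegral]
  refine norm_integral_le_of_norm_le (Real.GammaIntegral_convergent hs) ?_
  refine (ae_restrict_mem measurableSet_Ioi).mono fun t ht => ?_
  rw [norm_mul, norm_cpow_eq_rpow_re_of_pos ht, norm_real, Real.norm_of_nonneg (Real.exp_pos _).le]
  simp

/-- Shifting by `2` reaches the range where the real Gamma function is increasing. There it is
compared with `n! ≤ n^n ≤ exp (n²)`; the factors `s` and `s + 1` divided out are not small. -/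
theorem norm_Gamma_le_exp {s : ℂ} (hs : 1 / 2 ≤ s.re) :
    ‖Complex.Gamma s‖ ≤ 2 * Real.exp ((‖s‖ + 2) ^ 2) := by
  have h1 : s ≠ 0 := fun h => by rw [h] at hs; norm_num at hs
  have h2 : s + 1 ≠ 0 := fun h => by
    have := congrArg re h
    simp at this
    linarith
  have e : Complex.Gamma (s + 2) = (s + 1) * (s * Complex.Gamma s) := by
    rw [← Complex.Gamma_add_one s h1, ← Complex.Gamma_add_one (s + 1) h2]
    congr 1
    ring
  have n1 : 1 / 2 ≤ ‖s‖ := hs.trans (re_le_norm s)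
  have n2 : 1 ≤ ‖s + 1‖ := by
    have := re_le_norm (s + 1)
    simp at this
    linarith
  have h3 : ‖Complex.Gamma s‖ ≤ 2 * ‖Complex.Gamma (s + 2)‖ := by
    rw [e, norm_mul, norm_mul]
    have := norm_nonneg (Complex.Gamma s)
    have h4 : 1 / 2 * ‖Complex.Gamma s‖ ≤ ‖s‖ * ‖Complex.Gamma s‖ := by gcongr
    have h5 : 1 * (‖s‖ * ‖Complex.Gamma s‖) ≤ ‖s + 1‖ * (‖s‖ * ‖Complex.Gamma s‖) := by gcongr
    linarith
  refine h3.trans ?_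
  gcongr
  set n : ℕ := ⌈s.re⌉₊ + 1 with hn
  have hre : (s + 2).re = s.re + 2 := by simp
  have hn1 : s.re + 2 ≤ n + 1 := by
    rw [hn]; push_cast; linarith [Nat.le_ceil s.re]
  have hn2 : (n : ℝ) ≤ ‖s‖ + 2 := by
    rw [hn]; push_cast
    linarith [(Nat.ceil_lt_add_one (show 0 ≤ s.re by linarith)).le, re_le_norm s]
  calc ‖Complex.Gamma (s + 2)‖ ≤ Real.Gamma (s.re + 2) := by
        rw [← hre]; exact norm_Gamma_le (by rw [hre]; linarith)
    _ ≤ Real.Gamma (n + 1) := Real.Gamma_strictMonoOn_Ici.monotoneOn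
        (by simp; linarith) (by simp only [mem_Ici]; linarith) hn1
    _ = (n.factorial : ℝ) := Real.Gamma_nat_eq_factorial n
    _ ≤ (n : ℝ) ^ n := by exact_mod_cast Nat.factorial_le_pow n
    _ ≤ Real.exp n ^ n := by gcongr; linarith [Real.add_one_le_exp (n : ℝ)]
    _ = Real.exp ((n : ℝ) ^ 2) := by rw [← Real.exp_nat_mul]; ring_nf
    _ ≤ _ := by gcongr

theorem norm_cos_le (z : ℂ) : ‖Complex.cos z‖ ≤ Real.exp ‖z‖ := by
  have h1 : ∀ w : ℂ, ‖cexp w‖ ≤ Real.exp ‖w‖ := fun w => by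
    rw [Complex.norm_exp]; exact Real.exp_le_exp.2 (re_le_norm w)
  rw [Complex.cos, norm_div]
  have a := h1 (z * I)
  have b := h1 (-z * I)
  simp only [norm_mul, norm_neg, norm_I, mul_one] at a b
  have := norm_add_le (cexp (z * I)) (cexp (-z * I))
  rw [Complex.norm_ofNat, div_le_iff₀ two_pos]
  linarith

theorem riemannZeta₁_eq_mul {s : ℂ} (hs : s ≠ 1) : riemannZeta₁ s = (s - 1) * riemannZeta s := by
  rw [riemannZeta_eq_inv_sub_mul hs, mul_inv_cancel_left₀ (sub_ne_zero.2 hs)]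

theorem ne_neg_nat_of_re_pos {s : ℂ} (hs : 0 < s.re) (n : ℕ) : s ≠ -n := fun h => by
  rw [h] at hs
  simp at hs
  linarith [(Nat.cast_nonneg n : (0 : ℝ) ≤ n)]

/-- To the right of `1/2` the growth is polynomial; to the left the functional equation reduces to
that case, at the cost of a Gamma factor and a cosine. -/
theorem quadGrowth_riemannZeta₁ : QuadGrowth riemannZeta₁ := by
  refine .of_large differentiable_riemannZeta₁ (C := 20) (R := 3) fun s hs3 => ?_
  set r := 1 + ‖s‖ with hr
  have hr1 : 1 ≤ r := by linarith [norm_nonneg s]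
  have hrr : r ≤ r ^ 2 := by nlinarith
  have e1 : ∀ x : ℝ, x ≤ Real.exp x := fun x => by linarith [Real.add_one_le_exp x]
  rcases le_total (1 / 2) s.re with h | h
  · refine (norm_riemannZeta₁_le h).trans ((e1 _).trans (Real.exp_le_exp.2 ?_))
    nlinarith
  · set w := 1 - s with hw
    have hsw : s = 1 - w := by rw [hw]; ring
    have hwre : 1 / 2 ≤ w.re := by rw [hw]; simp; linarith
    have hw1 : ‖w - 1‖ = ‖s‖ := by rw [hw, ← norm_neg s]; congr 1; ring
    have hw1' : w ≠ 1 := fun h0 => by rw [h0] at hw1; simp at hw1; rw [← hw1] at hs3; norm_num at hs3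
    have hs1 : s ≠ 1 := fun h0 => by rw [h0] at h; norm_num at h
    have hwr : ‖w‖ ≤ r := by rw [hw]; exact (norm_sub_le _ _).trans (by simp [hr])
    -- Here `‖w - 1‖ = ‖s‖ ≥ 3`, so dividing by `w - 1` to return from `riemannZeta₁` to zeta loses
    -- nothing.
    have hz : ‖riemannZeta w‖ ≤ 4 * (1 + ‖w‖) ^ 2 := by
      have h1 := norm_riemannZeta₁_le hwre
      rw [riemannZeta₁_eq_mul hw1', norm_mul, hw1] at h1
      nlinarith [norm_nonneg (riemannZeta w)]
    have hpi : ‖(2 * (Real.pi : ℂ)) ^ (-w)‖ ≤ 1 := by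
      have : (2 * (Real.pi : ℂ)) = ((2 * Real.pi : ℝ) : ℂ) := by push_cast; ring
      rw [this, norm_cpow_eq_rpow_re_of_pos (by positivity)]
      refine Real.rpow_le_one_of_one_le_of_nonpos ?_ ?_
      · linarith [Real.pi_gt_three]
      · simp; linarith
    have hcos : ‖Complex.cos (Real.pi * w / 2)‖ ≤ Real.exp (2 * r ^ 2) := by
      refine (norm_cos_le _).trans (Real.exp_le_exp.2 ?_)
      rw [norm_div, norm_mul, norm_real, Real.norm_of_nonneg Real.pi_pos.le, Complex.norm_ofNat]
      nlinarith [Real.pi_lt_four, norm_nonneg w, Real.pi_pos]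
    have hG : ‖Complex.Gamma w‖ ≤ 2 * Real.exp (9 * r ^ 2) := by
      refine (norm_Gamma_le_exp hwre).trans ?_
      gcongr
      nlinarith [norm_nonneg w]
    have h16 : 4 * (1 + ‖w‖) ^ 2 ≤ Real.exp (4 * r ^ 2) := by
      have e4 : Real.exp 1 ^ 3 * Real.exp (r ^ 2) ≤ Real.exp (4 * r ^ 2) := by
        rw [← Real.exp_nat_mul, ← Real.exp_add]
        refine Real.exp_le_exp.2 ?_
        push_cast
        nlinarith
      have e5 : 16 ≤ Real.exp 1 ^ 3 :=
        calc (16 : ℝ) ≤ 2.7 ^ 3 := by norm_num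
          _ ≤ Real.exp 1 ^ 3 := by gcongr; linarith [Real.exp_one_gt_d9]
      have e6 := e1 (r ^ 2)
      calc 4 * (1 + ‖w‖) ^ 2 ≤ 16 * r ^ 2 := by nlinarith [norm_nonneg w]
        _ ≤ Real.exp 1 ^ 3 * Real.exp (r ^ 2) := by gcongr
        _ ≤ _ := e4
    have h4 : (4 : ℝ) ≤ Real.exp (2 * r ^ 2) := by
      have : Real.exp 1 ^ 2 ≤ Real.exp (2 * r ^ 2) := by
        rw [← Real.exp_nat_mul]
        refine Real.exp_le_exp.2 ?_
        push_cast
        nlinarith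
      nlinarith [Real.exp_one_gt_d9]
    have hwe : ‖w‖ ≤ Real.exp (r ^ 2) := hwr.trans (hrr.trans (e1 _))
    rw [riemannZeta₁_eq_mul hs1, hsw,
      riemannZeta_one_sub (ne_neg_nat_of_re_pos (by linarith)) hw1']
    rw [show 1 - w - 1 = -w by ring]
    simp only [norm_mul, norm_neg, Complex.norm_ofNat]
    have hprod : Real.exp (20 * r ^ 2) = Real.exp (2 * r ^ 2) * Real.exp (2 * r ^ 2) *
        (Real.exp (r ^ 2) * Real.exp (9 * r ^ 2) * Real.exp (2 * r ^ 2) * Real.exp (4 * r ^ 2)) := by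
      simp only [← Real.exp_add]
      congr 1
      ring
    rw [hprod]
    set G := ‖Complex.Gamma w‖
    calc ‖w‖ * (2 * ‖(2 * (Real.pi : ℂ)) ^ (-w)‖ * G * ‖Complex.cos (Real.pi * w / 2)‖ *
          ‖riemannZeta w‖)
        ≤ Real.exp (r ^ 2) * (2 * 1 * (2 * Real.exp (9 * r ^ 2)) * Real.exp (2 * r ^ 2) *
          Real.exp (4 * r ^ 2)) := by
          gcongr
          exact hz.trans h16
      _ = 4 * 1 * (Real.exp (r ^ 2) * Real.exp (9 * r ^ 2) * Real.exp (2 * r ^ 2) *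
          Real.exp (4 * r ^ 2)) := by ring
      _ ≤ _ := by
          gcongr
          exact Real.one_le_exp (by positivity)

/-! ### Zeros of the zeta function -/

theorem riemannZeta₁_ne_zero_of_one_le_re {s : ℂ} (hs : 1 ≤ s.re) : riemannZeta₁ s ≠ 0 := by
  by_cases h : s = 1
  · simp [h]
  · rw [riemannZeta₁_eq_mul h]
    exact mul_ne_zero (sub_ne_zero.2 h) (riemannZeta_ne_zero_of_one_le_re hs)

theorem riemannZeta_trivialZero (q : ℕ+) : riemannZeta (trivialZero q) = 0 := by
  obtain ⟨n, hn⟩ := Nat.exists_eq_succ_of_ne_zero q.ne_zero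
  have := riemannZeta_neg_two_mul_nat_add_one n
  rw [trivialZero, hn]
  push_cast
  exact this

theorem trivialZero_re (q : ℕ+) : (trivialZero q).re = -2 * (q : ℕ) := by
  simp [trivialZero]

theorem trivialZero_re_neg (q : ℕ+) : (trivialZero q).re < 0 := by
  have : (0 : ℝ) < (q : ℕ) := by exact_mod_cast q.pos
  rw [trivialZero_re]
  linarith

/-- With `s = 1 - w` and `Re w ≥ 1`, only the cosine in the functional equation can vanish. This
makes `w` an odd integer `2k + 1`, and `w ≠ 1` forces `k > 0`. -/
theorem exists_trivialZero {s : ℂ} (h : riemannZeta s = 0) (hs : s.re ≤ 0) :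
    ∃ q : ℕ+, s = trivialZero q := by
  have hs0 : s ≠ 0 := fun h0 => by rw [h0, riemannZeta_zero] at h; norm_num at h
  set w := 1 - s with hw
  have hsw : s = 1 - w := by rw [hw]; ring
  have hwre : 1 ≤ w.re := by rw [hw]; simpa using hs
  have hw1 : w ≠ 1 := fun h0 => hs0 (by rw [hsw, h0, sub_self])
  rw [hsw, riemannZeta_one_sub (ne_neg_nat_of_re_pos (by linarith)) hw1] at h
  have h2 : (2 : ℂ) * (2 * Real.pi) ^ (-w) * Complex.Gamma w ≠ 0 := by
    refine mul_ne_zero (mul_ne_zero two_ne_zero ?_) (Complex.Gamma_ne_zero_of_re_pos (by linarith))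
    simp [cpow_eq_zero_iff, Real.pi_ne_zero]
  have hcos : Complex.cos (Real.pi * w / 2) = 0 := by
    rcases mul_eq_zero.1 h with h3 | h3
    · exact (mul_eq_zero.1 h3).resolve_left h2
    · exact absurd h3 (riemannZeta_ne_zero_of_one_le_re hwre)
  obtain ⟨k, hk⟩ := Complex.cos_eq_zero_iff.1 hcos
  have hpi : (Real.pi : ℂ) ≠ 0 := by exact_mod_cast Real.pi_ne_zero
  have hwk : w = 2 * k + 1 := by
    field_simp at hk
    linear_combination hk
  have hk0 : 0 < k := by
    have h3 : w.re = 2 * k + 1 := by rw [hwk]; simp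
    have h4 : (0 : ℝ) ≤ k := by linarith
    have h5 : 0 ≤ k := by exact_mod_cast h4
    refine lt_of_le_of_ne h5 fun h6 => hw1 ?_
    rw [hwk, ← h6]; simp
  refine ⟨⟨k.toNat, by omega⟩, ?_⟩
  have h7 : ((k.toNat : ℕ) : ℂ) = (k : ℂ) := by
    have : ((k.toNat : ℤ) : ℂ) = (k : ℂ) := by rw [Int.toNat_of_nonneg hk0.le]
    exact_mod_cast this
  rw [hsw, hwk]
  simp only [trivialZero, PNat.mk_coe, h7]
  ring

/-- Near `-2q` the functional equation writes `riemannZeta₁` as a nonvanishing factor times a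
cosine, whose zeros are simple because sine and cosine have no common zero. -/
theorem analyticOrderNatAt_trivialZero (q : ℕ+) :
    analyticOrderNatAt riemannZeta₁ (trivialZero q) = 1 := by
  set u := trivialZero q with hu
  have hure : u.re < 0 := trivialZero_re_neg q
  have hζ : riemannZeta u = 0 := riemannZeta_trivialZero q
  have hne1 : ∀ t : ℂ, t.re < 0 → t ≠ 1 := fun t ht h => by rw [h] at ht; norm_num at ht
  set G : ℂ → ℂ := fun t => (t - 1) * (2 * (2 * Real.pi) ^ (-(1 - t)) * Complex.Gamma (1 - t) *
    riemannZeta (1 - t)) with hG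
  have hev : riemannZeta₁ =ᶠ[𝓝 u] fun t => G t * Complex.cos (Real.pi * (1 - t) / 2) := by
    filter_upwards [(isOpen_lt continuous_re continuous_const).mem_nhds hure] with t ht
    have ht : t.re < 0 := ht
    have h1 : 0 < (1 - t).re := by simp; linarith
    have h2 : (1 - t) ≠ 1 := fun h => by
      have := congrArg re h
      simp at this
      linarith
    have := riemannZeta_one_sub (ne_neg_nat_of_re_pos h1) h2
    rw [sub_sub_cancel] at this
    rw [riemannZeta₁_eq_mul (hne1 t ht), this, hG]
    ring
  have hu1 : 0 < (1 - u).re := by simp; linarith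
  have hu2 : 1 - u ≠ 1 := fun h => by
    have := congrArg re h
    simp at this
    linarith
  have hpi : (2 * (Real.pi : ℂ)) ≠ 0 := by
    have := Real.pi_ne_zero
    simp [this]
  have hGu : G u ≠ 0 := by
    refine mul_ne_zero (sub_ne_zero.2 (hne1 u hure)) (mul_ne_zero (mul_ne_zero (mul_ne_zero
      two_ne_zero ?_) (Complex.Gamma_ne_zero_of_re_pos hu1)) ?_)
    · simp [cpow_eq_zero_iff, Real.pi_ne_zero]
    · exact riemannZeta_ne_zero_of_one_le_re (by simp; linarith)
  have hGd : DifferentiableAt ℂ G u := by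
    have d1 : DifferentiableAt ℂ (fun t : ℂ => (2 * (Real.pi : ℂ)) ^ (-(1 - t))) u :=
      DifferentiableAt.const_cpow (by fun_prop) (Or.inl hpi)
    have d2 : DifferentiableAt ℂ (fun t : ℂ => Complex.Gamma (1 - t)) u :=
      (Complex.differentiableAt_Gamma _ (ne_neg_nat_of_re_pos hu1)).comp u (by fun_prop)
    have d3 : DifferentiableAt ℂ (fun t : ℂ => riemannZeta (1 - t)) u :=
      (differentiableAt_riemannZeta hu2).comp u (by fun_prop)
    exact (by fun_prop : DifferentiableAt ℂ (fun t : ℂ => t - 1) u).mul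
      ((((d1.const_mul 2).mul d2)).mul d3)
  have hcos : Complex.cos (Real.pi * (1 - u) / 2) = 0 := by
    rw [Complex.cos_eq_zero_iff]
    refine ⟨(q : ℕ), ?_⟩
    have hu' : u = -2 * ((q : ℕ) : ℂ) := rfl
    rw [hu']
    push_cast
    ring
  have hsin : Complex.sin (Real.pi * (1 - u) / 2) ≠ 0 := by
    intro h
    have := Complex.sin_sq_add_cos_sq (Real.pi * (1 - u) / 2)
    rw [h, hcos] at this
    norm_num at this
  have hd : HasDerivAt (fun t => G t * Complex.cos (Real.pi * (1 - t) / 2))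
      (G u * (Complex.sin (Real.pi * (1 - u) / 2) * (Real.pi / 2))) u := by
    have h1 : HasDerivAt (fun t : ℂ => Real.pi * (1 - t) / 2) (-(Real.pi / 2)) u := by
      have := (((hasDerivAt_id u).const_sub 1).const_mul (Real.pi : ℂ)).div_const 2
      exact this.congr_deriv (by ring)
    refine (hGd.hasDerivAt.mul h1.ccos).congr_deriv ?_
    rw [hcos]
    ring
  have hderiv : deriv riemannZeta₁ u ≠ 0 := by
    rw [hev.deriv_eq, hd.deriv]
    exact mul_ne_zero hGu (mul_ne_zero hsin (by simp [Real.pi_ne_zero]))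
  have h0 : riemannZeta₁ u = 0 := by rw [riemannZeta₁_eq_mul (hne1 u hure), hζ, mul_zero]
  have := (differentiable_riemannZeta₁.analyticAt u).analyticOrderAt_eq_one_of_zero_deriv_ne_zero
    h0 hderiv
  simp [analyticOrderNatAt, this]

theorem zeroMult_riemannZeta {ρ : ℂ} (hρ : ρ ≠ 1) :
    zeroMult riemannZeta ρ = analyticOrderNatAt riemannZeta₁ ρ := by
  have h1 : AnalyticAt ℂ riemannZeta₁ ρ := differentiable_riemannZeta₁.analyticAt ρ
  have h2 : AnalyticAt ℂ (fun s : ℂ => (s - 1)⁻¹) ρ :=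
    AnalyticAt.inv (by fun_prop) (sub_ne_zero.2 hρ)
  have hev : riemannZeta =ᶠ[𝓝[≠] ρ] (fun s : ℂ => (s - 1)⁻¹) * riemannZeta₁ := by
    filter_upwards [mem_nhdsWithin_of_mem_nhds (isOpen_ne.mem_nhds hρ)] with s hs
    exact riemannZeta_eq_inv_sub_mul hs
  have h0 : (fun s : ℂ => (s - 1)⁻¹) ρ ≠ 0 := inv_ne_zero (sub_ne_zero.2 hρ)
  rw [zeroMult, meromorphicOrderAt_congr hev, meromorphicOrderAt_mul_of_ne_zero h2 h0,
    h1.meromorphicOrderAt_eq]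
  have ht := analyticOrderAt_ne_top_of_entire differentiable_riemannZeta₁ (z := 1) (by simp) ρ
  rw [← Nat.cast_analyticOrderNatAt ht]
  simp

end Motohashi

namespace Motohashi

open LSeries LSeries.notation

/-! ### Functions represented by Dirichlet series far to the right -/

/-- `F` is represented, for all `s` of sufficiently large real part, by an absolutely convergent
Dirichlet series whose first coefficient is `v`. -/
def HasDirichlet (F : ℂ → ℂ) (v : ℂ) : Prop :=
  ∃ a : ℕ → ℂ, a 1 = v ∧ ∃ σ : ℝ, ∀ s : ℂ, σ < s.re → LSeriesHasSum a s (F s)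

namespace HasDirichlet

variable {F G : ℂ → ℂ} {v w : ℂ}

theorem congr (hF : HasDirichlet F v) (σ : ℝ) (h : ∀ s : ℂ, σ < s.re → G s = F s) :
    HasDirichlet G v := by
  obtain ⟨a, ha, τ, hτ⟩ := hF
  refine ⟨a, ha, max σ τ, fun s hs => ?_⟩
  rw [h s (lt_of_le_of_lt (le_max_left _ _) hs)]
  exact hτ s (lt_of_le_of_lt (le_max_right _ _) hs)

theorem value (hF : HasDirichlet F v) (h : v = w) : HasDirichlet F w := h ▸ hF

theorem add (hF : HasDirichlet F v) (hG : HasDirichlet G w) :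
    HasDirichlet (fun s => F s + G s) (v + w) := by
  obtain ⟨a, rfl, σ, hσ⟩ := hF
  obtain ⟨b, rfl, τ, hτ⟩ := hG
  exact ⟨a + b, rfl, max σ τ, fun s hs =>
    (hσ s (lt_of_le_of_lt (le_max_left _ _) hs)).add (hτ s (lt_of_le_of_lt (le_max_right _ _) hs))⟩

theorem const_mul (c : ℂ) (hF : HasDirichlet F v) : HasDirichlet (fun s => c * F s) (c * v) := by
  obtain ⟨a, rfl, σ, hσ⟩ := hF
  exact ⟨c • a, rfl, σ, fun s hs => (hσ s hs).smul c⟩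

theorem sub (hF : HasDirichlet F v) (hG : HasDirichlet G w) :
    HasDirichlet (fun s => F s - G s) (v - w) := by
  have := hF.add (hG.const_mul (-1))
  simpa [sub_eq_add_neg] using this

theorem mul (hF : HasDirichlet F v) (hG : HasDirichlet G w) :
    HasDirichlet (fun s => F s * G s) (v * w) := by
  obtain ⟨a, rfl, σ, hσ⟩ := hF
  obtain ⟨b, rfl, τ, hτ⟩ := hG
  refine ⟨a ⍟ b, by simp [convolution_def], max σ τ, fun s hs => ?_⟩
  exact (hσ s (lt_of_le_of_lt (le_max_left _ _) hs)).convolution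
    (hτ s (lt_of_le_of_lt (le_max_right _ _) hs))

theorem one : HasDirichlet (fun _ => 1) 1 := by
  refine ⟨δ, by simp [delta], 1, fun s hs => ?_⟩
  have h : LSeriesSummable δ s := by
    refine summable_of_ne_finset_zero (s := {1}) fun n hn => ?_
    rw [term_delta]
    simp only [Finset.mem_singleton] at hn
    simp [hn]
  have h2 : LSeries δ s = 1 := by rw [LSeries_delta]; rfl
  exact h2 ▸ h.LSeriesHasSum

theorem const (c : ℂ) : HasDirichlet (fun _ => c) c := by
  simpa using one.const_mul c

theorem sum {ι : Type*} (S : Finset ι) {F : ι → ℂ → ℂ} {v : ι → ℂ}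
    (h : ∀ i ∈ S, HasDirichlet (F i) (v i)) :
    HasDirichlet (fun s => ∑ i ∈ S, F i s) (∑ i ∈ S, v i) := by
  classical
  induction S using Finset.induction_on with
  | empty => simpa using const 0
  | insert i S hi ih =>
    simp only [Finset.sum_insert hi]
    exact (h i (Finset.mem_insert_self _ _)).add
      (ih fun j hj => h j (Finset.mem_insert_of_mem hj))

theorem prod {ι : Type*} (S : Finset ι) {F : ι → ℂ → ℂ} {v : ι → ℂ}
    (h : ∀ i ∈ S, HasDirichlet (F i) (v i)) :
    HasDirichlet (fun s => ∏ i ∈ S, F i s) (∏ i ∈ S, v i) := by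
  classical
  induction S using Finset.induction_on with
  | empty => simpa using one
  | insert i S hi ih =>
    simp only [Finset.prod_insert hi]
    exact (h i (Finset.mem_insert_self _ _)).mul
      (ih fun j hj => h j (Finset.mem_insert_of_mem hj))

theorem comp_add (hF : HasDirichlet F v) (b : ℂ) : HasDirichlet (fun s => F (s + b)) v := by
  obtain ⟨a, rfl, σ, hσ⟩ := hF
  refine ⟨fun n => a n * (n : ℂ) ^ (-b), by simp, σ - b.re, fun s hs => ?_⟩
  have h := hσ (s + b) (by rw [add_re]; linarith)
  refine HasSum.of_eq h (fun n => ?_) rfl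
  rcases eq_or_ne n 0 with rfl | hn
  · simp
  · rw [term_of_ne_zero hn, term_of_ne_zero hn, cpow_add _ _ (by exact_mod_cast hn), cpow_neg]
    field_simp

/-- Since `n^{-2s} = (n²)^{-s}`, the new coefficients live on the squares. -/
theorem comp_two_mul (hF : HasDirichlet F v) : HasDirichlet (fun s => F (2 * s)) v := by
  classical
  obtain ⟨a, rfl, σ, hσ⟩ := hF
  refine ⟨fun n => if IsSquare n then a (Nat.sqrt n) else 0, by simp, σ / 2, fun s hs => ?_⟩
  have h := hσ (2 * s) (by simp; linarith)
  have inj : Function.Injective fun n : ℕ => n * n := fun m n h => Nat.mul_self_inj.1 h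
  refine (inj.hasSum_iff fun n hn => ?_).1 (HasSum.of_eq h (fun n => ?_) rfl)
  · have : ¬ IsSquare n := fun ⟨r, hr⟩ => hn ⟨r, hr.symm⟩
    simp [term_def, this]
  · rcases eq_or_ne n 0 with rfl | hn
    · simp
    · have h1 : IsSquare (n * n) := ⟨n, rfl⟩
      simp only [Function.comp_apply]
      rw [term_of_ne_zero hn, term_of_ne_zero (mul_ne_zero hn hn), if_pos h1, Nat.sqrt_eq,
        two_mul, cpow_add _ _ (by exact_mod_cast hn), Nat.cast_mul, natCast_mul_natCast_cpow]

theorem one_div_natCast_cpow {p : ℕ} (hp : 1 < p) :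
    HasDirichlet (fun s => 1 / (p : ℂ) ^ s) 0 := by
  refine ⟨Pi.single p 1, by rw [Pi.single_eq_of_ne hp.ne], 0, fun s _ => ?_⟩
  refine HasSum.of_eq (hasSum_ite_eq p (1 / (p : ℂ) ^ s)) (fun n => ?_) rfl
  rcases eq_or_ne n p with rfl | hn
  · rw [term_of_ne_zero (by omega)]; simp
  · simp [term_def, hn]

theorem zeta : HasDirichlet riemannZeta 1 :=
  ⟨1, rfl, 1, fun _ hs => LSeriesHasSum_one hs⟩

theorem deriv (hF : HasDirichlet F v) : HasDirichlet (deriv F) 0 := by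
  obtain ⟨a, rfl, σ, hσ⟩ := hF
  have ha : abscissaOfAbsConv a ≤ σ := by
    refine abscissaOfAbsConv_le_of_forall_lt_LSeriesSummable fun y hy => ?_
    exact (hσ y (by simpa using hy)).LSeriesSummable
  refine ⟨-logMul a, by simp [logMul], σ, fun s hs => ?_⟩
  have h1 : abscissaOfAbsConv a < s.re := lt_of_le_of_lt ha (by exact_mod_cast hs)
  have h2 : _root_.deriv F s = _root_.deriv (LSeries a) s := by
    refine EventuallyEq.deriv_eq ?_
    filter_upwards [(isOpen_lt continuous_const continuous_re).mem_nhds hs] with w hw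
    exact (hσ w hw).LSeries_eq.symm
  rw [h2, LSeries_deriv h1, ← LSeries_neg]
  exact (LSeriesSummable_logMul_of_lt_re h1).neg.LSeriesHasSum

end HasDirichlet

/-! ### Inverting a Dirichlet series with first coefficient one -/

theorem sum_divisorsAntidiagonal_le {η β : ℕ → ℝ} (hη : ∀ n, 0 ≤ η n) (hβ : ∀ n, 0 ≤ β n)
    (N : ℕ) :
    ∑ n ∈ Finset.range N, ∑ p ∈ n.divisorsAntidiagonal, η p.1 * β p.2
      ≤ (∑ n ∈ Finset.range N, η n) * ∑ n ∈ Finset.range N, β n := by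
  rw [Finset.sum_mul_sum, ← Finset.sum_product']
  have h0 : ∀ p : ℕ × ℕ, 0 ≤ η p.1 * β p.2 := fun p => mul_nonneg (hη _) (hβ _)
  refine le_trans (Finset.sum_le_sum fun n hn => ?_)
    (Finset.sum_fiberwise_le_sum_of_sum_fiber_nonneg (s := Finset.range N ×ˢ Finset.range N)
      (t := Finset.range N) (g := fun p => p.1 * p.2) (f := fun p => η p.1 * β p.2)
      fun _ _ => Finset.sum_nonneg fun p _ => h0 p)
  refine Finset.sum_le_sum_of_subset_of_nonneg (fun p hp => ?_) fun p _ _ => h0 p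
  have hn' := Finset.mem_range.1 hn
  simp only [Nat.mem_divisorsAntidiagonal] at hp
  simp only [Finset.mem_filter, Finset.mem_product, Finset.mem_range]
  have h1 : p.1 ≠ 0 := fun h => hp.2 (by rw [← hp.1, h, zero_mul])
  have h2 : p.2 ≠ 0 := fun h => hp.2 (by rw [← hp.1, h, mul_zero])
  refine ⟨⟨?_, ?_⟩, hp.1⟩
  · exact lt_of_le_of_lt (Nat.le_mul_of_pos_right _ (Nat.pos_of_ne_zero h2)) (hp.1 ▸ hn')
  · exact lt_of_le_of_lt (Nat.le_mul_of_pos_left _ (Nat.pos_of_ne_zero h1)) (hp.1 ▸ hn')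

/-- Without the term `n = 1`, moving right by `k` gains at least `2^{-k}`; the nonconstant part of a
Dirichlet series can thus be made as small as desired. -/
theorem norm_term_add_nat_le {h : ℕ → ℂ} (h1 : h 1 = 0) (σ : ℝ) (k n : ℕ) :
    ‖term h ((σ + k : ℝ) : ℂ) n‖ ≤ (1 / 2) ^ k * ‖term h (σ : ℂ) n‖ := by
  rw [norm_term_eq, norm_term_eq]
  rcases eq_or_ne n 0 with rfl | hn
  · simp
  rcases eq_or_ne n 1 with rfl | hn1
  · simp [h1]
  rw [if_neg hn, if_neg hn, ofReal_re, ofReal_re]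
  have hn0 : (0 : ℝ) < n := by exact_mod_cast Nat.pos_of_ne_zero hn
  have h2 : (2 : ℝ) ≤ n := by exact_mod_cast (by omega : 2 ≤ n)
  rw [Real.rpow_add hn0, Real.rpow_natCast]
  have h3 : (0 : ℝ) < (n : ℝ) ^ σ := Real.rpow_pos_of_pos hn0 _
  rw [← div_div, div_eq_mul_inv _ ((n : ℝ) ^ k), mul_comm]
  refine mul_le_mul_of_nonneg_right ?_ (by positivity)
  rw [one_div, inv_pow]
  exact inv_anti₀ (by positivity) (pow_le_pow_left₀ (by norm_num) h2 k)

/-- Write `a = δ + h`, so that `b = δ - h ⍟ b`. Far enough right the terms of `h` have total size at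
most `1/2`, so the partial sums `S` of the norms of the terms of `b` satisfy `S ≤ 1 + S / 2`, that
is, `S ≤ 2`. -/
theorem LSeriesSummable_of_convolution_eq_delta {a b : ℕ → ℂ} (h1 : a 1 = 1) {σ : ℝ}
    (ha : LSeriesSummable a σ) (hab : a ⍟ b = δ) : ∃ τ : ℝ, LSeriesSummable b τ := by
  set h : ℕ → ℂ := fun n => if n = 1 then 0 else a n with hh
  have hh1 : h 1 = 0 := by simp [hh]
  have hle : ∀ n, ‖term h (σ : ℂ) n‖ ≤ ‖term a (σ : ℂ) n‖ := by
    intro n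
    refine norm_term_le _ ?_
    rcases eq_or_ne n 1 with rfl | hn
    · simp [hh]
    · simp [hh, hn]
  have hs : Summable fun n => ‖term h (σ : ℂ) n‖ :=
    Summable.of_nonneg_of_le (fun _ => norm_nonneg _) hle ha.norm
  set A : ℝ := ∑' n, ‖term h (σ : ℂ) n‖
  obtain ⟨k, hk⟩ : ∃ k : ℕ, (1 / 2 : ℝ) ^ k * A ≤ 1 / 2 := by
    have : Tendsto (fun k : ℕ => (1 / 2 : ℝ) ^ k * A) atTop (𝓝 (0 * A)) :=
      (tendsto_pow_atTop_nhds_zero_of_lt_one (by norm_num) (by norm_num)).mul_const _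
    rw [zero_mul] at this
    exact (this.eventually (Iic_mem_nhds (by norm_num : (0 : ℝ) < 1 / 2))).exists
  set τ : ℝ := σ + k
  refine ⟨τ, ?_⟩
  set η : ℕ → ℝ := fun n => ‖term h (τ : ℂ) n‖
  set β : ℕ → ℝ := fun n => ‖term b (τ : ℂ) n‖
  have hη : ∀ N, ∑ n ∈ Finset.range N, η n ≤ 1 / 2 := by
    intro N
    refine le_trans (Finset.sum_le_sum fun n _ => norm_term_add_nat_le hh1 σ k n) ?_
    rw [← Finset.mul_sum]
    refine le_trans (mul_le_mul_of_nonneg_left ?_ (by positivity)) hk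
    exact hs.sum_le_tsum _ fun _ _ => norm_nonneg _
  have hrec : ∀ n, β n ≤ (if n = 1 then 1 else 0)
      + ∑ p ∈ n.divisorsAntidiagonal, η p.1 * β p.2 := by
    intro n
    rcases eq_or_ne n 0 with rfl | hn
    · simp [β]
    have e1 : ∀ m, term a (τ : ℂ) m = (if m = 1 then 1 else 0) + term h (τ : ℂ) m := by
      intro m
      rcases eq_or_ne m 1 with rfl | hm1
      · simp [hh, h1]
      · simp [hh, hm1, term_def]
    have e2 : (if n = 1 then (1 : ℂ) else 0) = term b (τ : ℂ) n
        + ∑ p ∈ n.divisorsAntidiagonal, term h (τ : ℂ) p.1 * term b (τ : ℂ) p.2 := by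
      rw [← term_delta (τ : ℂ), ← hab, term_convolution]
      simp only [e1, add_mul, Finset.sum_add_distrib]
      congr 1
      rw [Finset.sum_eq_single (1, n)]
      · simp
      · rintro ⟨x, y⟩ hxy hne
        have hx : x ≠ 1 := by
          rintro rfl
          exact hne (by simpa using (Nat.mem_divisorsAntidiagonal.1 hxy).1)
        simp [hx]
      · simp [hn]
    have e3 : ‖(if n = 1 then (1 : ℂ) else 0)‖ = if n = 1 then 1 else 0 := by
      split_ifs <;> simp
    have e4 : β n = ‖(if n = 1 then (1 : ℂ) else 0)
        - ∑ p ∈ n.divisorsAntidiagonal, term h (τ : ℂ) p.1 * term b (τ : ℂ) p.2‖ := by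
      rw [e2, add_sub_cancel_right]
    rw [e4, ← e3]
    refine (norm_sub_le _ _).trans (add_le_add le_rfl ((norm_sum_le _ _).trans ?_))
    exact Finset.sum_le_sum fun p _ => (norm_mul _ _).le
  have hbound : ∀ N, ∑ n ∈ Finset.range N, β n ≤ 2 := by
    intro N
    have e1 := Finset.sum_le_sum fun n (_ : n ∈ Finset.range N) => hrec n
    rw [Finset.sum_add_distrib] at e1
    have e2 := sum_divisorsAntidiagonal_le (η := η) (β := β) (fun _ => norm_nonneg _)
      (fun _ => norm_nonneg _) N
    have e3 : ∑ n ∈ Finset.range N, (if n = 1 then (1 : ℝ) else 0) ≤ 1 := by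
      rw [Finset.sum_ite_eq' ]; split_ifs <;> norm_num
    have e4 : 0 ≤ ∑ n ∈ Finset.range N, β n := Finset.sum_nonneg fun _ _ => norm_nonneg _
    nlinarith [hη N]
  exact (summable_of_sum_range_le (fun _ => norm_nonneg _) hbound).of_norm

/-- The inverse exists formally among arithmetic functions because the first coefficient is a unit;
the previous bound makes it converge. Nonvanishing far to the right comes along with it. -/
theorem HasDirichlet.inv {F : ℂ → ℂ} (hF : HasDirichlet F 1) :
    HasDirichlet (fun s => (F s)⁻¹) 1 ∧ ∃ σ : ℝ, ∀ s : ℂ, σ < s.re → F s ≠ 0 := by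
  obtain ⟨a, ha1, σ, hσ⟩ := hF
  obtain ⟨u, hu⟩ := ArithmeticFunction.isUnit_iff_isUnit_apply_one.2
    (show IsUnit (toArithmeticFunction a 1) by simp [toArithmeticFunction, ha1])
  set b : ℕ → ℂ := ⇑(↑u⁻¹ : ArithmeticFunction ℂ) with hb
  have hab : a ⍟ b = δ := by
    have h1 : a ⍟ b = ⇑(toArithmeticFunction a * toArithmeticFunction b) := rfl
    have h2 : toArithmeticFunction b = (↑u⁻¹ : ArithmeticFunction ℂ) := by
      simp [hb]
    rw [h1, h2, ← hu, Units.mul_inv]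
    funext n
    simp [delta, ArithmeticFunction.one_apply]
  have hb1 : b 1 = 1 := by
    have := congrFun hab 1
    simpa [convolution_def, delta, ha1] using this
  obtain ⟨τ, hτ⟩ := LSeriesSummable_of_convolution_eq_delta ha1
    (hσ (σ + 1 : ℝ) (by simp)).LSeriesSummable hab
  have key : ∀ s : ℂ, max σ τ < s.re → LSeriesHasSum b s (F s)⁻¹ ∧ F s ≠ 0 := by
    intro s hs
    have h1 := hσ s (lt_of_le_of_lt (le_max_left _ _) hs)
    have h2 : LSeriesSummable b s :=
      hτ.of_re_le_re (by simpa using (lt_of_le_of_lt (le_max_right _ _) hs).le)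
    have h3 := h1.convolution h2.LSeriesHasSum
    have h4 : F s * LSeries b s = 1 := by
      rw [← h3.LSeries_eq, hab, LSeries_delta]; rfl
    rw [← eq_inv_of_mul_eq_one_right h4]
    exact ⟨h2.LSeriesHasSum, left_ne_zero_of_mul_eq_one h4⟩
  exact ⟨⟨b, hb1, _, fun s hs => (key s hs).1⟩, _, fun s hs => (key s hs).2⟩

theorem HasDirichlet.logDeriv {F : ℂ → ℂ} (hF : HasDirichlet F 1) :
    HasDirichlet (logDeriv F) 0 :=
  ((hF.deriv.mul hF.inv.1).value (zero_mul _)).congr 0 fun s _ => by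
    rw [logDeriv_apply, div_eq_mul_inv]

end Motohashi

namespace Motohashi

/-! ### The finite sum `K` as a quotient of entire functions -/

theorem HasDirichlet.one_sub_one_div_cpow {p : ℕ} (hp : 1 < p) (b : ℂ) :
    HasDirichlet (fun s => 1 - 1 / (p : ℂ) ^ (s + b)) 1 :=
  (HasDirichlet.one.sub ((HasDirichlet.one_div_natCast_cpow hp).comp_add b)).value (sub_zero _)

theorem HasDirichlet.one_sub_one_div_cpow_two_mul {p : ℕ} (hp : 1 < p) (b : ℂ) :
    HasDirichlet (fun s => 1 - 1 / (p : ℂ) ^ (2 * s + b)) 1 :=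
  (HasDirichlet.one_sub_one_div_cpow hp b).comp_two_mul

theorem quadGrowth_one_sub_one_div_cpow {p : ℕ} (hp : p ≠ 0) (a b : ℂ) :
    QuadGrowth fun s => 1 - 1 / (p : ℂ) ^ (a * s + b) := by
  have h : ∀ s : ℂ, 1 / (p : ℂ) ^ (a * s + b)
      = exp (-(log p * a) * s + -(log p * b)) := by
    intro s
    rw [cpow_def_of_ne_zero (by exact_mod_cast hp), one_div, ← exp_neg]
    congr 1
    ring
  simp only [h]
  exact (QuadGrowth.const 1).sub (QuadGrowth.exp_affine _ _)

/-- The product of the four Euler factors at `p` in the numerator of `J`. -/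
noncomputable def eulerNum (T₁ T₂ : ℝ) (p : ℕ) (s : ℂ) : ℂ :=
  (1 - 1 / (p : ℂ) ^ s) * (1 - 1 / (p : ℂ) ^ (s - I * T₁))
    * (1 - 1 / (p : ℂ) ^ (s + I * T₂)) * (1 - 1 / (p : ℂ) ^ (s - I * (T₁ - T₂)))

/-- The Euler factor at `p` in the denominator of `J`. -/
noncomputable def eulerDen (T₁ T₂ : ℝ) (p : ℕ) (s : ℂ) : ℂ :=
  1 - 1 / (p : ℂ) ^ (2 * s - I * (T₁ - T₂))

theorem P_eq (T₁ T₂ : ℝ) (d : ℕ) (s : ℂ) :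
    P T₁ T₂ d s = ∏ p ∈ d.primeFactors, (1 - eulerNum T₁ T₂ p s * (eulerDen T₁ T₂ p s)⁻¹) := rfl

theorem quadGrowth_eulerDen (T₁ T₂ : ℝ) {p : ℕ} (hp : p ≠ 0) : QuadGrowth (eulerDen T₁ T₂ p) :=
  quadGrowth_one_sub_one_div_cpow hp 2 (-(I * (T₁ - T₂)))

theorem quadGrowth_eulerNum (T₁ T₂ : ℝ) {p : ℕ} (hp : p ≠ 0) : QuadGrowth (eulerNum T₁ T₂ p) := by
  have h (b : ℂ) := quadGrowth_one_sub_one_div_cpow hp 1 b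
  simp only [one_mul] at h
  have h0 := h 0
  simp only [add_zero] at h0
  exact ((h0.mul (h (-(I * T₁)))).mul (h (I * T₂))).mul (h (-(I * (T₁ - T₂))))

theorem hasDirichlet_eulerDen (T₁ T₂ : ℝ) {p : ℕ} (hp : 1 < p) :
    HasDirichlet (eulerDen T₁ T₂ p) 1 :=
  HasDirichlet.one_sub_one_div_cpow_two_mul hp (-(I * (T₁ - T₂)))

theorem hasDirichlet_eulerNum (T₁ T₂ : ℝ) {p : ℕ} (hp : 1 < p) :
    HasDirichlet (eulerNum T₁ T₂ p) 1 := by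
  have h (b : ℂ) := HasDirichlet.one_sub_one_div_cpow hp b
  have h0 := h 0
  simp only [add_zero] at h0
  exact (((h0.mul (h (-(I * T₁)))).mul (h (I * T₂))).mul (h (-(I * (T₁ - T₂))))).value (by simp)

/-- Every Euler factor starts with `1`, so each factor of `P` starts with `1 - 1 = 0`. The product
is `1` when `d` has no prime factor and `0` otherwise, so only `d = 1` contributes to the first
coefficient of `K`. -/
theorem hasDirichlet_P (T₁ T₂ : ℝ) (d : ℕ) :
    HasDirichlet (P T₁ T₂ d) (∏ _p ∈ d.primeFactors, 0) := by
  refine HasDirichlet.prod _ fun p hp => ?_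
  have h1 : 1 < p := (Nat.prime_of_mem_primeFactors hp).one_lt
  exact (HasDirichlet.one.sub ((hasDirichlet_eulerNum T₁ T₂ h1).mul
    (hasDirichlet_eulerDen T₁ T₂ h1).inv.1)).value (by simp)

theorem hasDirichlet_K (T₁ T₂ : ℝ) {z : ℝ} (hz : 1 < z) : HasDirichlet (K T₁ T₂ z) 1 := by
  refine (HasDirichlet.sum (Finset.Icc 1 ⌊z ^ 2⌋₊) fun d _ =>
    (hasDirichlet_P T₁ T₂ d).const_mul (lam z d)).value ?_
  have h1 : 1 ≤ ⌊z ^ 2⌋₊ := Nat.le_floor (by push_cast; nlinarith)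
  rw [Finset.sum_eq_single 1]
  · simp [lam, hz]
  · intro d hd hd1
    have h2 : d.primeFactors.Nonempty := Nat.nonempty_primeFactors.2 (by
      have := (Finset.mem_Icc.1 hd).1; omega)
    rw [Finset.prod_const, zero_pow (Finset.card_pos.2 h2).ne', mul_zero]
  · simp [h1]

/-- A common denominator of the terms of `K`. -/
noncomputable def denK (T₁ T₂ z : ℝ) (s : ℂ) : ℂ :=
  ∏ p ∈ (Finset.Icc 1 ⌊z ^ 2⌋₊).filter Nat.Prime, eulerDen T₁ T₂ p s

/-- The numerator of `K` over the denominator `denK`. -/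
noncomputable def numK (T₁ T₂ z : ℝ) (s : ℂ) : ℂ :=
  ∑ d ∈ Finset.Icc 1 ⌊z ^ 2⌋₊, (lam z d : ℂ)
    * ((∏ p ∈ d.primeFactors, (eulerDen T₁ T₂ p s - eulerNum T₁ T₂ p s))
      * ∏ p ∈ (Finset.Icc 1 ⌊z ^ 2⌋₊).filter Nat.Prime \ d.primeFactors, eulerDen T₁ T₂ p s)

theorem quadGrowth_denK (T₁ T₂ z : ℝ) : QuadGrowth (denK T₁ T₂ z) :=
  QuadGrowth.prod _ fun _ hp => quadGrowth_eulerDen T₁ T₂ (Finset.mem_filter.1 hp).2.ne_zero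

theorem quadGrowth_numK (T₁ T₂ z : ℝ) : QuadGrowth (numK T₁ T₂ z) := by
  refine QuadGrowth.sum _ fun d _ => (QuadGrowth.const _).mul
    ((QuadGrowth.prod _ fun p hp => ?_).mul (QuadGrowth.prod _ fun p hp => ?_))
  · have h := (Nat.prime_of_mem_primeFactors hp).ne_zero
    exact (quadGrowth_eulerDen T₁ T₂ h).sub (quadGrowth_eulerNum T₁ T₂ h)
  · exact quadGrowth_eulerDen T₁ T₂
      (Finset.mem_filter.1 (Finset.mem_sdiff.1 hp).1).2.ne_zero

theorem K_eq_div {T₁ T₂ z : ℝ} {s : ℂ} (h : denK T₁ T₂ z s ≠ 0) :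
    K T₁ T₂ z s = numK T₁ T₂ z s / denK T₁ T₂ z s := by
  rw [eq_div_iff h, K, numK, Finset.sum_mul]
  refine Finset.sum_congr rfl fun d hd => ?_
  have hsub : d.primeFactors ⊆ (Finset.Icc 1 ⌊z ^ 2⌋₊).filter Nat.Prime := by
    intro p hp
    have hpp := Nat.prime_of_mem_primeFactors hp
    have hd' := Finset.mem_Icc.1 hd
    refine Finset.mem_filter.2 ⟨Finset.mem_Icc.2 ⟨hpp.one_lt.le, ?_⟩, hpp⟩
    exact (Nat.le_of_dvd (by omega) (Nat.dvd_of_mem_primeFactors hp)).trans hd'.2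
  have hden : denK T₁ T₂ z s =
      (∏ p ∈ (Finset.Icc 1 ⌊z ^ 2⌋₊).filter Nat.Prime \ d.primeFactors, eulerDen T₁ T₂ p s)
        * ∏ p ∈ d.primeFactors, eulerDen T₁ T₂ p s := (Finset.prod_sdiff hsub).symm
  have hne : ∀ p ∈ d.primeFactors, eulerDen T₁ T₂ p s ≠ 0 := fun p hp =>
    Finset.prod_ne_zero_iff.1 h p (hsub hp)
  rw [hden, P_eq, mul_assoc]
  congr 1
  rw [mul_comm (∏ p ∈ _ \ _, _), ← mul_assoc, ← Finset.prod_mul_distrib]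
  congr 1
  refine Finset.prod_congr rfl fun p hp => ?_
  rw [sub_mul, one_mul, mul_assoc, inv_mul_cancel₀ (hne p hp), mul_one]

theorem exists_numK_denK_ne_zero (T₁ T₂ : ℝ) {z : ℝ} (hz : 1 < z) :
    ∃ σ : ℝ, ∀ s : ℂ, σ < s.re → numK T₁ T₂ z s ≠ 0 ∧ denK T₁ T₂ z s ≠ 0 := by
  obtain ⟨σ, hσ⟩ := (hasDirichlet_K T₁ T₂ hz).inv.2
  have hd : HasDirichlet (denK T₁ T₂ z) 1 :=
    (HasDirichlet.prod ((Finset.Icc 1 ⌊z ^ 2⌋₊).filter Nat.Prime) fun p hp =>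
      hasDirichlet_eulerDen T₁ T₂ (Finset.mem_filter.1 hp).2.one_lt).value (by simp)
  obtain ⟨τ, hτ⟩ := hd.inv.2
  refine ⟨max σ τ, fun s hs => ?_⟩
  have h1 := hσ s (lt_of_le_of_lt (le_max_left _ _) hs)
  have h2 := hτ s (lt_of_le_of_lt (le_max_right _ _) hs)
  rw [K_eq_div h2] at h1
  exact ⟨(div_ne_zero_iff.1 h1).1, h2⟩

theorem eventually_ne_zero_of_entire {f : ℂ → ℂ} (hf : Differentiable ℂ f) {a : ℂ} (ha : f a ≠ 0)
    (u : ℂ) : ∀ᶠ w in 𝓝[≠] u, f w ≠ 0 := by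
  rcases (hf.analyticAt u).eventually_eq_zero_or_eventually_ne_zero with h | h
  · exact absurd (analyticOrderAt_eq_top.2 h) (analyticOrderAt_ne_top_of_entire hf ha u)
  · exact h

theorem meromorphicOrderAt_of_entire {f : ℂ → ℂ} (hf : Differentiable ℂ f) {a : ℂ} (ha : f a ≠ 0)
    (u : ℂ) : meromorphicOrderAt f u = ((analyticOrderNatAt f u : ℤ) : WithTop ℤ) := by
  rw [(hf.analyticAt u).meromorphicOrderAt_eq,
    ← Nat.cast_analyticOrderNatAt (analyticOrderAt_ne_top_of_entire hf ha u)]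
  rfl

theorem meromorphicOrderAt_K (T₁ T₂ : ℝ) {z : ℝ} (hz : 1 < z) (u : ℂ) :
    meromorphicOrderAt (K T₁ T₂ z) u =
      (((analyticOrderNatAt (numK T₁ T₂ z) u : ℤ) - analyticOrderNatAt (denK T₁ T₂ z) u : ℤ) :
        WithTop ℤ) := by
  obtain ⟨σ, hσ⟩ := exists_numK_denK_ne_zero T₁ T₂ hz
  obtain ⟨hn, hd⟩ := hσ ((σ + 1 : ℝ) : ℂ) (by simp)
  have dn := (quadGrowth_numK T₁ T₂ z).diff
  have dd := (quadGrowth_denK T₁ T₂ z).diff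
  have h : K T₁ T₂ z =ᶠ[𝓝[≠] u] numK T₁ T₂ z * (denK T₁ T₂ z)⁻¹ := by
    filter_upwards [eventually_ne_zero_of_entire dd hd u] with w hw
    rw [K_eq_div hw]
    rfl
  rw [meromorphicOrderAt_congr h, meromorphicOrderAt_mul (dn.analyticAt u).meromorphicAt
    (dd.analyticAt u).meromorphicAt.inv, meromorphicOrderAt_inv,
    meromorphicOrderAt_of_entire dn hn, meromorphicOrderAt_of_entire dd hd, sub_eq_add_neg]
  rfl

/-- Even if `s` is neither a zero nor a pole of `K`, `numK` and `denK` may both vanish there. Their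
orders then agree, and removing the common power of `w - s` gives a quotient usable for an expansion
centred at `s`. The equality is only punctured because the pointwise `K` is unreliable where an
inverse is taken at zero. -/
theorem exists_K_eq_div (T₁ T₂ : ℝ) {z : ℝ} (hz : 1 < z) {s : ℂ} (hp : s ∉ polesK T₁ T₂ z)
    (h0 : s ∉ zerosK T₁ T₂ z) : ∃ f g : ℂ → ℂ, QuadGrowth f ∧ QuadGrowth g ∧ f s ≠ 0 ∧ g s ≠ 0 ∧
      (∃ σ : ℝ, ∀ w : ℂ, σ < w.re → f w ≠ 0 ∧ g w ≠ 0) ∧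
      (∀ u, ∀ᶠ w in 𝓝[≠] u, K T₁ T₂ z w = f w / g w) ∧
      ∀ u, meromorphicOrderAt (K T₁ T₂ z) u
        = (((analyticOrderNatAt f u : ℤ) - analyticOrderNatAt g u : ℤ) : WithTop ℤ) := by
  obtain ⟨σ, hσ⟩ := exists_numK_denK_ne_zero T₁ T₂ hz
  obtain ⟨hn, hd⟩ := hσ ((σ + 1 : ℝ) : ℂ) (by simp)
  obtain ⟨f, hf, hfs, hfe, hfo⟩ := (quadGrowth_numK T₁ T₂ z).exists_eq_sub_pow_mul hn s
  obtain ⟨g, hg, hgs, hge, hgo⟩ := (quadGrowth_denK T₁ T₂ z).exists_eq_sub_pow_mul hd s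
  have hk : analyticOrderNatAt (numK T₁ T₂ z) s = analyticOrderNatAt (denK T₁ T₂ z) s := by
    have e := meromorphicOrderAt_K T₁ T₂ hz s
    simp only [polesK, zerosK, Set.mem_ofPred_eq, e] at hp h0
    rw [← WithTop.coe_zero, WithTop.coe_lt_coe] at hp h0
    omega
  refine ⟨f, g, hf, hg, hfs, hgs, ⟨σ, fun w hw => ?_⟩, fun u => ?_, fun u => ?_⟩
  · obtain ⟨h1, h2⟩ := hσ w hw
    rw [hfe] at h1
    rw [hge] at h2
    exact ⟨right_ne_zero_of_mul h1, right_ne_zero_of_mul h2⟩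
  · filter_upwards [eventually_ne_zero_of_entire (quadGrowth_denK T₁ T₂ z).diff hd u] with w hw
    have hw' := hw
    rw [hge] at hw'
    rw [K_eq_div hw, hfe, hge, hk, mul_div_mul_left _ _ (left_ne_zero_of_mul hw')]
  · rw [meromorphicOrderAt_K T₁ T₂ hz]
    rcases eq_or_ne u s with rfl | hu
    · rw [hk, analyticOrderNatAt_eq_zero_of_ne hfs, analyticOrderNatAt_eq_zero_of_ne hgs,
        sub_self]
      simp
    · rw [hfo u hu, hgo u hu]

/-! ### The poles of `K` -/

/-- The endpoint `d = z²` of the summation carries weight `0`; this gives the strict bound `p < z²`.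
-/
theorem analyticAt_K {T₁ T₂ z : ℝ} {u : ℂ}
    (h : ∀ p : ℕ, p.Prime → (p : ℝ) < z ^ 2 → eulerDen T₁ T₂ p u ≠ 0) :
    AnalyticAt ℂ (K T₁ T₂ z) u := by
  have e : K T₁ T₂ z = fun s => ∑ d ∈ Finset.Icc 1 ⌊z ^ 2⌋₊, (lam z d : ℂ) * P T₁ T₂ d s := rfl
  rw [e]
  refine Finset.analyticAt_fun_sum _ fun d hd => ?_
  by_cases hl : lam z d = 0
  · simp only [hl, ofReal_zero, zero_mul]
    exact analyticAt_const
  have hdz : (d : ℝ) < z ^ 2 ∨ (d : ℝ) < z := by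
    by_contra! hc
    exact hl (by simp [lam, not_lt.2 hc.1, not_lt.2 hc.2])
  have hd1 : (1 : ℝ) ≤ d := by exact_mod_cast (Finset.mem_Icc.1 hd).1
  have hdz' : (d : ℝ) < z ^ 2 := hdz.elim id fun h => by nlinarith
  refine analyticAt_const.mul ?_
  have e2 : P T₁ T₂ d = fun s => ∏ p ∈ d.primeFactors,
    (1 - eulerNum T₁ T₂ p s * (eulerDen T₁ T₂ p s)⁻¹) := rfl
  rw [e2]
  refine Finset.analyticAt_fun_prod _ fun p hp => ?_
  have hpp := Nat.prime_of_mem_primeFactors hp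
  have hpd : (p : ℝ) ≤ d := by
    exact_mod_cast Nat.le_of_dvd (Finset.mem_Icc.1 hd).1 (Nat.dvd_of_mem_primeFactors hp)
  exact analyticAt_const.sub
    (((quadGrowth_eulerNum T₁ T₂ hpp.ne_zero).diff.analyticAt u).mul
      (((quadGrowth_eulerDen T₁ T₂ hpp.ne_zero).diff.analyticAt u).inv
        (h p hpp (lt_of_le_of_lt hpd hdz'))))

theorem eq_of_eulerDen_eq_zero {T₁ T₂ : ℝ} {p : ℕ} (hp : p.Prime) {u : ℂ}
    (h : eulerDen T₁ T₂ p u = 0) :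
    ∃ k : ℤ, u = I * (Real.pi * k / Real.log p + 1 / 2 * (T₁ - T₂)) := by
  have hp0 : (p : ℂ) ≠ 0 := by exact_mod_cast hp.ne_zero
  have h1 : (p : ℂ) ^ (2 * u - I * (T₁ - T₂)) = 1 := by
    have := sub_eq_zero.1 h
    rw [one_div] at this
    exact inv_eq_one.1 this.symm
  rw [cpow_def_of_ne_zero hp0, exp_eq_one_iff] at h1
  obtain ⟨k, hk⟩ := h1
  refine ⟨k, ?_⟩
  have hl : (Real.log p : ℂ) ≠ 0 := by
    exact_mod_cast (Real.log_pos (by exact_mod_cast hp.one_lt)).ne'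
  rw [← ofReal_natCast, ← ofReal_log (Nat.cast_nonneg p)] at hk
  field_simp
  linear_combination hk

theorem exists_prime_of_mem_polesK {T₁ T₂ z : ℝ} {ν : ℂ} (hν : ν ∈ polesK T₁ T₂ z) :
    ∃ (p : ℕ) (k : ℤ), p.Prime ∧ (p : ℝ) < z ^ 2 ∧
      ν = I * (Real.pi * k / Real.log p + 1 / 2 * (T₁ - T₂)) := by
  by_contra! hc
  refine absurd (analyticAt_K fun p hp hpz h => ?_ : AnalyticAt ℂ (K T₁ T₂ z) ν).meromorphicOrderAt_nonneg
    (not_le.2 hν)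
  obtain ⟨k, hk⟩ := eq_of_eulerDen_eq_zero hp h
  exact hc p k hp hpz hk

end Motohashi

namespace Motohashi

/-! ### Motohashi's product as a quotient of entire functions -/

theorem J_eq (T₁ T₂ : ℝ) (s : ℂ) :
    J T₁ T₂ s = (∏ j, riemannZeta (s - shift T₁ T₂ j)) / riemannZeta (2 * s - I * (T₁ - T₂)) := by
  simp [J, Fin.prod_univ_four, shift]

theorem hasDirichlet_J (T₁ T₂ : ℝ) : HasDirichlet (J T₁ T₂) 1 := by
  have h1 := HasDirichlet.prod Finset.univ fun j _ =>
    HasDirichlet.zeta.comp_add (-(shift T₁ T₂ j))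
  have h2 := (HasDirichlet.zeta.comp_add (-(I * (T₁ - T₂)))).comp_two_mul
  refine ((h1.mul h2.inv.1).value (by simp)).congr 0 fun s _ => ?_
  simp only [J_eq, sub_eq_add_neg, div_eq_mul_inv]

/-- The quotient of entire functions which represents `Z` when `f / g` represents `K`. -/
noncomputable def quotZ (T₁ T₂ : ℝ) (f g : ℂ → ℂ) (w : ℂ) : ℂ :=
  ((∏ j, riemannZeta₁ (w - shift T₁ T₂ j)) * (w - half T₁ T₂ 1) * f w)
    / ((∏ j, (w - (1 + shift T₁ T₂ j))) * (riemannZeta₁ (2 * w - I * (T₁ - T₂)) / 2) * g w)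

/-- The `2` in `quotZ` comes from `2w - i(T₁ - T₂) - 1 = 2 (w - half T₁ T₂ 1)`. -/
theorem J_mul_eq_quotZ {T₁ T₂ : ℝ} (f g : ℂ → ℂ) {w : ℂ} (h1 : ∀ j, w ≠ 1 + shift T₁ T₂ j)
    (h2 : w ≠ half T₁ T₂ 1) : J T₁ T₂ w * (f w / g w) = quotZ T₁ T₂ f g w := by
  have e1 : ∀ j, riemannZeta (w - shift T₁ T₂ j)
      = riemannZeta₁ (w - shift T₁ T₂ j) / (w - (1 + shift T₁ T₂ j)) := fun j => by
    have : w - shift T₁ T₂ j ≠ 1 := fun h => h1 j (by rw [← h]; ring)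
    rw [riemannZeta₁_eq_mul this, eq_div_iff (sub_ne_zero.2 (h1 j))]
    ring
  have e2 : riemannZeta (2 * w - I * (T₁ - T₂))
      = riemannZeta₁ (2 * w - I * (T₁ - T₂)) / 2 / (w - half T₁ T₂ 1) := by
    have : 2 * w - I * (T₁ - T₂) ≠ 1 := fun h => h2 (by rw [half, ← h]; ring)
    rw [riemannZeta₁_eq_mul this, eq_div_iff (sub_ne_zero.2 h2), half]
    ring
  rw [J_eq, quotZ, e2, Finset.prod_congr rfl fun j _ => e1 j, Finset.prod_div_distrib]
  simp only [div_eq_mul_inv, mul_inv, inv_inv]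
  ring

theorem Z_eventuallyEq {T₁ T₂ z : ℝ} {f g : ℂ → ℂ} (hf : Differentiable ℂ f)
    (hg : Differentiable ℂ g) {w : ℂ} (hK : ∀ᶠ t in 𝓝[≠] w, K T₁ T₂ z t = f t / g t)
    (h1 : ∀ j, w ≠ 1 + shift T₁ T₂ j)
    (h3 : riemannZeta₁ (2 * w - I * (T₁ - T₂)) ≠ 0) (h4 : g w ≠ 0) :
    Z T₁ T₂ z =ᶠ[𝓝 w] quotZ T₁ T₂ f g := by
  have hζ := differentiable_riemannZeta₁
  have hA : AnalyticAt ℂ (quotZ T₁ T₂ f g) w := by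
    refine AnalyticAt.div (Differentiable.analyticAt ?_ w) (Differentiable.analyticAt ?_ w)
      (mul_ne_zero (mul_ne_zero (Finset.prod_ne_zero_iff.2 fun j _ => sub_ne_zero.2 (h1 j))
        (div_ne_zero h3 two_ne_zero)) h4)
    · fun_prop
    · fun_prop
  -- Two functions in normal form that agree near `w` except at `w` agree at `w` as well, so the
  -- removable singularities of the product need no separate treatment.
  refine (MeromorphicNFAt.eventuallyEq_nhdsNE_iff_eventuallyEq_nhds
    (meromorphicNFOn_toMeromorphicNFOn _ _ (Set.mem_univ w)) hA.meromorphicNFAt).1 ?_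
  refine ((meromorphicOn_J_mul_K T₁ T₂ z).toMeromorphicNFOn_eq_self_on_nhdsNE
    (Set.mem_univ w)).trans ?_
  have hne : ∀ a : ℂ, ∀ᶠ t in 𝓝[≠] w, t ≠ a := fun a => by
    rcases eq_or_ne w a with rfl | ha
    · exact self_mem_nhdsWithin
    · exact mem_nhdsWithin_of_mem_nhds (isOpen_ne.mem_nhds ha)
  filter_upwards [hK, eventually_all.2 fun j => hne (1 + shift T₁ T₂ j), hne (half T₁ T₂ 1)]
    with t ht ht1 ht2
  rw [ht, J_mul_eq_quotZ f g ht1 ht2]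

theorem shift_re (T₁ T₂ : ℝ) (j : Fin 4) : (shift T₁ T₂ j).re = 0 := by
  fin_cases j <;> simp [shift]

theorem half_re (T₁ T₂ : ℝ) (w : ℂ) : (half T₁ T₂ w).re = w.re / 2 := by
  have : half T₁ T₂ w = ((1 / 2 : ℝ) : ℂ) * w + ((1 / 2 * (T₁ - T₂) : ℝ) : ℂ) * I := by
    rw [half]; push_cast; ring
  rw [this, add_re, re_ofReal_mul, re_ofReal_mul]
  simp
  ring

theorem ne_one_add_shift {T₁ T₂ : ℝ} {w : ℂ} (hw : 1 < w.re) (j : Fin 4) :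
    w ≠ 1 + shift T₁ T₂ j := fun h => by
  rw [h, add_re, shift_re] at hw
  simp at hw

theorem ne_half_one {T₁ T₂ : ℝ} {w : ℂ} (hw : 1 < w.re) : w ≠ half T₁ T₂ 1 := fun h => by
  rw [h, half_re] at hw
  norm_num at hw

theorem two_mul_sub_re (T₁ T₂ : ℝ) (w : ℂ) : (2 * w - I * (T₁ - T₂)).re = 2 * w.re := by
  simp

theorem hasDirichlet_Z (T₁ T₂ : ℝ) {z : ℝ} (hz : 1 < z) : HasDirichlet (Z T₁ T₂ z) 1 := by
  obtain ⟨σ, hσ⟩ := exists_numK_denK_ne_zero T₁ T₂ hz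
  refine (((hasDirichlet_J T₁ T₂).mul (hasDirichlet_K T₁ T₂ hz)).value (one_mul 1)).congr
    (max σ 1) fun w hw => ?_
  have hw1 : 1 < w.re := lt_of_le_of_lt (le_max_right _ _) hw
  have hwσ := hσ w (lt_of_le_of_lt (le_max_left _ _) hw)
  have dd := (quadGrowth_denK T₁ T₂ z).diff
  have h := Z_eventuallyEq (quadGrowth_numK T₁ T₂ z).diff dd
    ((eventually_ne_zero_of_entire dd hwσ.2 w).mono fun t ht => K_eq_div ht)
    (ne_one_add_shift hw1)
    (riemannZeta₁_ne_zero_of_one_le_re (by rw [two_mul_sub_re]; linarith)) hwσ.2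
  rw [h.eq_of_nhds, ← J_mul_eq_quotZ _ _ (ne_one_add_shift hw1) (ne_half_one hw1),
    K_eq_div hwσ.2]

theorem exists_isLogDerivCoeff (T₁ T₂ : ℝ) {z : ℝ} (hz : 1 < z) :
    ∃ c : ℕ → ℂ, c 1 = 0 ∧ IsLogDerivCoeff T₁ T₂ z c :=
  (hasDirichlet_Z T₁ T₂ hz).logDeriv

theorem logDeriv_Z {T₁ T₂ z : ℝ} {f g : ℂ → ℂ} (hf : Differentiable ℂ f)
    (hg : Differentiable ℂ g) {w : ℂ} (hK : ∀ᶠ t in 𝓝[≠] w, K T₁ T₂ z t = f t / g t)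
    (h1 : ∀ j, w ≠ 1 + shift T₁ T₂ j) (h2 : w ≠ half T₁ T₂ 1)
    (h3 : riemannZeta₁ (2 * w - I * (T₁ - T₂)) ≠ 0)
    (h5 : ∀ j, riemannZeta₁ (w - shift T₁ T₂ j) ≠ 0) (hfw : f w ≠ 0) (hgw : g w ≠ 0) :
    logDeriv (Z T₁ T₂ z) w =
      (∑ j, logDeriv (fun t => riemannZeta₁ (t - shift T₁ T₂ j)) w) + 1 / (w - half T₁ T₂ 1)
        + logDeriv f w
      - ((∑ j, 1 / (w - (1 + shift T₁ T₂ j)))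
        + logDeriv (fun t => riemannZeta₁ (2 * t - I * (T₁ - T₂))) w + logDeriv g w) := by
  have hζ := differentiable_riemannZeta₁
  have hid : ∀ a, logDeriv (fun t : ℂ => t - a) w = 1 / (w - a) := fun a => by
    simp [logDeriv_apply]
  rw [(logDeriv_congr_nhds (Z_eventuallyEq hf hg hK h1 h3 hgw)).eq_of_nhds]
  unfold quotZ
  have n1 : ∏ j, riemannZeta₁ (w - shift T₁ T₂ j) ≠ 0 := Finset.prod_ne_zero_iff.2 fun j _ => h5 j
  have n2 : ∏ j, (w - (1 + shift T₁ T₂ j)) ≠ 0 :=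
    Finset.prod_ne_zero_iff.2 fun j _ => sub_ne_zero.2 (h1 j)
  have n3 := sub_ne_zero.2 h2
  have n4 := div_ne_zero h3 (two_ne_zero (α := ℂ))
  set A : ℂ → ℂ := fun t => ∏ j, riemannZeta₁ (t - shift T₁ T₂ j) with hA
  set B : ℂ → ℂ := fun t => t - half T₁ T₂ 1
  set C : ℂ → ℂ := fun t => ∏ j, (t - (1 + shift T₁ T₂ j)) with hC
  set D : ℂ → ℂ := fun t => riemannZeta₁ (2 * t - I * (T₁ - T₂)) / 2 with hD
  have dA : Differentiable ℂ A := by fun_prop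
  have dB : Differentiable ℂ B := by fun_prop
  have dC : Differentiable ℂ C := by fun_prop
  have dD : Differentiable ℂ D := by fun_prop
  have lA : logDeriv A w = ∑ j, logDeriv (fun t => riemannZeta₁ (t - shift T₁ T₂ j)) w :=
    logDeriv_prod (fun j _ => h5 j) (fun j _ => by fun_prop)
  have lC : logDeriv C w = ∑ j, 1 / (w - (1 + shift T₁ T₂ j)) :=
    (logDeriv_prod (fun j _ => sub_ne_zero.2 (h1 j)) (fun j _ => by fun_prop)).trans
      (Finset.sum_congr rfl fun j _ => hid _)
  have lD : logDeriv D w = logDeriv (fun t => riemannZeta₁ (2 * t - I * (T₁ - T₂))) w := by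
    simp only [hD, div_eq_mul_inv _ (2 : ℂ)]
    exact logDeriv_mul_const w _ (inv_ne_zero two_ne_zero)
  have nAB : A w * B w ≠ 0 := mul_ne_zero n1 n3
  have nCD : C w * D w ≠ 0 := mul_ne_zero n2 n4
  have dAB : DifferentiableAt ℂ (fun t => A t * B t) w := (dA w).mul (dB w)
  have dCD : DifferentiableAt ℂ (fun t => C t * D t) w := (dC w).mul (dD w)
  have e1 := logDeriv_mul (f := A) (g := B) w n1 n3 (dA w) (dB w)
  have e2 := logDeriv_mul (f := C) (g := D) w n2 n4 (dC w) (dD w)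
  have e3 := logDeriv_mul (g := f) w nAB hfw dAB (hf w)
  have e4 := logDeriv_mul (g := g) w nCD hgw dCD (hg w)
  have e5 := logDeriv_div (f := fun t => A t * B t * f t) (g := fun t => C t * D t * g t) w
    (mul_ne_zero nAB hfw) (mul_ne_zero nCD hgw) (dAB.mul (hf w)) (dCD.mul (hg w))
  rw [← lA, ← lC, ← lD, ← hid (half T₁ T₂ 1), ← e1, ← e2, ← e3, ← e4, ← e5]

end Motohashi

namespace Motohashi

/-! ### Sums over the zeros and poles -/

theorem zetaZeros_ne_one {ρ : ℂ} (hρ : ρ ∈ zetaZeros) : ρ ≠ 1 := fun h => by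
  have := hρ.2.2
  rw [h] at this
  simp at this

theorem mem_zetaZeros_or_exists_trivialZero {r : ℂ} (hr : riemannZeta₁ r = 0) :
    r ∈ zetaZeros ∨ ∃ q, r = trivialZero q := by
  have hre : r.re < 1 := by
    by_contra! h
    exact riemannZeta₁_ne_zero_of_one_le_re h hr
  have hr1 : r ≠ 1 := fun h => by rw [h] at hre; simp at hre
  have hζ : riemannZeta r = 0 := by
    rw [riemannZeta₁_eq_mul hr1] at hr
    exact (mul_eq_zero.1 hr).resolve_left (sub_ne_zero.2 hr1)
  rcases le_or_gt r.re 0 with h | h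
  · exact Or.inr (exists_trivialZero hζ h)
  · exact Or.inl ⟨hζ, h, hre⟩

theorem trivialZero_injective : Function.Injective trivialZero := by
  intro p q h
  have h1 := congrArg re h
  rw [trivialZero_re, trivialZero_re] at h1
  have h2 : ((p : ℕ) : ℝ) = (q : ℕ) := by linarith
  exact PNat.coe_injective (by exact_mod_cast h2)

/-- The zeros split into the nontrivial and the trivial ones; the latter are simple and so carry no
multiplicity. -/
theorem hasSum_order_riemannZeta₁ {φ : ℂ → ℂ}
    (h : Summable fun r => (analyticOrderNatAt riemannZeta₁ r : ℂ) * φ r) :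
    (Summable fun ρ : zetaZeros => (zeroMult riemannZeta ρ : ℂ) * φ ρ) ∧
    (Summable fun q : ℕ+ => φ (trivialZero q)) ∧
    HasSum (fun r => (analyticOrderNatAt riemannZeta₁ r : ℂ) * φ r)
      ((∑' ρ : zetaZeros, (zeroMult riemannZeta ρ : ℂ) * φ ρ) + ∑' q : ℕ+, φ (trivialZero q)) := by
  set Φ : ℂ → ℂ := fun r => (analyticOrderNatAt riemannZeta₁ r : ℂ) * φ r with hΦ
  have e1 : (fun ρ : zetaZeros => (zeroMult riemannZeta ρ : ℂ) * φ ρ) = Φ ∘ (↑) := by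
    funext ρ
    simp [hΦ, zeroMult_riemannZeta (zetaZeros_ne_one ρ.2)]
  have e2 : (fun q : ℕ+ => φ (trivialZero q)) = Φ ∘ trivialZero := by
    funext q
    simp [hΦ, analyticOrderNatAt_trivialZero q]
  have s1 : Summable fun ρ : zetaZeros => (zeroMult riemannZeta ρ : ℂ) * φ ρ :=
    e1 ▸ h.subtype zetaZeros
  have s2 : Summable fun q : ℕ+ => φ (trivialZero q) :=
    e2 ▸ h.comp_injective trivialZero_injective
  refine ⟨s1, s2, ?_⟩
  have hd : Disjoint zetaZeros (Set.range trivialZero) := by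
    refine Set.disjoint_left.2 fun r hr => ?_
    rintro ⟨q, rfl⟩
    exact absurd hr.2.1 (trivialZero_re_neg q).le.not_gt
  have t1 : HasSum (Φ ∘ ((↑) : zetaZeros → ℂ))
      (∑' ρ : zetaZeros, (zeroMult riemannZeta ρ : ℂ) * φ ρ) := e1 ▸ s1.hasSum
  have t2 : HasSum (Φ ∘ ((↑) : Set.range trivialZero → ℂ)) (∑' q : ℕ+, φ (trivialZero q)) := by
    refine (Equiv.ofInjective _ trivialZero_injective).hasSum_iff.1 ?_
    have := s2.hasSum
    rw [e2] at this ⊢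
    exact this
  refine (hasSum_subtype_iff_of_support_subset fun r hr => ?_).1 (t1.add_disjoint hd t2)
  by_cases h0 : riemannZeta₁ r = 0
  · rcases mem_zetaZeros_or_exists_trivialZero h0 with h1 | ⟨q, hq⟩
    · exact Or.inl h1
    · exact Or.inr ⟨q, hq.symm⟩
  · exact absurd (by simp [hΦ, analyticOrderNatAt_eq_zero_of_ne h0]) hr

theorem hasSum_order_riemannZeta₁_comp {φ : ℂ → ℂ} {a b : ℂ} (ha : a ≠ 0)
    (h : Summable fun u => (analyticOrderNatAt (fun w => riemannZeta₁ (a * w + b)) u : ℂ) * φ u) :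
    (Summable fun ρ : zetaZeros => (zeroMult riemannZeta ρ : ℂ) * φ ((ρ - b) / a)) ∧
    (Summable fun q : ℕ+ => φ ((trivialZero q - b) / a)) ∧
    HasSum (fun u => (analyticOrderNatAt (fun w => riemannZeta₁ (a * w + b)) u : ℂ) * φ u)
      ((∑' ρ : zetaZeros, (zeroMult riemannZeta ρ : ℂ) * φ ((ρ - b) / a))
        + ∑' q : ℕ+, φ ((trivialZero q - b) / a)) := by
  let e : ℂ ≃ ℂ :=
    { toFun := fun r => (r - b) / a
      invFun := fun u => a * u + b
      left_inv := fun r => by simp only; field_simp; ring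
      right_inv := fun u => by simp only; field_simp; ring }
  have he : ((fun u => (analyticOrderNatAt (fun w => riemannZeta₁ (a * w + b)) u : ℂ) * φ u) ∘ e)
      = fun r => (analyticOrderNatAt riemannZeta₁ r : ℂ) * φ ((r - b) / a) := by
    funext r
    simp only [Function.comp_apply, analyticOrderNatAt_comp_affine ha]
    exact congrArg (fun t => (analyticOrderNatAt riemannZeta₁ t : ℂ) * φ ((r - b) / a))
      (e.left_inv r)
  have h' := e.summable_iff.2 h
  rw [he] at h'
  obtain ⟨s1, s2, s3⟩ := hasSum_order_riemannZeta₁ (φ := fun r => φ ((r - b) / a)) h'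
  exact ⟨s1, s2, e.hasSum_iff.1 (he ▸ s3)⟩

theorem summable_prod_fin {α : Type*} {n : ℕ} {F : α × Fin n → ℂ}
    (h : ∀ j, Summable fun a => F (a, j)) :
    Summable F ∧ ∑' p, F p = ∑ j, ∑' a, F (a, j) := by
  have h1 : Summable (F ∘ Equiv.prodComm (Fin n) α) := by
    refine Summable.of_norm ((summable_prod_of_nonneg fun _ => norm_nonneg _).2 ⟨fun j => ?_, ?_⟩)
    · exact (h j).norm
    · exact Summable.of_finite
  refine ⟨(Equiv.summable_iff _).1 h1, ?_⟩
  rw [← (Equiv.prodComm (Fin n) α).tsum_eq F]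
  exact (h1.tsum_prod' fun j => h j).trans (tsum_fintype _)

theorem summable_toNat_sub_mul {m n : ℂ → ℕ} {φ : ℂ → ℂ} (hm : Summable fun u => (m u : ℂ) * φ u) :
    Summable fun u => ((((m u : ℤ) - n u).toNat : ℕ) : ℂ) * φ u := by
  refine Summable.of_norm_bounded hm.norm fun u => ?_
  rw [norm_mul, norm_mul, norm_natCast, norm_natCast]
  refine mul_le_mul_of_nonneg_right ?_ (norm_nonneg _)
  exact_mod_cast (by omega : ((m u : ℤ) - n u).toNat ≤ m u)

/-- The zero and pole multiplicities are the positive and negative parts of `ord f - ord g`. Common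
zeros of `f` and `g` cancel, and each part is dominated by one of the two orders, hence summable. -/
theorem hasSum_order_K {T₁ T₂ z : ℝ} {f g φ : ℂ → ℂ}
    (ho : ∀ u, meromorphicOrderAt (K T₁ T₂ z) u
      = (((analyticOrderNatAt f u : ℤ) - analyticOrderNatAt g u : ℤ) : WithTop ℤ))
    (hf : Summable fun u => (analyticOrderNatAt f u : ℂ) * φ u)
    (hg : Summable fun u => (analyticOrderNatAt g u : ℂ) * φ u) :
    (Summable fun r : zerosK T₁ T₂ z => (zeroMult (K T₁ T₂ z) r : ℂ) * φ r) ∧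
    (Summable fun ν : polesK T₁ T₂ z => (poleMult (K T₁ T₂ z) ν : ℂ) * φ ν) ∧
    HasSum (fun u => (analyticOrderNatAt f u : ℂ) * φ u - (analyticOrderNatAt g u : ℂ) * φ u)
      ((∑' r : zerosK T₁ T₂ z, (zeroMult (K T₁ T₂ z) r : ℂ) * φ r)
        - ∑' ν : polesK T₁ T₂ z, (poleMult (K T₁ T₂ z) ν : ℂ) * φ ν) := by
  have ez : ∀ u, zeroMult (K T₁ T₂ z) u
      = ((analyticOrderNatAt f u : ℤ) - analyticOrderNatAt g u).toNat := fun u => by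
    rw [zeroMult, ho, WithTop.untop₀_coe]
  have ep : ∀ u, poleMult (K T₁ T₂ z) u
      = ((analyticOrderNatAt g u : ℤ) - analyticOrderNatAt f u).toNat := fun u => by
    rw [poleMult, ho, WithTop.untop₀_coe, neg_sub]
  have sz : Summable fun u => (zeroMult (K T₁ T₂ z) u : ℂ) * φ u := by
    simp only [ez]
    exact summable_toNat_sub_mul hf
  have sp : Summable fun u => (poleMult (K T₁ T₂ z) u : ℂ) * φ u := by
    simp only [ep]
    exact summable_toNat_sub_mul hg
  refine ⟨sz.subtype _, sp.subtype _, ?_⟩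
  have tz : ∑' r : zerosK T₁ T₂ z, (zeroMult (K T₁ T₂ z) r : ℂ) * φ r
      = ∑' u, (zeroMult (K T₁ T₂ z) u : ℂ) * φ u := by
    refine tsum_subtype_eq_of_support_subset
      (f := fun u => (zeroMult (K T₁ T₂ z) u : ℂ) * φ u) fun u hu => ?_
    have h1 : zeroMult (K T₁ T₂ z) u ≠ 0 := fun h => hu (by simp [h])
    rw [ez] at h1
    rw [zerosK, Set.mem_ofPred_eq, ho, ← WithTop.coe_zero, WithTop.coe_lt_coe]
    omega
  have tp : ∑' ν : polesK T₁ T₂ z, (poleMult (K T₁ T₂ z) ν : ℂ) * φ ν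
      = ∑' u, (poleMult (K T₁ T₂ z) u : ℂ) * φ u := by
    refine tsum_subtype_eq_of_support_subset
      (f := fun u => (poleMult (K T₁ T₂ z) u : ℂ) * φ u) fun u hu => ?_
    have h1 : poleMult (K T₁ T₂ z) u ≠ 0 := fun h => hu (by simp [h])
    rw [ep] at h1
    rw [polesK, Set.mem_ofPred_eq, ho, ← WithTop.coe_zero, WithTop.coe_lt_coe]
    omega
  rw [tz, tp]
  refine HasSum.of_eq (sz.hasSum.sub sp.hasSum) (fun u => ?_) rfl
  rw [← sub_mul, ← sub_mul]
  congr 1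
  have : (analyticOrderNatAt f u : ℤ) - analyticOrderNatAt g u
      = zeroMult (K T₁ T₂ z) u - poleMult (K T₁ T₂ z) u := by
    rw [ez, ep]
    omega
  exact_mod_cast congrArg (Int.cast : ℤ → ℂ) this

/-! ### The expansion of `Z'/Z` -/

/-- The order of `Z`, described through the orders of its entire factors. -/
noncomputable def orderZ (T₁ T₂ : ℝ) (f g : ℂ → ℂ) (u : ℂ) : ℂ :=
  (∑ j, (analyticOrderNatAt (fun w => riemannZeta₁ (1 * w + -(shift T₁ T₂ j))) u : ℂ))
      + (if u = half T₁ T₂ 1 then 1 else 0) + analyticOrderNatAt f u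
    - ((∑ j, if u = 1 + shift T₁ T₂ j then 1 else 0)
      + analyticOrderNatAt (fun w => riemannZeta₁ (2 * w + -(I * (T₁ - T₂)))) u
      + analyticOrderNatAt g u)

theorem hasExpansion_riemannZeta₁_sub_shift {T₁ T₂ : ℝ} {s : ℂ} {j : Fin 4}
    (h : riemannZeta₁ (s - shift T₁ T₂ j) ≠ 0) :
    HasExpansion s 1 (logDeriv fun w => riemannZeta₁ (1 * w + -(shift T₁ T₂ j)))
      fun u => (analyticOrderNatAt (fun w => riemannZeta₁ (1 * w + -(shift T₁ T₂ j))) u : ℂ) := by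
  refine (quadGrowth_riemannZeta₁.comp_affine 1 (-(shift T₁ T₂ j))).hasExpansion ?_ fun w hw => ?_
  · rwa [one_mul, ← sub_eq_add_neg]
  · rw [one_mul, ← sub_eq_add_neg]
    exact riemannZeta₁_ne_zero_of_one_le_re (by rw [sub_re, shift_re]; linarith)

theorem hasExpansion_riemannZeta₁_two_mul_sub {T₁ T₂ : ℝ} {s : ℂ}
    (h : riemannZeta₁ (2 * s - I * (T₁ - T₂)) ≠ 0) :
    HasExpansion s 1 (logDeriv fun w => riemannZeta₁ (2 * w + -(I * (T₁ - T₂))))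
      fun u => (analyticOrderNatAt (fun w => riemannZeta₁ (2 * w + -(I * (T₁ - T₂)))) u : ℂ) := by
  refine (quadGrowth_riemannZeta₁.comp_affine 2 (-(I * (T₁ - T₂)))).hasExpansion ?_ fun w hw => ?_
  · rwa [← sub_eq_add_neg]
  · rw [← sub_eq_add_neg]
    exact riemannZeta₁_ne_zero_of_one_le_re (by rw [two_mul_sub_re]; linarith)

/-- The expansions of the factors combine linearly; `logDeriv_Z` identifies the combination with
`Z'/Z` both in the half-plane and at `s`, where it supplies the constant term. -/
theorem hasExpansion_logDeriv_Z {T₁ T₂ z : ℝ} {f g : ℂ → ℂ} (hf : QuadGrowth f) (hg : QuadGrowth g)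
    (hK : ∀ u, ∀ᶠ w in 𝓝[≠] u, K T₁ T₂ z w = f w / g w) {s : ℂ}
    (h1 : ∀ j, s ≠ 1 + shift T₁ T₂ j) (h2 : s ≠ half T₁ T₂ 1)
    (h3 : riemannZeta₁ (2 * s - I * (T₁ - T₂)) ≠ 0)
    (h5 : ∀ j, riemannZeta₁ (s - shift T₁ T₂ j) ≠ 0) (hfs : f s ≠ 0) (hgs : g s ≠ 0) {B : ℝ}
    (hB1 : 1 ≤ B) (hB : ∀ w : ℂ, B < w.re → f w ≠ 0 ∧ g w ≠ 0) :
    HasExpansion s B (logDeriv (Z T₁ T₂ z)) (orderZ T₁ T₂ f g) := by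
  have z1 : ∀ w : ℂ, B < w.re → ∀ j, riemannZeta₁ (w - shift T₁ T₂ j) ≠ 0 := fun w hw j =>
    riemannZeta₁_ne_zero_of_one_le_re (by rw [sub_re, shift_re]; linarith)
  have z2 : ∀ w : ℂ, B < w.re → riemannZeta₁ (2 * w - I * (T₁ - T₂)) ≠ 0 := fun w hw =>
    riemannZeta₁_ne_zero_of_one_le_re (by rw [two_mul_sub_re]; linarith)
  have E1 := HasExpansion.sum Finset.univ fun j =>
    (hasExpansion_riemannZeta₁_sub_shift (h5 j)).mono hB1
  have E2 := hasExpansion_inv_sub (B := B) h2 (by rw [half_re]; norm_num; linarith)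
  have E3 := hf.hasExpansion hfs fun w hw => (hB w hw).1
  have E4 := HasExpansion.sum Finset.univ fun j =>
    hasExpansion_inv_sub (B := B) (h1 j) (by rw [add_re, shift_re]; simpa using hB1)
  have E5 := (hasExpansion_riemannZeta₁_two_mul_sub h3).mono hB1
  have E6 := hg.hasExpansion hgs fun w hw => (hB w hw).2
  refine (((E1.add E2).add E3).sub ((E4.add E5).add E6)).congr ?_ (fun w hw => ?_) fun u => rfl
  · rw [logDeriv_Z hf.diff hg.diff (hK s) h1 h2 h3 h5 hfs hgs]
    simp only [one_mul, ← sub_eq_add_neg]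
  · have hw1 : 1 < w.re := by linarith
    rw [logDeriv_Z hf.diff hg.diff (hK w) (ne_one_add_shift hw1) (ne_half_one hw1) (z2 w hw)
      (z1 w hw) (hB w hw).1 (hB w hw).2]
    simp only [one_mul, ← sub_eq_add_neg]

end Motohashi

namespace Motohashi

/-! ### Regrouping the sum over zeros and poles into the families of the theorem -/

theorem hasSum_ite_mul (φ : ℂ → ℂ) (a : ℂ) :
    HasSum (fun u => (if u = a then 1 else 0) * φ u) (φ a) :=
  HasSum.of_eq (hasSum_ite_eq a (φ a)) (fun u => by split_ifs with h <;> simp [h]) rfl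

/-- In the application `φ` is the kernel. Zeros of the numerator factors of `Z` count positively and
those of the denominator factors negatively. -/
theorem tsum_orderZ_mul {T₁ T₂ z : ℝ} {f g φ : ℂ → ℂ}
    (ho : ∀ u, meromorphicOrderAt (K T₁ T₂ z) u
      = (((analyticOrderNatAt f u : ℤ) - analyticOrderNatAt g u : ℤ) : WithTop ℤ))
    (hf : Summable fun u => (analyticOrderNatAt f u : ℂ) * φ u)
    (hg : Summable fun u => (analyticOrderNatAt g u : ℂ) * φ u)
    (h1 : ∀ j, Summable fun u =>
      (analyticOrderNatAt (fun w => riemannZeta₁ (1 * w + -(shift T₁ T₂ j))) u : ℂ) * φ u)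
    (h2 : Summable fun u =>
      (analyticOrderNatAt (fun w => riemannZeta₁ (2 * w + -(I * (T₁ - T₂)))) u : ℂ) * φ u) :
    (Summable fun ρ : zetaZeros => (zeroMult riemannZeta ρ : ℂ) * φ (half T₁ T₂ ρ)) ∧
    (Summable fun q : ℕ+ => φ (half T₁ T₂ (trivialZero q))) ∧
    (Summable fun ν : polesK T₁ T₂ z => (poleMult (K T₁ T₂ z) ν : ℂ) * φ ν) ∧
    (Summable fun a : zetaZeros × Fin 4 =>
      (zeroMult riemannZeta a.1 : ℂ) * φ (a.1 + shift T₁ T₂ a.2)) ∧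
    (Summable fun a : ℕ+ × Fin 4 => φ (trivialZero a.1 + shift T₁ T₂ a.2)) ∧
    (Summable fun r : zerosK T₁ T₂ z => (zeroMult (K T₁ T₂ z) r : ℂ) * φ r) ∧
    ∑' u, orderZ T₁ T₂ f g u * φ u =
      (φ (half T₁ T₂ 1)
        + (∑' a : zetaZeros × Fin 4, (zeroMult riemannZeta a.1 : ℂ) * φ (a.1 + shift T₁ T₂ a.2))
        + (∑' a : ℕ+ × Fin 4, φ (trivialZero a.1 + shift T₁ T₂ a.2))
        + ∑' r : zerosK T₁ T₂ z, (zeroMult (K T₁ T₂ z) r : ℂ) * φ r)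
      - ((∑ j, φ (1 + shift T₁ T₂ j))
        + (∑' ρ : zetaZeros, (zeroMult riemannZeta ρ : ℂ) * φ (half T₁ T₂ ρ))
        + (∑' q : ℕ+, φ (half T₁ T₂ (trivialZero q)))
        + ∑' ν : polesK T₁ T₂ z, (poleMult (K T₁ T₂ z) ν : ℂ) * φ ν) := by
  obtain ⟨k1, k2, k3⟩ := hasSum_order_K ho hf hg
  have e1 : ∀ (r : ℂ) j, (r - -(shift T₁ T₂ j)) / 1 = r + shift T₁ T₂ j := fun r j => by ring
  have e2 : ∀ r : ℂ, (r - -(I * (T₁ - T₂))) / 2 = half T₁ T₂ r := fun r => by rw [half]; ring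
  have A := fun j => hasSum_order_riemannZeta₁_comp one_ne_zero (h1 j)
  obtain ⟨b1, b2, b3⟩ := hasSum_order_riemannZeta₁_comp two_ne_zero h2
  simp only [e1] at A
  simp only [e2] at b1 b2 b3
  obtain ⟨p1, p2⟩ := summable_prod_fin (F := fun a : zetaZeros × Fin 4 =>
    (zeroMult riemannZeta a.1 : ℂ) * φ (a.1 + shift T₁ T₂ a.2)) fun j => (A j).1
  obtain ⟨q1, q2⟩ := summable_prod_fin (F := fun a : ℕ+ × Fin 4 =>
    φ (trivialZero a.1 + shift T₁ T₂ a.2)) fun j => (A j).2.1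
  refine ⟨b1, b2, k2, p1, q1, k1, HasSum.tsum_eq ?_⟩
  refine HasSum.of_eq ((((hasSum_sum fun j (_ : j ∈ Finset.univ) => (A j).2.2).add
    (hasSum_ite_mul φ (half T₁ T₂ 1))).add k3).sub
    ((hasSum_sum fun j (_ : j ∈ Finset.univ) => hasSum_ite_mul φ (1 + shift T₁ T₂ j)).add b3))
    (fun u => ?_) ?_
  · simp only [orderZ, ← Finset.sum_mul]
    ring
  · rw [p2, q2, Finset.sum_add_distrib]
    ring

theorem riemannZeta₁_sub_shift_ne_zero {T₁ T₂ : ℝ} {s : ℂ}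
    (hρ : ∀ ρ ∈ zetaZeros, ∀ j, s ≠ ρ + shift T₁ T₂ j)
    (hq : ∀ q : ℕ+, ∀ j, s ≠ trivialZero q + shift T₁ T₂ j) (j : Fin 4) :
    riemannZeta₁ (s - shift T₁ T₂ j) ≠ 0 := fun h => by
  rcases mem_zetaZeros_or_exists_trivialZero h with h1 | ⟨q, h1⟩
  · exact hρ _ h1 j (sub_add_cancel _ _).symm
  · exact hq q j (by rw [← h1, sub_add_cancel])

theorem riemannZeta₁_two_mul_sub_ne_zero {T₁ T₂ : ℝ} {s : ℂ}
    (hρ : ∀ ρ ∈ zetaZeros, s ≠ half T₁ T₂ ρ) (hq : ∀ q : ℕ+, s ≠ half T₁ T₂ (trivialZero q)) :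
    riemannZeta₁ (2 * s - I * (T₁ - T₂)) ≠ 0 := fun h => by
  have e : s = half T₁ T₂ (2 * s - I * (T₁ - T₂)) := by rw [half]; ring
  rcases mem_zetaZeros_or_exists_trivialZero h with h1 | ⟨q, h1⟩
  · exact hρ _ h1 e
  · exact hq q (h1 ▸ e)

end Motohashi

/-! ### Assembly of the three parts -/

theorem mainTheorem1 (T₁ T₂ z : ℝ) (hz : 1 < z) :
    -- the logarithmic derivative of `Z` has a Dirichlet series, starting at `n = 2`
    (∃ c : ℕ → ℂ, c 1 = 0 ∧ Motohashi.IsLogDerivCoeff T₁ T₂ z c) ∧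
    -- the shape of the poles of `K`
    (∀ ν ∈ Motohashi.polesK T₁ T₂ z, ∃ (p : ℕ) (k : ℤ), p.Prime ∧ (p : ℝ) < z ^ 2 ∧
      ν = Complex.I * (Real.pi * k / Real.log p + 1 / 2 * (T₁ - T₂))) ∧
    -- the explicit formula
    ∀ c : ℕ → ℂ, Motohashi.IsLogDerivCoeff T₁ T₂ z c →
      ∀ x : ℝ, 1 < x → ∀ s : ℂ,
        (∀ j, s ≠ 1 + Motohashi.shift T₁ T₂ j) →
        s ≠ Motohashi.half T₁ T₂ 1 →
        (∀ ρ ∈ Motohashi.zetaZeros, ∀ j, s ≠ ρ + Motohashi.shift T₁ T₂ j) →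
        (∀ ρ ∈ Motohashi.zetaZeros, s ≠ Motohashi.half T₁ T₂ ρ) →
        (∀ q : ℕ+, ∀ j, s ≠ Motohashi.trivialZero q + Motohashi.shift T₁ T₂ j) →
        (∀ q : ℕ+, s ≠ Motohashi.half T₁ T₂ (Motohashi.trivialZero q)) →
        s ∉ Motohashi.polesK T₁ T₂ z →
        s ∉ Motohashi.zerosK T₁ T₂ z →
        -- all the infinite sums converge absolutely
        Summable (fun ρ : Motohashi.zetaZeros =>
          (Motohashi.zeroMult riemannZeta ρ : ℂ) *
            Motohashi.kernel x s (Motohashi.half T₁ T₂ ρ)) ∧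
        Summable (fun q : ℕ+ =>
          Motohashi.kernel x s (Motohashi.half T₁ T₂ (Motohashi.trivialZero q))) ∧
        Summable (fun ν : Motohashi.polesK T₁ T₂ z =>
          (Motohashi.poleMult (Motohashi.K T₁ T₂ z) ν : ℂ) * Motohashi.kernel x s ν) ∧
        Summable (fun a : Motohashi.zetaZeros × Fin 4 =>
          (Motohashi.zeroMult riemannZeta a.1 : ℂ) *
            Motohashi.kernel x s (a.1 + Motohashi.shift T₁ T₂ a.2)) ∧
        Summable (fun a : ℕ+ × Fin 4 =>
          Motohashi.kernel x s (Motohashi.trivialZero a.1 + Motohashi.shift T₁ T₂ a.2)) ∧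
        Summable (fun r : Motohashi.zerosK T₁ T₂ z =>
          (Motohashi.zeroMult (Motohashi.K T₁ T₂ z) r : ℂ) * Motohashi.kernel x s r) ∧
        logDeriv (Motohashi.Z T₁ T₂ z) s =
          (∑ n ∈ Finset.Ico 1 ⌈x ^ 3⌉₊, Motohashi.smoothed x c n / (n : ℂ) ^ s)
          + ((∑ j : Fin 4, Motohashi.kernel x s (1 + Motohashi.shift T₁ T₂ j))
            + (∑' ρ : Motohashi.zetaZeros, (Motohashi.zeroMult riemannZeta ρ : ℂ) *
                Motohashi.kernel x s (Motohashi.half T₁ T₂ ρ))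
            + (∑' q : ℕ+, Motohashi.kernel x s
                (Motohashi.half T₁ T₂ (Motohashi.trivialZero q)))
            + ∑' ν : Motohashi.polesK T₁ T₂ z,
                (Motohashi.poleMult (Motohashi.K T₁ T₂ z) ν : ℂ) * Motohashi.kernel x s ν)
          - (Motohashi.kernel x s (Motohashi.half T₁ T₂ 1)
            + (∑' a : Motohashi.zetaZeros × Fin 4, (Motohashi.zeroMult riemannZeta a.1 : ℂ) *
                Motohashi.kernel x s (a.1 + Motohashi.shift T₁ T₂ a.2))
            + (∑' a : ℕ+ × Fin 4, Motohashi.kernel x s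
                (Motohashi.trivialZero a.1 + Motohashi.shift T₁ T₂ a.2))
            + ∑' r : Motohashi.zerosK T₁ T₂ z,
                (Motohashi.zeroMult (Motohashi.K T₁ T₂ z) r : ℂ) * Motohashi.kernel x s r) := by
  refine ⟨Motohashi.exists_isLogDerivCoeff T₁ T₂ hz, fun ν hν => Motohashi.exists_prime_of_mem_polesK hν, ?_⟩
  intro c ⟨σ₀, hc⟩ x hx s h1 h2 h3 h4 h5 h6 h7 h8
  obtain ⟨f, g, hf, hg, hfs, hgs, ⟨σ, hσ⟩, hK, ho⟩ := Motohashi.exists_K_eq_div T₁ T₂ hz h7 h8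
  have n1 := Motohashi.riemannZeta₁_sub_shift_ne_zero h3 h5
  have n2 := Motohashi.riemannZeta₁_two_mul_sub_ne_zero h4 h6
  have hB : ∀ w : ℂ, max σ 1 < w.re → f w ≠ 0 ∧ g w ≠ 0 := fun w hw =>
    hσ w (lt_of_le_of_lt (le_max_left _ _) hw)
  have hE := Motohashi.hasExpansion_logDeriv_Z hf hg hK h1 h2 n2 n1 hfs hgs (le_max_right σ 1) hB
  obtain ⟨s1, s2, s3, s4, s5, s6, hsum⟩ := Motohashi.tsum_orderZ_mul ho
    ((hf.hasExpansion hfs fun w hw => (hB w hw).1).summable_kernel hx)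
    ((hg.hasExpansion hgs fun w hw => (hB w hw).2).summable_kernel hx)
    (fun j => (Motohashi.hasExpansion_riemannZeta₁_sub_shift (n1 j)).summable_kernel hx)
    ((Motohashi.hasExpansion_riemannZeta₁_two_mul_sub n2).summable_kernel hx)
  refine ⟨s1, s2, s3, s4, s5, s6, ?_⟩
  -- The general formula subtracts the sum over orders, so poles of `Z` enter with a plus sign and
  -- zeros with a minus sign.
  rw [hE.explicit_formula hc hx, hsum]
  ring
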